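/- **Notation.** Let $\widehat f(\xi)=\mathcal F f(\xi)=\int_{\mathbb R^d} f(x)e^{-2\pi i\langle x,\xi\rangle}\,dx$ on $\mathbb R^d$, let $T_y h=h(\cdot-y)$, and let $\mathcal O\subset\mathbb R^d$ be an open set whose complement is a null set. *Cover, weight, partition of unity.* Let $\mathcal Q=(Q_i)_{i\in I}$ be a family of non-empty sets with $\bigcup_i Q_i=\mathcal O$ and $\sup_i |i^*|<\infty$, where $i^*=\{\ell\in I: Q_\ell\cap Q_i\neq\emptyset\}$. Let $w=(w_i)_{i\in I}$ be a $\mathcal Q$-moderate weight: $w_i>0$ and $w_i/w_\ell\le C$ for all $i\in I$, $\ell\in i^*$. Let $\Phi=(\varphi_i)_{i\in I}$ be a bounded admissible partition of unity: $\varphi_i\in C_c^\infty(\mathcal O)$, $\varphi_i=0$ on $\mathcal O\setminus Q_i$, $\sum_i\varphi_i=1$ on $\mathcal O$, and $C_\Phi:=\sup_i\|\mathcal F^{-1}\varphi_i\|_{L^1}<\infty$. Put $\varphi_i^*=\sum_{\ell\in i^*}\varphi_\ell$. Let $\|c\|_{\ell^q_w}=\|(w_ic_i)_i\|_{\ell^q}$,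 and let $\|\Gamma_{\mathcal Q}\|$ be the operator norm on $\ell^q_w(I)$ of $(c_i)_i\mapsto(\sum_{\ell\in i^*}c_\ell)_i$. The Schur norm of a matrix is $\|M\|_{\mathrm{Schur}}=\max\{\sup_i\sum_j|M_{i,j}|,\ \sup_j\sum_i|M_{i,j}|\}$; $M$ is of Schur type if this is finite. *Spaces.* Let $Z(\mathcal O)=\mathcal F(C_c^\infty(\mathcal O))$, with the topology that makes $\mathcal F:C_c^\infty(\mathcal O)\to Z(\mathcal O)$ a homeomorphism, and let $Z'(\mathcal O)$ be its topological dual with the weak-$*$ topology. The map $\widehat f:=f\circ\mathcal F$ is a bijection $Z'(\mathcal O)\to\mathcal D'(\mathcal O)$, with inverse $\mathcal F^{-1}$. A function $u\in L^r$, $1\le r\le\infty$, is identified with $\psi\mapsto\int u\psi$ in $Z'(\mathcal O)$. For $p,q\in[1,\infty]$ and $f\in Z'(\mathcal O)$ let $\|f\|_{\mathcal D(\mathcal Q,L^p,\ell^q_w)}=\big\|\big(\|\mathcal F^{-1}(\varphi_i\widehat f)\|_{L^p}\big)_i\big\|_{\ell^q_w}\in[0,\infty]$, and let $\mathcal D(\mathcal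 Q,L^p,\ell^q_w)$ be the space of all $f$ for which this is finite. Let $\mathcal S_{\mathcal O}=\mathcal F^{-1}(C_c^\infty(\mathcal O))$. *System.* Let $J$ be countable and, for $j\in J$, let $C_j\in GL(d,\mathbb R)$ and $g_j\in L^1\cap L^2$ with $\widehat{g_j}\in C^\infty(\mathbb R^d)$, such that for some constants $A,B>0$ one has $A\le\sum_j|\det C_j|^{-1}|\widehat{g_j}(\xi)|^2\le B$ for almost every $\xi$. Let $\Lambda=\bigcup_jC_j^{-t}\mathbb Z^d$ and, for $\alpha\in\mathbb R^d$, $$t_\alpha(\xi)=\sum_{j:\ \alpha\in C_j^{-t}\mathbb Z^d}\frac1{|\det C_j|}\overline{\widehat{g_j}(\xi)}\,\widehat{g_j}(\xi+\alpha).$$ The system satisfies the *$\alpha$-local integrability condition* ($\alpha$-LIC) if $$\sum_{j}\frac1{|\det C_j|}\sum_{\alpha\in C_j^{-t}\mathbb Z^d}\int_{\mathbb R^d}\big|\widehat f(\xi)\widehat f(\xi+\alpha)\widehat{g_j}(\xi)\widehat{g_j}(\xi+\alpha)\big|\,d\xi<\infty$$ for every $f\in L^2$ such that $\widehat f$ is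 bounded and vanishes almost everywhere outside some compact subset of $\mathcal O$. For $f\in\mathcal S_{\mathcal O}$ the *remainder* is $Rf=\mathcal F^{-1}\big(\sum_{\alpha\in\Lambda\setminus\{0\}}T_\alpha(t_\alpha\widehat f)\big)$. Define matrices on $I\times I$ by $$N_{i,\ell}=\frac{w_i}{w_\ell}\sum_{\alpha\in\Lambda\setminus\{0\}}\big\|\mathcal F^{-1}\big(\varphi_i(\cdot+\alpha)\,t_\alpha\,\varphi_\ell\big)\big\|_{L^1},$$ $$\widetilde N_{i,\ell}=\max\Big\{1,\frac{w_i}{w_\ell}\Big\}\sum_j\frac1{|\det C_j|}\sum_{\alpha\in C_j^{-t}\mathbb Z^d\setminus\{0\}}\big\|\mathcal F^{-1}\big(\varphi_i(\cdot-\alpha)\,\overline{\widehat{g_j}}\,\widehat{g_j}(\cdot-\alpha)\,\varphi_\ell\big)\big\|_{L^1}.$$ The function $t_0$ is *tame* if $\sup_i\|\mathcal F^{-1}(\varphi_it_0)\|_{L^1}<\infty$. For a weight $v=(v_j)_j$ with $v_j>0$, the system is *$(w,v,\Phi)$-adapted* if the $I\times J$ matrix with entries $$\max\Big\{\frac{w_i}{v_j},\frac{v_j}{w_i}\Big\}\,|\det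 C_j|^{1/2}\,\big\|\big((\mathcal F^{-1}\varphi_i)*g_j\big)\circ C_j\big\|_{W(L^\infty,\ell^1)}$$ is of Schur type, where $\|h\|_{W(L^\infty,\ell^1)}=\sum_{n\in\mathbb Z^d}\|h\|_{L^\infty(n+[0,1]^d)}$. The extended inner product is $\langle f\,|\,g\rangle_\Phi=\sum_i\langle\widehat f\,|\,\varphi_i\widehat g\rangle$ with $\langle T\,|\,\varphi\rangle=T(\overline\varphi)$, whenever this series converges absolutely. **Theorem.** (a) Assume the $\alpha$-LIC and that $N$ is of Schur type. Then for all $p,q\in[1,\infty]$ and all $f\in\mathcal S_{\mathcal O}$ the series defining $Rf$ converges unconditionally in $\mathcal D'(\mathcal O)$, and $$\|Rf\|_{\mathcal D(\mathcal Q,L^p,\ell^q_w)}\le\|N\|_{\mathrm{Schur}}\,\|\Gamma_{\mathcal Q}\|\,\|f\|_{\mathcal D(\mathcal Q,L^p,\ell^q_w)}.$$ (b) Assume in addition that $t_0$ is continuous on $\mathcal O$ and tame, and that the system is $(w,v,\Phi)$-adapted for some weight $v$. Then for all $p,q\in[1,\infty]$ the frame operator $$Sf=\sum_{j\in J}\sum_{k\in\mathbb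 Z^d}\langle f\,|\,T_{C_jk}g_j\rangle_\Phi\,T_{C_jk}g_j$$ and the Fourier multiplier $$T_0f=\sum_{i\in I}\big[\mathcal F^{-1}(\varphi_i^*t_0)\big]*\big[\mathcal F^{-1}(\varphi_i\widehat f\,)\big]$$ are well-defined bounded linear operators on $\mathcal D(\mathcal Q,L^p,\ell^q_w)$ (all the extended inner products converge absolutely, and both series converge unconditionally in $Z'(\mathcal O)$). Moreover $\mathcal S_{\mathcal O}\subset\mathcal D(\mathcal Q,L^p,\ell^q_w)$ and $S=T_0+R_0$ with a bounded linear operator $R_0$ on $\mathcal D(\mathcal Q,L^p,\ell^q_w)$ that satisfies $R_0f=Rf$ for $f\in\mathcal S_{\mathcal O}$ and $$\|R_0\|\le C_{p,q}\,\|N\|_{\mathrm{Schur}}\,\|\Gamma_{\mathcal Q}\|,$$ where $C_{p,q}=1$ if $\max\{p,q\}<\infty$, and $C_{p,q}=C_\Phi\|\Gamma_{\mathcal Q}\|^2$ otherwise. (c) If $\widetilde N$ is of Schur type, then the $\alpha$-LIC holds and $\|N\|_{\mathrm{Schur}}\le\|\widetilde N\|_{\mathrm{Schur}}$; in particular the hypotheses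 of (a) hold. -/

import Mathlib

open MeasureTheory TopologicalSpace
open scoped ENNReal NNReal FourierTransform SchwartzMap Distributions ContDiff Convolution
  ComplexConjugate

noncomputable section

/-- Euclidean space `ℝ^d`, used both as the time and as the frequency domain. The Fourier transform
is Mathlib's `𝓕 f ξ = ∫ x, exp (-2 π i ⟪x, ξ⟫) f x`. -/
abbrev Eucl (d : ℕ) : Type := EuclideanSpace ℝ (Fin d)

variable {d : ℕ} {Ω : Opens (Eucl d)} {I J : Type*}

/-! ### Test functions -/

/-- The inclusion of `C_c^∞(Ω)` into the Schwartz space. -/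
def testToSchwartz (Ω : Opens (Eucl d)) : 𝓓(Ω, ℂ) →ₗ[ℂ] 𝓢(Eucl d, ℂ) where
  toFun φ := φ.hasCompactSupport.toSchwartzMap φ.contDiff
  map_add' _ _ := by ext; rfl
  map_smul' _ _ := by ext; rfl

theorem continuous_testToSchwartz (Ω : Opens (Eucl d)) :
    Continuous (testToSchwartz Ω) := by
  rw [TestFunction.continuous_iff_continuous_comp]
  intro K hK
  let T : 𝓓_{K}(Eucl d, ℂ) →ₗ[ℝ] 𝓢(Eucl d, ℂ) :=
    { toFun := fun f => testToSchwartz Ω (TestFunction.ofSupportedIn hK f)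
      map_add' := fun _ _ => by ext; rfl
      map_smul' := fun _ _ => by ext; rfl }
  change Continuous T
  refine WithSeminorms.continuous_of_isBounded
    (ContDiffMapSupportedIn.withSeminorms ℝ (Eucl d) ℂ ⊤ K)
    (schwartz_withSeminorms ℝ (Eucl d) ℂ) T ?_
  rintro ⟨k, n⟩
  obtain ⟨R, hR⟩ := K.isCompact.isBounded.exists_norm_le
  refine ⟨{n}, ⟨(max R 0) ^ k, by positivity⟩, fun f => ?_⟩
  refine SchwartzMap.seminorm_le_bound ℝ k n _ (by positivity) fun x => ?_
  change ‖x‖ ^ k * ‖iteratedFDeriv ℝ n f x‖ ≤ _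
  by_cases hx : x ∈ K
  · have h1 := ContDiffMapSupportedIn.norm_iteratedFDeriv_apply_le_seminorm_top (𝕜 := ℝ) (f := f)
      (x := x) (i := n)
    simp only [Finset.sup_singleton]
    change _ ≤ (max R 0) ^ k * _
    gcongr
    exact (hR x hx).trans (le_max_left _ _)
  · have : iteratedFDeriv ℝ n f x = 0 := f.iteratedFDeriv_zero_on_compl hx
    rw [this]
    simp only [norm_zero, mul_zero]
    positivity

/-- The product of a test function with a smooth function. -/
def TestFunction.mulSmooth (φ : 𝓓(Ω, ℂ)) (h : Eucl d → ℂ) (hh : ContDiff ℝ ∞ h) : 𝓓(Ω, ℂ) where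
  toFun ξ := φ ξ * h ξ
  contDiff' := φ.contDiff.mul hh
  hasCompactSupport' := φ.hasCompactSupport.mul_right
  tsupport_subset' := (tsupport_mul_subset_left).trans φ.tsupport_subset

/-- The complex conjugate of a test function. -/
def conjTest (φ : 𝓓(Ω, ℂ)) : 𝓓(Ω, ℂ) :=
  TestFunction.postcompCLM (𝕜 := ℝ) (Complex.conjCLE : ℂ →L[ℝ] ℂ) φ

/-- The exponential `e_x(ξ) = exp (2 π i ⟪x, ξ⟫)`. -/
def planeWave (x ξ : Eucl d) : ℂ := Complex.exp (2 * Real.pi * Complex.I * inner ℝ x ξ)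

theorem contDiff_planeWave_uncurry :
    ContDiff ℝ ∞ (fun p : Eucl d × Eucl d => planeWave p.1 p.2) := by
  unfold planeWave
  refine Complex.contDiff_exp.comp ?_ |>.of_le le_rfl
  refine contDiff_const.mul ?_
  exact Complex.ofRealCLM.contDiff.comp (contDiff_fst.inner ℝ contDiff_snd)

theorem contDiff_planeWave (x : Eucl d) : ContDiff ℝ ∞ (planeWave x) :=
  contDiff_planeWave_uncurry.comp (contDiff_const.prodMk contDiff_id)

theorem continuous_mulSmooth_planeWave (φ : 𝓓(Ω, ℂ)) :
    Continuous (fun x : Eucl d => φ.mulSmooth (planeWave x) (contDiff_planeWave x)) := by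
  let K : Compacts (Eucl d) := ⟨tsupport φ, φ.hasCompactSupport⟩
  have hK : (K : Set (Eucl d)) ⊆ Ω := φ.tsupport_subset
  let ψ : Eucl d → 𝓓_{K}(Eucl d, ℂ) := fun x =>
    .of_support_subset (f := fun ξ => φ ξ * planeWave x ξ)
      (φ.contDiff.mul (contDiff_planeWave x))
      (fun ξ hξ => subset_closure (fun h => hξ (by simp [h])))
  have hψ : Continuous ψ := by
    rw [ContDiffMapSupportedIn.continuous_iff_comp]
    intro i
    let G : Eucl d × Eucl d → ℂ := fun p => φ p.2 * planeWave p.1 p.2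
    have hG : ContDiff ℝ ∞ G := (φ.contDiff.comp contDiff_snd).mul contDiff_planeWave_uncurry
    have key : ∀ x ξ, iteratedFDeriv ℝ i (ψ x) ξ =
        (iteratedFDeriv ℝ i G (x, ξ)).compContinuousLinearMap
          (fun _ => ContinuousLinearMap.inr ℝ (Eucl d) (Eucl d)) := by
      intro x ξ
      have h1 : (ψ x : Eucl d → ℂ) =
          (fun p => G (p + (x, 0))) ∘ (ContinuousLinearMap.inr ℝ (Eucl d) (Eucl d)) := by
        ext η
        simp [G, ψ, ContDiffMapSupportedIn.of_support_subset]
        rfl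
      have h2 : ContDiff ℝ ∞ (fun p : Eucl d × Eucl d => G (p + (x, 0))) :=
        hG.comp (contDiff_id.add contDiff_const)
      rw [h1, ContinuousLinearMap.iteratedFDeriv_comp_right _ h2 _ (mod_cast le_top),
        iteratedFDeriv_comp_add_right]
      simp
    have hc : Continuous (fun p : Eucl d × Eucl d => iteratedFDeriv ℝ i (ψ p.1) p.2) := by
      simp only [key]
      exact (ContinuousMultilinearMap.compContinuousLinearMapL
        (fun _ : Fin i => ContinuousLinearMap.inr ℝ (Eucl d) (Eucl d))).continuous.comp
          (hG.continuous_iteratedFDeriv (mod_cast le_top))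
    rw [continuous_iff_continuousAt]
    intro x
    rw [ContinuousAt, BoundedContinuousFunction.tendsto_iff_tendstoUniformly]
    intro u hu
    obtain ⟨v, hv, hvu⟩ := K.isCompact.mem_uniformity_of_prod (s := Set.univ)
      (f := fun x ξ => iteratedFDeriv ℝ i (ψ x) ξ) hc.continuousOn (Set.mem_univ x)
      (symm_le_uniformity hu)
    rw [nhdsWithin_univ] at hv
    filter_upwards [hv] with y hy ξ
    simp only [Function.comp_apply, ContDiffMapSupportedIn.structureMapCLM_top_apply]
    by_cases hξ : ξ ∈ K
    · exact hvu y hy ξ hξ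
    · rw [(ψ x).iteratedFDeriv_zero_on_compl hξ, (ψ y).iteratedFDeriv_zero_on_compl hξ]
      exact refl_mem_uniformity hu
  exact (TestFunction.continuous_ofSupportedIn hK).comp hψ

/-! ### Fourier test functions and Fourier distributions -/

/-- The Fourier transform on `C_c^∞(Ω)`. -/
def fourierTestMap (Ω : Opens (Eucl d)) : 𝓓(Ω, ℂ) →ₗ[ℂ] 𝓢(Eucl d, ℂ) :=
  (FourierTransform.fourierCLM ℂ 𝓢(Eucl d, ℂ)).toLinearMap ∘ₗ testToSchwartz Ω

theorem fourierTestMap_injective (Ω : Opens (Eucl d)) :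
    Function.Injective (fourierTestMap Ω) := by
  intro φ ψ h
  have h1 : testToSchwartz Ω φ = testToSchwartz Ω ψ :=
    (FourierTransform.fourierCLE ℂ 𝓢(Eucl d, ℂ)).injective h
  ext x
  exact congrArg (fun f : 𝓢(Eucl d, ℂ) => f x) h1

/-- The Fourier test function space `Z(Ω) = 𝓕 (C_c^∞(Ω))`. -/
def FourierTestSpace (Ω : Opens (Eucl d)) : Type := LinearMap.range (fourierTestMap Ω)

instance : AddCommGroup (FourierTestSpace Ω) :=
  inferInstanceAs (AddCommGroup (LinearMap.range (fourierTestMap Ω)))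

instance : Module ℂ (FourierTestSpace Ω) :=
  inferInstanceAs (Module ℂ (LinearMap.range (fourierTestMap Ω)))

/-- The Fourier transform as a linear bijection `C_c^∞(Ω) → Z(Ω)`. -/
def fourierTestEquiv (Ω : Opens (Eucl d)) : 𝓓(Ω, ℂ) ≃ₗ[ℂ] FourierTestSpace Ω :=
  LinearEquiv.ofInjective (fourierTestMap Ω) (fourierTestMap_injective Ω)

/-- `Z(Ω)` carries the topology that makes `𝓕 : C_c^∞(Ω) → Z(Ω)` a homeomorphism. -/
instance : TopologicalSpace (FourierTestSpace Ω) :=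
  TopologicalSpace.coinduced (fourierTestEquiv Ω) inferInstance

/-- The Fourier transform as a linear homeomorphism `C_c^∞(Ω) → Z(Ω)`. -/
def fourierTestCLE (Ω : Opens (Eucl d)) : 𝓓(Ω, ℂ) ≃L[ℂ] FourierTestSpace Ω where
  toLinearEquiv := fourierTestEquiv Ω
  continuous_toFun := continuous_coinduced_rng
  continuous_invFun := by
    refine continuous_coinduced_dom.2 ?_
    convert continuous_id using 1
    ext1 φ
    exact (fourierTestEquiv Ω).symm_apply_apply φ

/-- The inclusion of `Z(Ω)` into the Schwartz space. -/
def FourierTestSpace.toSchwartz (Ω : Opens (Eucl d)) : FourierTestSpace Ω →L[ℂ] 𝓢(Eucl d, ℂ) where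
  toLinearMap := (LinearMap.range (fourierTestMap Ω)).subtype
  cont := by
    refine continuous_coinduced_dom.2 ?_
    exact (FourierTransform.fourierCLM ℂ 𝓢(Eucl d, ℂ)).continuous.comp
      (continuous_testToSchwartz Ω)

theorem FourierTestSpace.toSchwartz_fourier (φ : 𝓓(Ω, ℂ)) (x : Eucl d) :
    FourierTestSpace.toSchwartz Ω (fourierTestCLE Ω φ) x = 𝓕 (φ : Eucl d → ℂ) x := by
  change (𝓕 (testToSchwartz Ω φ)) x = _
  rw [SchwartzMap.fourier_coe]
  rfl

/-- `𝓓'(Ω)`: continuous `ℂ`-linear functionals on `C_c^∞(Ω)`, with the weak-* topology. -/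
abbrev DistributionOn (Ω : Opens (Eucl d)) : Type := WeakDual ℂ 𝓓(Ω, ℂ)

/-- `Z'(Ω)`: continuous `ℂ`-linear functionals on `Z(Ω)`, with the weak-* topology. -/
abbrev FourierDistribution (Ω : Opens (Eucl d)) : Type := WeakDual ℂ (FourierTestSpace Ω)

/-- The Fourier transform `Z'(Ω) → 𝓓'(Ω)`, `f ↦ f ∘ 𝓕`. -/
def FourierDistribution.fourier (f : FourierDistribution Ω) : DistributionOn Ω :=
  StrongDual.toWeakDual (f.toStrongDual ∘L (fourierTestCLE Ω : 𝓓(Ω, ℂ) →L[ℂ] FourierTestSpace Ω))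

/-- The inverse Fourier transform `𝓓'(Ω) → Z'(Ω)`, `T ↦ T ∘ 𝓕⁻¹`. -/
def DistributionOn.fourierInv (T : DistributionOn Ω) : FourierDistribution Ω :=
  StrongDual.toWeakDual
    (T.toStrongDual ∘L ((fourierTestCLE Ω).symm : FourierTestSpace Ω →L[ℂ] 𝓓(Ω, ℂ)))

/-- The distribution `φ ↦ ∫ φ u` on `Ω` given by a locally integrable function `u`
(and `0` if `u` is not locally integrable on `Ω`). -/
def regularDistribution (Ω : Opens (Eucl d)) (u : Eucl d → ℂ) : DistributionOn Ω :=
  StrongDual.toWeakDual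
    (TestFunction.integralAgainstBilinCLM (ContinuousLinearMap.mul ℂ ℂ) volume u)

/-- The sesquilinear pairing `⟨T | φ⟩ = T (conj φ)` of `𝓓'(Ω)` and `𝓓(Ω)`. -/
def sesqPairing (T : DistributionOn Ω) (φ : 𝓓(Ω, ℂ)) : ℂ := T (conjTest φ)

theorem exists_lpFunctional {u : Eucl d → ℂ} (h : ∃ p : ℝ≥0∞, 1 ≤ p ∧ MemLp u p volume) :
    ∃ L : 𝓢(Eucl d, ℂ) →L[ℂ] ℂ, ∀ g, L g = ∫ x, u x * g x := by
  obtain ⟨p, hp, hu⟩ := h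
  have : Fact (1 ≤ p) := ⟨hp⟩
  refine ⟨(ContinuousLinearMap.toUniformConvergenceCLM _ _ _).symm
    (Lp.toTemperedDistribution hu.toLp), fun g => ?_⟩
  rw [ContinuousLinearMap.toUniformConvergenceCLM_symm_apply, Lp.toTemperedDistribution_apply]
  refine integral_congr_ae ?_
  filter_upwards [hu.coeFn_toLp] with x hx
  rw [hx, smul_eq_mul, mul_comm]

open Classical in
/-- A function `u` lying in some `L^p`, `1 ≤ p ≤ ∞`, seen as the Fourier distribution
`ψ ↦ ∫ u ψ` (and `0` for functions in no `L^p`). -/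
def FourierDistribution.ofFun (Ω : Opens (Eucl d)) (u : Eucl d → ℂ) : FourierDistribution Ω :=
  if h : ∃ p : ℝ≥0∞, 1 ≤ p ∧ MemLp u p volume then
    StrongDual.toWeakDual
      { toFun := fun ψ => ∫ x, u x * FourierTestSpace.toSchwartz Ω ψ x
        map_add' := fun ψ χ => by
          obtain ⟨L, hL⟩ := exists_lpFunctional h
          simp only [← hL, map_add]
        map_smul' := fun c ψ => by
          obtain ⟨L, hL⟩ := exists_lpFunctional h
          simp only [← hL, map_smul, RingHom.id_apply]
        cont := by
          obtain ⟨L, hL⟩ := exists_lpFunctional h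
          simp only [← hL]
          exact L.continuous.comp (FourierTestSpace.toSchwartz Ω).continuous }
  else 0

theorem FourierDistribution.ofFun_apply {u : Eucl d → ℂ} {p : ℝ≥0∞} (hp : 1 ≤ p)
    (hu : MemLp u p volume) (ψ : FourierTestSpace Ω) :
    FourierDistribution.ofFun Ω u ψ = ∫ x, u x * FourierTestSpace.toSchwartz Ω ψ x := by
  unfold FourierDistribution.ofFun
  rw [dif_pos ⟨p, hp, hu⟩]
  rfl

/-- The space `𝓢_Ω = 𝓕⁻¹ (C_c^∞(Ω))` of Schwartz functions. -/
def schwartzFourierSupported (Ω : Opens (Eucl d)) : Set 𝓢(Eucl d, ℂ) :=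
  Set.range fun φ : 𝓓(Ω, ℂ) => 𝓕⁻ (testToSchwartz Ω φ)

/-! ### Covers, weights, partitions of unity -/

/-- An admissible cover `(Q_i)_{i ∈ I}` of the open set `Ω`. -/
structure AdmissibleCover (Ω : Opens (Eucl d)) (I : Type*) where
  carrier : I → Set (Eucl d)
  iUnion_eq : ⋃ i, carrier i = (Ω : Set (Eucl d))
  nonempty : ∀ i, (carrier i).Nonempty
  boundedOverlap : ∃ n : ℕ, ∀ i, {l | (carrier l ∩ carrier i).Nonempty}.encard ≤ n

theorem AdmissibleCover.finite_neighbors (Q : AdmissibleCover Ω I) (i : I) :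
    {l | (Q.carrier l ∩ Q.carrier i).Nonempty}.Finite := by
  obtain ⟨n, hn⟩ := Q.boundedOverlap
  exact Set.finite_of_encard_le_coe (hn i)

/-- The set `i^*` of all `l` such that `Q_l` meets `Q_i`. -/
def AdmissibleCover.neighbors (Q : AdmissibleCover Ω I) (i : I) : Finset I :=
  (Q.finite_neighbors i).toFinset

/-- `w` is a `Q`-moderate weight. -/
def AdmissibleCover.IsModerate (Q : AdmissibleCover Ω I) (w : I → ℝ) : Prop :=
  (∀ i, 0 < w i) ∧ ∃ C : ℝ, ∀ i, ∀ l ∈ Q.neighbors i, w i / w l ≤ C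

/-- A bounded admissible partition of unity subordinate to `Q`. -/
structure BAPU (Q : AdmissibleCover Ω I) where
  fn : I → 𝓓(Ω, ℂ)
  hasSum_one : ∀ ξ ∈ Ω, HasSum (fun i => fn i ξ) 1
  eq_zero : ∀ i, ∀ ξ ∈ (Ω : Set (Eucl d)) \ Q.carrier i, fn i ξ = 0
  bounded : ⨆ i, eLpNorm (𝓕⁻ (fn i : Eucl d → ℂ)) 1 volume < ⊤

/-- The constant `C_Φ = sup_i ‖𝓕⁻¹ φ_i‖_{L^1}`. -/
def BAPU.const {Q : AdmissibleCover Ω I} (Φ : BAPU Q) : ℝ≥0∞ :=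
  ⨆ i, eLpNorm (𝓕⁻ (Φ.fn i : Eucl d → ℂ)) 1 volume

/-! ### Weighted sequence norms, the Schur norm and the clustering map -/

/-- The norm `‖a‖_{ℓ^q_w} ∈ [0, ∞]` of a sequence with entries in `[0, ∞]`. -/
def ellNorm (q : ℝ≥0∞) (w : I → ℝ) (a : I → ℝ≥0∞) : ℝ≥0∞ :=
  if q = ⊤ then ⨆ i, ENNReal.ofReal (w i) * a i
  else (∑' i, (ENNReal.ofReal (w i) * a i) ^ q.toReal) ^ (1 / q.toReal)

theorem ellNorm_mono (q : ℝ≥0∞) (w : I → ℝ) {a b : I → ℝ≥0∞} (h : ∀ i, a i ≤ b i) :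
    ellNorm q w a ≤ ellNorm q w b := by
  unfold ellNorm
  split_ifs
  · exact iSup_mono fun i => by gcongr; exact h i
  · gcongr with i
    exact h i

theorem ellNorm_add_le {q : ℝ≥0∞} (hq : 1 ≤ q) (w : I → ℝ) (a b : I → ℝ≥0∞) :
    ellNorm q w (fun i => a i + b i) ≤ ellNorm q w a + ellNorm q w b := by
  unfold ellNorm
  split_ifs with h
  · refine iSup_le fun i => ?_
    rw [mul_add]
    exact add_le_add (le_iSup (fun i => ENNReal.ofReal (w i) * a i) i)
      (le_iSup (fun i => ENNReal.ofReal (w i) * b i) i)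
  · let _ : MeasurableSpace I := ⊤
    have hq' : 1 ≤ q.toReal := by
      rw [← ENNReal.toReal_one]
      exact ENNReal.toReal_mono h hq
    have := ENNReal.lintegral_Lp_add_le (μ := (Measure.count : Measure I))
      (f := fun i => ENNReal.ofReal (w i) * a i) (g := fun i => ENNReal.ofReal (w i) * b i)
      measurable_from_top.aemeasurable measurable_from_top.aemeasurable hq'
    simpa only [lintegral_count, Pi.add_apply, ← mul_add] using this

theorem ellNorm_const_mul (q : ℝ≥0∞) (hq : 1 ≤ q) (w : I → ℝ) (c : ℝ≥0∞) (a : I → ℝ≥0∞) :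
    ellNorm q w (fun i => c * a i) = c * ellNorm q w a := by
  unfold ellNorm
  split_ifs with h
  · simp only [ENNReal.mul_iSup, mul_left_comm]
  · have hq' : 0 < q.toReal := ENNReal.toReal_pos (by positivity) h
    simp only [mul_left_comm _ c, ENNReal.mul_rpow_of_nonneg _ _ hq'.le, ENNReal.tsum_mul_left]
    rw [ENNReal.mul_rpow_of_nonneg _ _ (by positivity), ← ENNReal.rpow_mul,
      mul_one_div_cancel hq'.ne', ENNReal.rpow_one]

/-- The Schur norm, in `[0, ∞]`, of a matrix with (absolute values of) entries `M i j ∈ [0, ∞]`;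
the matrix is of Schur type if this is finite. -/
def schurNorm (M : I → J → ℝ≥0∞) : ℝ≥0∞ :=
  max (⨆ i, ∑' j, M i j) (⨆ j, ∑' i, M i j)

/-- The operator norm on `ℓ^q_w` of the clustering map `(c_i) ↦ (∑_{l ∈ i^*} c_l)`. -/
def AdmissibleCover.clusteringNorm (Q : AdmissibleCover Ω I) (w : I → ℝ) (q : ℝ≥0∞) : ℝ≥0∞ :=
  ⨆ (c : I → ℂ) (_ : ellNorm q w (fun i => ‖c i‖ₑ) ≤ 1),
    ellNorm q w (fun i => ‖∑ l ∈ Q.neighbors i, c l‖ₑ)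

/-! ### Decomposition spaces -/

variable {Q : AdmissibleCover Ω I}

/-- The smooth function `𝓕⁻¹ (φ_i · f̂)`. Since `φ_i · f̂` is a distribution with compact support,
its inverse Fourier transform is the function `x ↦ ⟨φ_i · f̂, e_x⟩ = ⟨f̂, φ_i e_x⟩`. -/
def BAPU.piece (Φ : BAPU Q) (f : FourierDistribution Ω) (i : I) : Eucl d → ℂ :=
  fun x => f.fourier ((Φ.fn i).mulSmooth (planeWave x) (contDiff_planeWave x))

theorem BAPU.continuous_piece (Φ : BAPU Q) (f : FourierDistribution Ω) (i : I) :
    Continuous (Φ.piece f i) :=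
  (f.fourier.toStrongDual).continuous.comp (continuous_mulSmooth_planeWave (Φ.fn i))

/-- The norm `‖f‖_{𝓓(Q, L^p, ℓ^q_w)} ∈ [0, ∞]` of a Fourier distribution. -/
def BAPU.decompositionNorm (Φ : BAPU Q) (p q : ℝ≥0∞) (w : I → ℝ) (f : FourierDistribution Ω) :
    ℝ≥0∞ :=
  ellNorm q w (fun i => eLpNorm (Φ.piece f i) p volume)

/-- The decomposition space `𝓓(Q, L^p, ℓ^q_w)`. -/
def BAPU.decompositionSpace (Φ : BAPU Q) {p q : ℝ≥0∞} (hp : 1 ≤ p) (hq : 1 ≤ q) (w : I → ℝ) :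
    Submodule ℂ (FourierDistribution Ω) where
  carrier := {f | Φ.decompositionNorm p q w f < ⊤}
  zero_mem' := by
    have : ∀ i, Φ.piece (0 : FourierDistribution Ω) i = 0 := fun i => rfl
    change Φ.decompositionNorm p q w 0 < ⊤
    simp only [BAPU.decompositionNorm, this, eLpNorm_zero]
    have := ellNorm_const_mul q hq w 0 (fun _ => 0)
    simp only [zero_mul] at this
    rw [this]
    exact ENNReal.zero_lt_top
  add_mem' {f g} hf hg := by
    refine lt_of_le_of_lt ((ellNorm_mono q w fun i => ?_).trans (ellNorm_add_le hq w _ _))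
      (ENNReal.add_lt_top.2 ⟨hf, hg⟩)
    exact eLpNorm_add_le (Φ.continuous_piece f i).aestronglyMeasurable
      (Φ.continuous_piece g i).aestronglyMeasurable hp
  smul_mem' c f hf := by
    have : Φ.decompositionNorm p q w (c • f) = ‖c‖ₑ * Φ.decompositionNorm p q w f := by
      unfold BAPU.decompositionNorm
      rw [← ellNorm_const_mul q hq]
      congr 1
      ext1 i
      exact eLpNorm_const_smul c (Φ.piece f i) p volume
    change Φ.decompositionNorm p q w (c • f) < ⊤
    rw [this]
    exact ENNReal.mul_lt_top enorm_lt_top hf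

/-- The `i`-th term `⟨f̂ | φ_i · ĝ⟩` of the extended inner product of `f` and `g`. -/
def BAPU.pairingTerm (Φ : BAPU Q) (f : FourierDistribution Ω) (g : Eucl d → ℂ)
    (hg : ContDiff ℝ ∞ (𝓕 g)) (i : I) : ℂ :=
  sesqPairing f.fourier ((Φ.fn i).mulSmooth (𝓕 g) hg)

/-- The extended inner product `⟨f | g⟩_Φ`, well-defined if the series converges absolutely. -/
def BAPU.extendedPairing (Φ : BAPU Q) (f : FourierDistribution Ω) (g : Eucl d → ℂ)
    (hg : ContDiff ℝ ∞ (𝓕 g)) : ℂ :=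
  ∑' i, Φ.pairingTerm f g hg i

/-! ### Fourier multipliers -/

/-- `h` is continuous on `Ω` and tame: `sup_i ‖𝓕⁻¹ (φ_i h)‖_{L^1} < ∞`. -/
def BAPU.IsTame (Φ : BAPU Q) (h : Eucl d → ℂ) : Prop :=
  ContinuousOn h Ω ∧ ⨆ i, eLpNorm (𝓕⁻ (fun ξ => Φ.fn i ξ * h ξ)) 1 volume < ⊤

/-- The `i`-th term `𝓕⁻¹ [(φ_i^* h) ⊙ (φ_i f̂)]` of the series defining the Fourier multiplier
`Φ_h f`, where `φ_i^* = ∑_{l ∈ i^*} φ_l`. By definition of the generalized product `⊙`, it is the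
convolution of `𝓕⁻¹ (φ_i^* h) ∈ L^1` with `𝓕⁻¹ (φ_i f̂) ∈ L^p`. -/
def BAPU.multiplierTerm (Φ : BAPU Q) (h : Eucl d → ℂ) (f : FourierDistribution Ω) (i : I) :
    FourierDistribution Ω :=
  FourierDistribution.ofFun Ω
    ((𝓕⁻ (fun ξ => (∑ l ∈ Q.neighbors i, Φ.fn l ξ) * h ξ))
      ⋆[ContinuousLinearMap.mul ℂ ℂ, volume] (Φ.piece f i))

/-! ### Generalized shift-invariant systems -/

/-- The integer vector `k ∈ ℤ^d` as an element of `ℝ^d`. -/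
def intVec (k : Fin d → ℤ) : Eucl d := WithLp.toLp 2 fun i => (k i : ℝ)

/-- A generalized shift-invariant system with generators `g_j ∈ L^1 ∩ L^2` with smooth Fourier
transform and matrices `C_j ∈ GL(d, ℝ)`, such that
`A ≤ ∑_j |det C_j|⁻¹ |ĝ_j(ξ)|² ≤ B` for almost all `ξ` and some constants `A, B > 0`. -/
structure GSISystem (d : ℕ) (J : Type*) where
  C : J → GL (Fin d) ℝ
  g : J → Eucl d → ℂ
  memLp_one : ∀ j, MemLp (g j) 1 volume
  memLp_two : ∀ j, MemLp (g j) 2 volume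
  contDiff_fourier : ∀ j, ContDiff ℝ ∞ (𝓕 (g j))
  exists_bounds : ∃ A B : ℝ, 0 < A ∧ 0 < B ∧ ∀ᵐ ξ : Eucl d,
    ENNReal.ofReal A ≤ ∑' j, ENNReal.ofReal (|(C j).val.det|⁻¹ * ‖𝓕 (g j) ξ‖ ^ 2) ∧
    ∑' j, ENNReal.ofReal (|(C j).val.det|⁻¹ * ‖𝓕 (g j) ξ‖ ^ 2) ≤ ENNReal.ofReal B

namespace GSISystem

variable (G : GSISystem d J)

/-- `|det C_j|` -/
def absDet (j : J) : ℝ := |(G.C j).val.det|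

/-- `C_j k`, for `k ∈ ℤ^d` -/
def latticePoint (j : J) (k : Fin d → ℤ) : Eucl d :=
  Matrix.toEuclideanLin (G.C j).val (intVec k)

/-- The dual lattice `C_j^{-t} ℤ^d`. -/
def dualLattice (j : J) : Set (Eucl d) :=
  Set.range fun k : Fin d → ℤ => Matrix.toEuclideanLin ((G.C j)⁻¹).val.transpose (intVec k)

/-- The translate `T_{C_j k} g_j`. -/
def atom (j : J) (k : Fin d → ℤ) : Eucl d → ℂ := fun x => G.g j (x - G.latticePoint j k)

theorem contDiff_fourier_atom (j : J) (k : Fin d → ℤ) : ContDiff ℝ ∞ (𝓕 (G.atom j k)) := by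
  have : 𝓕 (G.atom j k) = fun ξ => planeWave (-G.latticePoint j k) ξ * 𝓕 (G.g j) ξ := by
    ext ξ
    rw [Real.fourier_eq', Real.fourier_eq', ← integral_const_mul,
      ← integral_add_right_eq_self _ (G.latticePoint j k)]
    refine integral_congr_ae (Filter.Eventually.of_forall fun x => ?_)
    simp only [atom, planeWave, smul_eq_mul, ← mul_assoc, ← Complex.exp_add]
    congr 2
    · simp only [inner_add_left, inner_neg_left]
      push_cast
      ring
    · simp
  rw [this]
  exact (contDiff_planeWave _).mul (G.contDiff_fourier j)

/-- `Λ = ⋃_j C_j^{-t} ℤ^d` -/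
def frequencies : Set (Eucl d) := ⋃ j, G.dualLattice j

/-- `t_α(ξ) = ∑_{j ∈ κ(α)} |det C_j|⁻¹ conj (ĝ_j(ξ)) ĝ_j(ξ + α)`,
where `κ(α) = {j | α ∈ C_j^{-t} ℤ^d}`. -/
def t (α ξ : Eucl d) : ℂ :=
  ∑' j : {j : J // α ∈ G.dualLattice j},
    ((G.absDet j)⁻¹ : ℂ) * (conj (𝓕 (G.g j) ξ) * 𝓕 (G.g j) (ξ + α))

end GSISystem

/-- `L^2(ℝ^d)` with its Fourier-Plancherel transform `𝓕`. -/
abbrev LTwo (d : ℕ) : Type := Lp ℂ 2 (volume : Measure (Eucl d))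

/-- The space of all `f ∈ L^2` such that `f̂` is bounded, with compact support contained in `Ω`. -/
def bandlimitedBounded (Ω : Opens (Eucl d)) : Set (LTwo d) :=
  {f | MemLp (𝓕 f : LTwo d) ⊤ volume ∧
    ∃ K : Set (Eucl d), IsCompact K ∧ K ⊆ Ω ∧ ∀ᵐ ξ, ξ ∉ K → (𝓕 f : LTwo d) ξ = 0}

namespace GSISystem

variable (G : GSISystem d J)

/-- The `α`-local integrability condition relative to the complement of `Ω`. -/
def AlphaLIC (Ω : Opens (Eucl d)) : Prop :=
  ∀ f ∈ bandlimitedBounded Ω,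
    ∑' j, ENNReal.ofReal (G.absDet j)⁻¹ * ∑' α : G.dualLattice j,
      ∫⁻ ξ : Eucl d, ‖(𝓕 f : LTwo d) ξ * (𝓕 f : LTwo d) (ξ + α) *
        𝓕 (G.g j) ξ * 𝓕 (G.g j) (ξ + α)‖ₑ < ⊤

/-- The cube `n + [0, 1]^d`. -/
def cube (n : Fin d → ℤ) : Set (Eucl d) := {x | ∀ m, (n m : ℝ) ≤ x m ∧ x m ≤ n m + 1}

/-- The discrete amalgam norm `‖h‖_{W(L^∞, ℓ^1)}`. -/
def amalgamNorm (h : Eucl d → ℂ) : ℝ≥0∞ :=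
  ∑' n : Fin d → ℤ, eLpNorm ((cube n).indicator h) ⊤ volume

/-- The entries `max {w_i / v_j, v_j / w_i} |det C_j|^{1/2} ‖(φ̌_i * g_j) ∘ C_j‖_{W(L^∞, ℓ^1)}`;
the system is `(w, v, Φ)`-adapted if this matrix is of Schur type. -/
def adaptMatrix (Φ : BAPU Q) (w : I → ℝ) (v : J → ℝ) (i : I) (j : J) : ℝ≥0∞ :=
  ENNReal.ofReal (max (w i / v j) (v j / w i) * (G.absDet j) ^ (1 / 2 : ℝ)) *
    amalgamNorm fun x =>
      ((𝓕⁻ (Φ.fn i : Eucl d → ℂ)) ⋆[ContinuousLinearMap.mul ℂ ℂ, volume] (G.g j))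
        (Matrix.toEuclideanLin (G.C j).val x)

/-- `(w, v, Φ)`-adaptedness of the system. -/
def IsAdapted (Φ : BAPU Q) (w : I → ℝ) (v : J → ℝ) : Prop :=
  schurNorm (G.adaptMatrix Φ w v) < ⊤

/-- The term `⟨f | T_{C_j k} g_j⟩_Φ T_{C_j k} g_j` of the series defining the frame operator. -/
def frameTerm (Φ : BAPU Q) (f : FourierDistribution Ω) (jk : J × (Fin d → ℤ)) :
    FourierDistribution Ω :=
  Φ.extendedPairing f (G.atom jk.1 jk.2) (G.contDiff_fourier_atom jk.1 jk.2) •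
    FourierDistribution.ofFun Ω (G.atom jk.1 jk.2)

/-- The distribution `T_α (t_α · f̂)` on `Ω`. -/
def remainderTerm (Ω : Opens (Eucl d)) (f : 𝓢(Eucl d, ℂ)) (α : Eucl d) : DistributionOn Ω :=
  regularDistribution Ω fun ξ => G.t α (ξ - α) * 𝓕 (f : Eucl d → ℂ) (ξ - α)

/-- The remainder `R f = 𝓕⁻¹ (∑_{α ∈ Λ \ {0}} T_α (t_α · f̂))`; the series is an unconditional sum
in `𝓓'(Ω)`. -/
def remainder (Ω : Opens (Eucl d)) (f : 𝓢(Eucl d, ℂ)) : FourierDistribution Ω :=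
  DistributionOn.fourierInv
    (∑' α : {α : Eucl d // α ∈ G.frequencies ∧ α ≠ 0}, G.remainderTerm Ω f α)

/-- `N_{i,l} = (w_i / w_l) ∑_{α ∈ Λ \ {0}} ‖𝓕⁻¹ (φ_i(· + α) t_α φ_l)‖_{L^1}` -/
def matrixN (Φ : BAPU Q) (w : I → ℝ) (i l : I) : ℝ≥0∞ :=
  ENNReal.ofReal (w i / w l) * ∑' α : {α : Eucl d // α ∈ G.frequencies ∧ α ≠ 0},
    eLpNorm (𝓕⁻ (fun ξ => Φ.fn i (ξ + α) * G.t α ξ * Φ.fn l ξ)) 1 volume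

/-- `Ñ_{i,l} = max {1, w_i / w_l} ∑_j |det C_j|⁻¹
∑_{α ∈ C_j^{-t} ℤ^d \ {0}} ‖𝓕⁻¹ (φ_i(· - α) conj(ĝ_j) ĝ_j(· - α) φ_l)‖_{L^1}` -/
def matrixNTilde (Φ : BAPU Q) (w : I → ℝ) (i l : I) : ℝ≥0∞ :=
  ENNReal.ofReal (max 1 (w i / w l)) * ∑' j, ENNReal.ofReal (G.absDet j)⁻¹ *
    ∑' α : {α : Eucl d // α ∈ G.dualLattice j ∧ α ≠ 0},
      eLpNorm (𝓕⁻ (fun ξ => Φ.fn i (ξ - α) * conj (𝓕 (G.g j) ξ) * 𝓕 (G.g j) (ξ - α) *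
        Φ.fn l ξ)) 1 volume

end GSISystem

/-- The constant `C_{p,q}`: it is `1` if `max {p, q} < ∞`, and `C_Φ ‖Γ_Q‖²` otherwise. -/
def BAPU.extensionConst (Φ : BAPU Q) (p q : ℝ≥0∞) (w : I → ℝ) : ℝ≥0∞ :=
  if max p q < ⊤ then 1 else Φ.const * Q.clusteringNorm w q ^ 2

end

noncomputable section

/-! ### Minkowski's inequality for series and the Schur test -/

/-! On a test function the frame operator can be computed exactly. Let f̂ = φ ∈ C_c^∞(O). For fixed
j the coefficients ⟨f | T_{C_j k} g_j⟩ and the values at x of the localized atoms φ̌_m * T_{C_j k}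
g_j are samples on C_j ℤ^d of an inverse Fourier transform and of a Fourier transform of test
functions. Poisson summation therefore turns the sum over k into |det C_j|⁻¹ times a sum of
correlation integrals over the dual lattice C_j^{-t} ℤ^d. The α-LIC makes the double series over (j,
α) absolutely convergent, and grouping it by α produces the functions t_α. The term α = 0 is the
multiplier with symbol t_0, all other terms form Rf, so S = T_0 + R on S_O
(`GSISystem.frame_eq_multiplier_add_remainder`).

For the bound on R one writes f̂ = ∑_l φ_l (φ_l^* f̂). The i-th piece of Rf is then dominated by a
sum over l of convolutions of ∑_α |𝓕⁻(φ_i(·+α) t_α φ_l)| with the modulus of the clustered piece of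
f at l. The inequalities of Minkowski and Young and the Schur test give the factor ‖N‖, and
clustering costs one factor ‖Γ‖ (`GSISystem.decompositionNorm_remainder_le`).

On the whole space, S and T_0 are handled as dominated series. The frame series is controlled by M
Mᵀ with M the adaptedness matrix (`GSISystem.ellNorm_frameBound_le`). The m-th piece of T_0 f
involves only the neighbours of m and kernels that are uniformly bounded in L^1.

The operator R_0 is S − T_0, and only its norm remains. An extension by density would fail when p or
q is infinite. Instead, f is approximated in Z' by functions f_n in S_O whose pieces share one
majorant of norm at most C_Φ ‖Γ‖² ‖f‖ (`BAPU.exists_approximation`). Under this domination the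
pieces of S f_n and T_0 f_n converge almost everywhere, and Fatou's lemma gives ‖R_0 f‖ ≤ liminf ‖R
f_n‖. If p, q < ∞ the norms of f_n converge to that of f; otherwise they are bounded through the
majorant. This explains the two values of C_{p,q}.

For (c), the comparison of N with Ñ is the triangle inequality in the series for t_α, an exchange of
sums and the symmetry α ↦ −α of the lattices. The α-LIC follows since finitely many φ_i sum to 1 on
a compact set and a function is bounded by the L^1 norm of its inverse Fourier transform; the terms
with α = 0 are covered by the upper bound B. -/

theorem eLpNorm_tsum_le {X ι : Type*} [MeasurableSpace X] [Countable ι] {μ : Measure X}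
    {p : ℝ≥0∞} (hp : 1 ≤ p) {H : ι → X → ℝ≥0∞} (hH : ∀ i, AEMeasurable (H i) μ) :
    eLpNorm (fun x => ∑' i, H i x) p μ ≤ ∑' i, eLpNorm (H i) p μ := by
  rcases eq_or_ne p ⊤ with rfl | hpt
  · simp only [eLpNorm_exponent_top]
    refine essSup_le_of_ae_le _ ?_
    have : ∀ᵐ x ∂μ, ∀ i, H i x ≤ eLpNormEssSup (H i) μ :=
      ae_all_iff.2 fun i => enorm_ae_le_eLpNormEssSup (H i) μ
    filter_upwards [this] with x hx
    exact ENNReal.tsum_le_tsum hx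
  · have hp0 : p ≠ 0 := (zero_lt_one.trans_le hp).ne'
    have hr : 0 < p.toReal := ENNReal.toReal_pos hp0 hpt
    rw [eLpNorm_eq_lintegral_rpow_enorm_toReal hp0 hpt]
    simp only [enorm_eq_self, one_div]
    rw [ENNReal.rpow_inv_le_iff hr]
    have h1 : ∀ x, (∑' i, H i x) ^ p.toReal = ⨆ s : Finset ι, (∑ i ∈ s, H i x) ^ p.toReal := by
      intro x
      rw [ENNReal.tsum_eq_iSup_sum]
      exact (ENNReal.orderIsoRpow _ hr).map_iSup _
    simp only [h1]
    -- The finite subsets of a countable set form a countable directed family, so monotone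
    -- convergence reduces the claim to finite sums.
    rw [lintegral_iSup_directed (fun s => by fun_prop)]
    · refine iSup_le fun s => ?_
      have h2 := eLpNorm_sum_le (s := s) (f := H) (μ := μ)
        (fun i _ => (hH i).aestronglyMeasurable) hp
      have h3 := h2.trans (ENNReal.sum_le_tsum s)
      rw [eLpNorm_eq_lintegral_rpow_enorm_toReal hp0 hpt, one_div, ENNReal.rpow_inv_le_iff hr] at h3
      simpa using h3
    · refine Monotone.directed_le fun s t hst x => ?_
      exact ENNReal.rpow_le_rpow (Finset.sum_le_sum_of_subset hst) hr.le

/-- The Schur test for a nonnegative integral kernel. -/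
theorem eLpNorm_lintegral_mul_le {X Y : Type*} [MeasurableSpace X] [MeasurableSpace Y]
    {μ : Measure X} {ν : Measure Y} [SFinite μ] [SFinite ν] {K : X → Y → ℝ≥0∞}
    (hK : Measurable (Function.uncurry K)) {A : ℝ≥0∞}
    (h1 : ∀ᵐ x ∂μ, ∫⁻ y, K x y ∂ν ≤ A) (h2 : ∀ᵐ y ∂ν, ∫⁻ x, K x y ∂μ ≤ A)
    {p : ℝ≥0∞} (hp : 1 ≤ p) {H : Y → ℝ≥0∞} (hH : Measurable H) :
    eLpNorm (fun x => ∫⁻ y, K x y * H y ∂ν) p μ ≤ A * eLpNorm H p ν := by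
  have hKx : ∀ x, Measurable (K x) := fun x => hK.comp measurable_prodMk_left
  rcases eq_or_ne p ⊤ with rfl | hpt
  · simp only [eLpNorm_exponent_top]
    refine essSup_le_of_ae_le _ ?_
    filter_upwards [h1] with x hx
    simp only [enorm_eq_self]
    calc ∫⁻ y, K x y * H y ∂ν ≤ ∫⁻ y, K x y * eLpNormEssSup H ν ∂ν := by
          refine lintegral_mono_ae ?_
          filter_upwards [enorm_ae_le_eLpNormEssSup H ν] with y hy
          gcongr
          exact hy
      _ = (∫⁻ y, K x y ∂ν) * eLpNormEssSup H ν := lintegral_mul_const _ (hKx x)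
      _ ≤ _ := by gcongr
  · have hp0 : p ≠ 0 := (zero_lt_one.trans_le hp).ne'
    set r := p.toReal with hrdef
    have hr1 : 1 ≤ r := by
      rw [hrdef, ← ENNReal.toReal_one]
      exact ENNReal.toReal_mono hpt hp
    have hr : 0 < r := by linarith
    -- Jensen's inequality for the measure K(x, y) dν(y), whose total mass is at most A; this mass
    -- accounts for A^(r-1), and Tonelli below supplies the last factor A.
    have key : ∀ᵐ x ∂μ, (∫⁻ y, K x y * H y ∂ν) ^ r ≤
        A ^ (r - 1) * ∫⁻ y, K x y * H y ^ r ∂ν := by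
      filter_upwards [h1] with x hx
      have h3 := eLpNorm_le_eLpNorm_mul_rpow_measure_univ (μ := ν.withDensity (K x)) hp
        hH.aestronglyMeasurable
      rw [eLpNorm_one_eq_lintegral_enorm, eLpNorm_eq_lintegral_rpow_enorm_toReal hp0 hpt,
        lintegral_withDensity_eq_lintegral_mul _ (hKx x) (by fun_prop),
        lintegral_withDensity_eq_lintegral_mul _ (hKx x) (by fun_prop),
        withDensity_apply _ MeasurableSet.univ, Measure.restrict_univ] at h3
      simp only [enorm_eq_self, Pi.mul_apply, ENNReal.toReal_one, div_one, ← hrdef] at h3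
      calc (∫⁻ y, K x y * H y ∂ν) ^ r
          ≤ ((∫⁻ y, K x y * H y ^ r ∂ν) ^ (1 / r) * (∫⁻ y, K x y ∂ν) ^ (1 - 1 / r)) ^ r := by
            gcongr
        _ = (∫⁻ y, K x y * H y ^ r ∂ν) * (∫⁻ y, K x y ∂ν) ^ (r - 1) := by
            rw [ENNReal.mul_rpow_of_nonneg _ _ hr.le, ← ENNReal.rpow_mul, ← ENNReal.rpow_mul,
              one_div_mul_cancel hr.ne', ENNReal.rpow_one, sub_mul, one_div_mul_cancel hr.ne',
              one_mul]
        _ ≤ (∫⁻ y, K x y * H y ^ r ∂ν) * A ^ (r - 1) := by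
            gcongr
        _ = _ := mul_comm _ _
    rw [eLpNorm_eq_lintegral_rpow_enorm_toReal hp0 hpt, eLpNorm_eq_lintegral_rpow_enorm_toReal hp0 hpt]
    simp only [enorm_eq_self, ← hrdef, one_div]
    rw [ENNReal.rpow_inv_le_iff hr, ENNReal.mul_rpow_of_nonneg _ _ hr.le, ← ENNReal.rpow_mul,
      inv_mul_cancel₀ hr.ne', ENNReal.rpow_one]
    have hm : Measurable (fun z : X × Y => K z.1 z.2 * H z.2 ^ r) := by
      have : Measurable (fun z : X × Y => K z.1 z.2) := hK
      fun_prop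
    calc ∫⁻ x, (∫⁻ y, K x y * H y ∂ν) ^ r ∂μ
        ≤ ∫⁻ x, A ^ (r - 1) * ∫⁻ y, K x y * H y ^ r ∂ν ∂μ := lintegral_mono_ae key
      _ = A ^ (r - 1) * ∫⁻ x, ∫⁻ y, K x y * H y ^ r ∂ν ∂μ :=
          lintegral_const_mul _ hm.lintegral_prod_right'
      _ = A ^ (r - 1) * ∫⁻ y, ∫⁻ x, K x y * H y ^ r ∂μ ∂ν := by
          rw [lintegral_lintegral_swap hm.aemeasurable]
      _ = A ^ (r - 1) * ∫⁻ y, (∫⁻ x, K x y ∂μ) * H y ^ r ∂ν := by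
          congr 1
          refine lintegral_congr fun y => ?_
          exact lintegral_mul_const _ (hK.comp measurable_prodMk_right)
      _ ≤ A ^ (r - 1) * ∫⁻ y, A * H y ^ r ∂ν := by
          gcongr 1
          refine lintegral_mono_ae ?_
          filter_upwards [h2] with y hy
          gcongr
      _ = A ^ (r - 1) * (A * ∫⁻ y, H y ^ r ∂ν) := by
          rw [lintegral_const_mul _ (by fun_prop)]
      _ = A ^ r * ∫⁻ y, H y ^ r ∂ν := by
          rw [← mul_assoc]
          congr 1
          nth_rewrite 2 [← ENNReal.rpow_one A]
          rw [← ENNReal.rpow_add_of_nonneg _ _ (by linarith) zero_le_one]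
          congr 1
          ring

/-- Young's inequality for the convolution with an integrable function. -/
theorem eLpNorm_lintegral_sub_le {d : ℕ} {m H : Eucl d → ℝ≥0∞} (hm : Measurable m)
    (hH : Measurable H) {p : ℝ≥0∞} (hp : 1 ≤ p) :
    eLpNorm (fun x => ∫⁻ y, m (x - y) * H y) p volume ≤ (∫⁻ y, m y) * eLpNorm H p volume := by
  refine eLpNorm_lintegral_mul_le (K := fun x y => m (x - y)) ?_ ?_ ?_ hp hH
  · exact hm.comp (measurable_fst.sub measurable_snd)
  · exact .of_forall fun x => (lintegral_sub_left_eq_self m x).le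
  · exact .of_forall fun y => (lintegral_sub_right_eq_self m y).le

/-- A substitute for Hölder's inequality in the pairing of L^p with L^1 ∩ L^∞, valid for all p ≥ 1
at once: for p < ∞ it rests on a ≤ 1 + a^p. The constant depends on `H` alone, which makes the later
estimates uniform over test functions. -/
theorem exists_lintegral_mul_le {X : Type*} [MeasurableSpace X] {μ : Measure X}
    {p : ℝ≥0∞} (hp : 1 ≤ p) {H : X → ℝ≥0∞} (hH : Measurable H) (hfin : eLpNorm H p μ < ⊤) :
    ∃ C : ℝ≥0∞, C < ⊤ ∧ ∀ u : X → ℝ≥0∞, ∀ M : ℝ≥0∞, (∀ᵐ x ∂μ, u x ≤ M) →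
      ∫⁻ x, H x * u x ∂μ ≤ C * (∫⁻ x, u x ∂μ + M) := by
  rcases eq_or_ne p ⊤ with rfl | hpt
  · refine ⟨eLpNormEssSup H μ, by simpa using hfin, fun u M _ => ?_⟩
    calc ∫⁻ x, H x * u x ∂μ ≤ ∫⁻ x, eLpNormEssSup H μ * u x ∂μ := by
          refine lintegral_mono_ae ?_
          filter_upwards [enorm_ae_le_eLpNormEssSup H μ] with y hy
          gcongr
          exact hy
      _ = eLpNormEssSup H μ * ∫⁻ x, u x ∂μ := by
          rw [lintegral_const_mul' _ _ (by simpa using hfin.ne)]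
      _ ≤ _ := by gcongr; exact le_self_add
  · have hp0 : p ≠ 0 := (zero_lt_one.trans_le hp).ne'
    have hr1 : 1 ≤ p.toReal := by
      rw [← ENNReal.toReal_one]
      exact ENNReal.toReal_mono hpt hp
    have hD : ∫⁻ x, H x ^ p.toReal ∂μ < ⊤ := by
      have := (eLpNorm_lt_top_iff_lintegral_rpow_enorm_lt_top hp0 hpt).1 hfin
      simpa using this
    refine ⟨max 1 (∫⁻ x, H x ^ p.toReal ∂μ), max_lt ENNReal.one_lt_top hD, fun u M hu => ?_⟩
    have hle : ∀ a : ℝ≥0∞, a ≤ 1 + a ^ p.toReal := by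
      intro a
      rcases le_total a 1 with h | h
      · exact h.trans le_self_add
      · exact (ENNReal.le_rpow_self_of_one_le h hr1).trans le_add_self
    calc ∫⁻ x, H x * u x ∂μ ≤ ∫⁻ x, (u x + H x ^ p.toReal * M) ∂μ := by
          refine lintegral_mono_ae ?_
          filter_upwards [hu] with x hx
          calc H x * u x ≤ (1 + H x ^ p.toReal) * u x := by gcongr; exact hle _
            _ = u x + H x ^ p.toReal * u x := by ring
            _ ≤ _ := by gcongr
      _ = ∫⁻ x, u x ∂μ + (∫⁻ x, H x ^ p.toReal ∂μ) * M := by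
          rw [lintegral_add_right _ (by fun_prop), lintegral_mul_const _ (by fun_prop)]
      _ ≤ max 1 (∫⁻ x, H x ^ p.toReal ∂μ) * (∫⁻ x, u x ∂μ) +
          max 1 (∫⁻ x, H x ^ p.toReal ∂μ) * M := by
          gcongr
          · calc _ = 1 * ∫⁻ x, u x ∂μ := (one_mul _).symm
              _ ≤ _ := by gcongr; exact le_max_left _ _
          · exact le_max_right _ _
      _ = _ := by ring

end

noncomputable section

variable {d : ℕ} {Ω : Opens (Eucl d)} {I J : Type*}

/-! ### Weighted sequence norms -/

theorem ellNorm_eq_ellNorm_one (q : ℝ≥0∞) (w : I → ℝ) (a : I → ℝ≥0∞) :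
    ellNorm q w a = ellNorm q 1 (fun i => ENNReal.ofReal (w i) * a i) := by
  simp [ellNorm]

theorem ellNorm_one_eq_eLpNorm [MeasurableSpace I] [MeasurableSingletonClass I] {q : ℝ≥0∞}
    (hq : 1 ≤ q) (a : I → ℝ≥0∞) : ellNorm q 1 a = eLpNorm a q .count := by
  unfold ellNorm
  have hq0 : q ≠ 0 := (zero_lt_one.trans_le hq).ne'
  split_ifs with h
  · subst h
    rw [eLpNorm_exponent_top, eLpNormEssSup_eq_essSup_enorm, essSup_count]
    simp
  · rw [eLpNorm_eq_lintegral_rpow_enorm_toReal hq0 h, lintegral_count]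
    simp

theorem le_ellNorm {q : ℝ≥0∞} (hq : 1 ≤ q) (w : I → ℝ) (a : I → ℝ≥0∞) (i : I) :
    ENNReal.ofReal (w i) * a i ≤ ellNorm q w a := by
  unfold ellNorm
  split_ifs with h
  · exact le_iSup (fun i => ENNReal.ofReal (w i) * a i) i
  · have hr : 0 < q.toReal := ENNReal.toReal_pos (zero_lt_one.trans_le hq).ne' h
    rw [one_div, ENNReal.le_rpow_inv_iff hr]
    exact ENNReal.le_tsum (f := fun i => (ENNReal.ofReal (w i) * a i) ^ q.toReal) i

theorem lt_top_of_ellNorm_lt_top {q : ℝ≥0∞} (hq : 1 ≤ q) {w : I → ℝ} (hw : ∀ i, 0 < w i)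
    {a : I → ℝ≥0∞} (h : ellNorm q w a < ⊤) (i : I) : a i < ⊤ :=
  ENNReal.lt_top_of_mul_ne_top_right ((le_ellNorm hq w a i).trans_lt h).ne
    (ENNReal.ofReal_pos.2 (hw i)).ne'

/-- The Schur test for sequence spaces. -/
theorem ellNorm_one_tsum_mul_le [Countable I] [Countable J] {q : ℝ≥0∞} (hq : 1 ≤ q)
    (M : I → J → ℝ≥0∞) (b : J → ℝ≥0∞) :
    ellNorm q 1 (fun i => ∑' j, M i j * b j) ≤ schurNorm M * ellNorm q 1 b := by
  let _ : MeasurableSpace I := ⊤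
  let _ : MeasurableSpace J := ⊤
  rw [ellNorm_one_eq_eLpNorm hq, ellNorm_one_eq_eLpNorm hq]
  have := eLpNorm_lintegral_mul_le (μ := (.count : Measure I)) (ν := (.count : Measure J))
    (K := M) (measurable_of_countable _) (A := schurNorm M) (p := q) ?_ ?_ hq
    (measurable_of_countable b)
  · simpa only [lintegral_count] using this
  · refine .of_forall fun i => ?_
    rw [lintegral_count]
    exact (le_iSup (fun i => ∑' j, M i j) i).trans (le_max_left _ _)
  · refine .of_forall fun j => ?_
    rw [lintegral_count]
    exact (le_iSup (fun j => ∑' i, M i j) j).trans (le_max_right _ _)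

theorem ellNorm_tsum_mul_le [Countable I] {q : ℝ≥0∞} (hq : 1 ≤ q) {w : I → ℝ}
    (hw : ∀ i, 0 < w i) (M : I → I → ℝ≥0∞) (b : I → ℝ≥0∞) :
    ellNorm q w (fun i => ∑' l, M i l * b l) ≤
      schurNorm (fun i l => ENNReal.ofReal (w i / w l) * M i l) * ellNorm q w b := by
  rw [ellNorm_eq_ellNorm_one q w, ellNorm_eq_ellNorm_one q w b]
  refine le_trans (le_of_eq ?_) (ellNorm_one_tsum_mul_le hq _ _)
  congr 1
  ext i
  rw [← ENNReal.tsum_mul_left]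
  refine tsum_congr fun l => ?_
  have : ENNReal.ofReal (w i) = ENNReal.ofReal (w i / w l) * ENNReal.ofReal (w l) := by
    rw [← ENNReal.ofReal_mul (div_pos (hw i) (hw l)).le, div_mul_cancel₀ _ (hw l).ne']
  rw [this]
  ring

/-! ### Admissible covers -/

variable {Q : AdmissibleCover Ω I}

theorem AdmissibleCover.mem_neighbors {i l : I} :
    l ∈ Q.neighbors i ↔ (Q.carrier l ∩ Q.carrier i).Nonempty := by
  simp [AdmissibleCover.neighbors]

theorem AdmissibleCover.mem_neighbors_comm {i l : I} :
    l ∈ Q.neighbors i ↔ i ∈ Q.neighbors l := by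
  rw [mem_neighbors, mem_neighbors, Set.inter_comm]

theorem AdmissibleCover.mem_neighbors_self (i : I) : i ∈ Q.neighbors i := by
  rw [mem_neighbors, Set.inter_self]
  exact Q.nonempty i

theorem AdmissibleCover.exists_card_neighbors_le (Q : AdmissibleCover Ω I) :
    ∃ n : ℕ, ∀ i, (Q.neighbors i).card ≤ n := by
  obtain ⟨n, hn⟩ := Q.boundedOverlap
  refine ⟨n, fun i => ?_⟩
  have := hn i
  rw [← Nat.cast_le (α := ℕ∞), ← Set.encard_coe_eq_coe_finsetCard]
  simpa [AdmissibleCover.neighbors] using this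

/-- The operator norm is a supremum over complex sequences in the unit ball. A sequence of finite
norm has finite entries because the weight is positive, so it can be divided by its norm and read as
such a complex sequence. If the norm vanishes, so does the sequence. -/
theorem AdmissibleCover.ellNorm_sum_neighbors_le {q : ℝ≥0∞} (hq : 1 ≤ q) {w : I → ℝ}
    (hw : ∀ i, 0 < w i) {a : I → ℝ≥0∞} (ha : ellNorm q w a < ⊤) :
    ellNorm q w (fun i => ∑ l ∈ Q.neighbors i, a l) ≤ Q.clusteringNorm w q * ellNorm q w a := by
  have hfin := lt_top_of_ellNorm_lt_top hq hw ha
  rcases eq_or_ne (ellNorm q w a) 0 with h0 | h0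
  · have ha0 : ∀ i, a i = 0 := by
      intro i
      have := le_ellNorm hq w a i
      rw [h0, nonpos_iff_eq_zero, mul_eq_zero, ENNReal.ofReal_eq_zero] at this
      exact this.resolve_left (hw i).not_ge
    have ha1 : a = fun _ => 0 := funext ha0
    have := ellNorm_const_mul q hq w 0 (fun _ => 0)
    simp only [zero_mul] at this
    simp [ha1, this]
  · set s := ellNorm q w a with hs
    let c : I → ℂ := fun i => ((a i / s).toReal : ℂ)
    have hc : ∀ i, ‖c i‖ₑ = s⁻¹ * a i := by
      intro i
      have : a i / s ≠ ⊤ := ENNReal.div_ne_top (hfin i).ne h0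
      rw [mul_comm, ← div_eq_mul_inv]
      simp only [c]
      rw [← ofReal_norm, Complex.norm_real, Real.norm_of_nonneg ENNReal.toReal_nonneg,
        ENNReal.ofReal_toReal this]
    have hsum : ∀ i, ‖∑ l ∈ Q.neighbors i, c l‖ₑ = s⁻¹ * ∑ l ∈ Q.neighbors i, a l := by
      intro i
      rw [Finset.mul_sum]
      simp only [← hc]
      simp only [c]
      rw [← Complex.ofReal_sum, ← ofReal_norm, Complex.norm_real,
        Real.norm_of_nonneg (Finset.sum_nonneg fun _ _ => ENNReal.toReal_nonneg),
        ENNReal.ofReal_sum_of_nonneg (fun _ _ => ENNReal.toReal_nonneg)]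
      refine Finset.sum_congr rfl fun l _ => ?_
      rw [← ofReal_norm, Complex.norm_real, Real.norm_of_nonneg ENNReal.toReal_nonneg]
    have h1 : ellNorm q w (fun i => ‖c i‖ₑ) ≤ 1 := by
      simp only [hc]
      rw [ellNorm_const_mul q hq, ← hs, ENNReal.inv_mul_cancel h0 ha.ne]
    have h2 : ellNorm q w (fun i => ‖∑ l ∈ Q.neighbors i, c l‖ₑ) ≤ Q.clusteringNorm w q :=
      le_iSup₂ (f := fun (c : I → ℂ) (_ : ellNorm q w (fun i => ‖c i‖ₑ) ≤ 1) =>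
        ellNorm q w (fun i => ‖∑ l ∈ Q.neighbors i, c l‖ₑ)) c h1
    simp only [hsum] at h2
    rw [ellNorm_const_mul q hq] at h2
    rwa [ENNReal.inv_mul_le_iff h0 ha.ne, mul_comm] at h2

/-- The clustering matrix has at most n nonzero entries in every row and, by symmetry of the
neighbour relation, in every column. Moderateness bounds the weighted entries by C, so the Schur
test applies with constant n C. -/
theorem AdmissibleCover.clusteringNorm_lt_top [Countable I] {q : ℝ≥0∞} (hq : 1 ≤ q) {w : I → ℝ}
    (hw : Q.IsModerate w) : Q.clusteringNorm w q < ⊤ := by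
  classical
  obtain ⟨hw0, C, hC⟩ := hw
  obtain ⟨n, hn⟩ := Q.exists_card_neighbors_le
  let M : I → I → ℝ≥0∞ := fun i l => if l ∈ Q.neighbors i then 1 else 0
  have hM : schurNorm (fun i l => ENNReal.ofReal (w i / w l) * M i l) ≤ n * ENNReal.ofReal C := by
    have hle : ∀ i l, ENNReal.ofReal (w i / w l) * M i l ≤
        if l ∈ Q.neighbors i then ENNReal.ofReal C else 0 := by
      intro i l
      by_cases h : l ∈ Q.neighbors i
      · simp only [M, h, if_true, mul_one]
        exact ENNReal.ofReal_le_ofReal (hC i l h)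
      · simp [M, h]
    have hrow : ∀ i, ∑' l, (if l ∈ Q.neighbors i then ENNReal.ofReal C else 0) ≤
        n * ENNReal.ofReal C := by
      intro i
      rw [tsum_eq_sum (s := Q.neighbors i) (fun l hl => by simp [hl]),
        Finset.sum_congr rfl (fun l hl => if_pos hl)]
      simp only [Finset.sum_const, nsmul_eq_mul]
      gcongr
      exact hn i
    refine max_le (iSup_le fun i => ?_) (iSup_le fun l => ?_)
    · exact (ENNReal.tsum_le_tsum (hle i)).trans (hrow i)
    · refine (ENNReal.tsum_le_tsum fun i => ?_).trans (hrow l)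
      simpa only [AdmissibleCover.mem_neighbors_comm (i := i)] using hle i l
  refine lt_of_le_of_lt (iSup₂_le fun c hc => ?_)
    (ENNReal.mul_lt_top (ENNReal.natCast_lt_top n) ENNReal.ofReal_lt_top : n * ENNReal.ofReal C < ⊤)
  calc ellNorm q w (fun i => ‖∑ l ∈ Q.neighbors i, c l‖ₑ)
      ≤ ellNorm q w (fun i => ∑' l, M i l * ‖c l‖ₑ) := by
        refine ellNorm_mono q w fun i => ?_
        rw [tsum_eq_sum (s := Q.neighbors i) (fun l hl => by simp [M, hl])]
        refine (enorm_sum_le _ _).trans (Finset.sum_le_sum fun l hl => ?_)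
        simp [M, hl]
    _ ≤ _ * ellNorm q w (fun i => ‖c i‖ₑ) := ellNorm_tsum_mul_le hq hw0 _ _
    _ ≤ n * ENNReal.ofReal C * 1 := by gcongr
    _ = _ := mul_one _

/-! ### Partitions of unity -/

namespace BAPU

variable (Φ : BAPU Q)

theorem fn_eq_zero {i : I} {ξ : Eucl d} (h : ξ ∉ Q.carrier i) : Φ.fn i ξ = 0 := by
  by_cases hξ : ξ ∈ (Ω : Set (Eucl d))
  · exact Φ.eq_zero i ξ ⟨hξ, h⟩
  · by_contra h0
    exact hξ ((Φ.fn i).tsupport_subset (subset_tsupport _ h0))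

theorem carrier_subset (Q : AdmissibleCover Ω I) (i : I) : Q.carrier i ⊆ Ω := by
  rw [← Q.iUnion_eq]
  exact Set.subset_iUnion _ i

theorem sum_neighbors_eq_one {i : I} {ξ : Eucl d} (h : ξ ∈ Q.carrier i) :
    ∑ l ∈ Q.neighbors i, Φ.fn l ξ = 1 := by
  refine (hasSum_sum_of_ne_finset_zero fun l hl => ?_).unique
    (Φ.hasSum_one ξ (carrier_subset Q i h))
  refine Φ.fn_eq_zero fun hξ => hl ?_
  exact AdmissibleCover.mem_neighbors.2 ⟨ξ, hξ, h⟩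

theorem sum_neighbors_mul_fn (i : I) (ξ : Eucl d) :
    (∑ l ∈ Q.neighbors i, Φ.fn l ξ) * Φ.fn i ξ = Φ.fn i ξ := by
  by_cases h : ξ ∈ Q.carrier i
  · rw [Φ.sum_neighbors_eq_one h, one_mul]
  · rw [Φ.fn_eq_zero h, mul_zero]

theorem fn_mul_fn_eq_zero {i l : I} (h : l ∉ Q.neighbors i) (ξ : Eucl d) :
    Φ.fn l ξ * Φ.fn i ξ = 0 := by
  by_cases h1 : ξ ∈ Q.carrier l
  · by_cases h2 : ξ ∈ Q.carrier i
    · exact absurd (AdmissibleCover.mem_neighbors.2 ⟨ξ, h1, h2⟩) h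
    · rw [Φ.fn_eq_zero h2, mul_zero]
  · rw [Φ.fn_eq_zero h1, zero_mul]

theorem exists_fn_ne_zero {ξ : Eucl d} (h : ξ ∈ Ω) : ∃ i, Φ.fn i ξ ≠ 0 := by
  by_contra! h0
  have := Φ.hasSum_one ξ h
  simp only [h0] at this
  exact one_ne_zero (this.unique hasSum_zero)

/-- A compact subset of `Ω` meets only finitely many sets of the cover. -/
theorem exists_finset_of_isCompact (Φ : BAPU Q) {K : Set (Eucl d)} (hK : IsCompact K) (hKΩ : K ⊆ Ω) :
    ∃ F : Finset I, ∀ i ∉ F, Disjoint (Q.carrier i) K := by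
  classical
  -- The sets Q_i need not be open. Compactness is applied to the open sets {φ_i ≠ 0} ⊆ Q_i, and the
  -- neighbours of the selected indices catch every Q_i that meets K.
  obtain ⟨t, ht⟩ := hK.elim_finite_subcover (fun i => Function.support (Φ.fn i))
    (fun i => (Φ.fn i).continuous.isOpen_support)
    (fun ξ hξ => Set.mem_iUnion.2 (Φ.exists_fn_ne_zero (hKΩ hξ)))
  refine ⟨t.biUnion Q.neighbors, fun i hi => Set.disjoint_left.2 fun ξ h1 h2 => hi ?_⟩
  obtain ⟨l, hl, hξ⟩ := Set.mem_iUnion₂.1 (ht h2)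
  refine Finset.mem_biUnion.2 ⟨l, hl, AdmissibleCover.mem_neighbors.2 ⟨ξ, h1, ?_⟩⟩
  by_contra h
  exact hξ (Φ.fn_eq_zero h)

theorem sum_eq_one {K : Set (Eucl d)} (hKΩ : K ⊆ Ω) {F : Finset I}
    (hF : ∀ i ∉ F, Disjoint (Q.carrier i) K) {ξ : Eucl d} (hξ : ξ ∈ K) :
    ∑ i ∈ F, Φ.fn i ξ = 1 :=
  (hasSum_sum_of_ne_finset_zero fun l hl =>
    Φ.fn_eq_zero fun h => Set.disjoint_left.1 (hF l hl) h hξ).unique (Φ.hasSum_one ξ (hKΩ hξ))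

/-- By the Lindelöf property countably many of the open sets {φ_l ≠ 0} already cover O. Every Q_i is
nonempty and meets one of them, so i lies in one of countably many finite sets l^*. -/
theorem countable_index (Φ : BAPU Q) : Countable I := by
  classical
  obtain ⟨t, htc, ht⟩ := isOpen_iUnion_countable (fun i => Function.support (Φ.fn i))
    (fun i => (Φ.fn i).continuous.isOpen_support)
  have : (Set.univ : Set I) ⊆ ⋃ l ∈ t, (Q.neighbors l : Set I) := by
    intro i _
    obtain ⟨ξ, hξ⟩ := Q.nonempty i
    have h1 : ξ ∈ ⋃ i, Function.support (Φ.fn i) :=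
      Set.mem_iUnion.2 (Φ.exists_fn_ne_zero (carrier_subset Q i hξ))
    rw [← ht] at h1
    obtain ⟨l, hl, hl'⟩ := Set.mem_iUnion₂.1 h1
    refine Set.mem_iUnion₂.2 ⟨l, hl, AdmissibleCover.mem_neighbors.2 ⟨ξ, hξ, ?_⟩⟩
    by_contra h
    exact hl' (Φ.fn_eq_zero h)
  rw [← Set.countable_univ_iff]
  exact (htc.biUnion fun l _ => (Q.neighbors l).finite_toSet.countable).mono this

end BAPU

end

noncomputable section

variable {d : ℕ} {Ω : Opens (Eucl d)} {I J : Type*}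

/-! ### Plane waves -/

theorem planeWave_eq_fourierChar (x ξ : Eucl d) :
    planeWave x ξ = Real.fourierChar (inner ℝ x ξ) := by
  rw [planeWave, Real.fourierChar_apply]
  congr 1
  push_cast
  ring

@[simp]
theorem norm_planeWave (x ξ : Eucl d) : ‖planeWave x ξ‖ = 1 := by
  rw [planeWave_eq_fourierChar]
  exact Circle.norm_coe _

@[simp]
theorem enorm_planeWave (x ξ : Eucl d) : ‖planeWave x ξ‖ₑ = 1 := by
  rw [← ofReal_norm, norm_planeWave, ENNReal.ofReal_one]

theorem planeWave_add_left (x y ξ : Eucl d) :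
    planeWave (x + y) ξ = planeWave x ξ * planeWave y ξ := by
  simp only [planeWave, ← Complex.exp_add, inner_add_left]
  congr 1
  push_cast
  ring

theorem planeWave_add_right (x ξ η : Eucl d) :
    planeWave x (ξ + η) = planeWave x ξ * planeWave x η := by
  simp only [planeWave, ← Complex.exp_add, inner_add_right]
  congr 1
  push_cast
  ring

theorem planeWave_comm (x ξ : Eucl d) : planeWave x ξ = planeWave ξ x := by
  simp only [planeWave, real_inner_comm]

theorem planeWave_neg_right (x ξ : Eucl d) : planeWave x (-ξ) = planeWave (-x) ξ := by
  simp only [planeWave, inner_neg_left, inner_neg_right]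

theorem conj_planeWave (x ξ : Eucl d) : conj (planeWave x ξ) = planeWave (-x) ξ := by
  rw [planeWave_eq_fourierChar, planeWave_eq_fourierChar, ← Circle.coe_inv_eq_conj, inner_neg_left,
    AddChar.map_neg_eq_inv]

theorem fourier_eq_integral_planeWave (f : Eucl d → ℂ) (ξ : Eucl d) :
    𝓕 f ξ = ∫ x, planeWave (-x) ξ * f x := by
  rw [Real.fourier_eq]
  refine integral_congr_ae (.of_forall fun x => ?_)
  simp only [planeWave_eq_fourierChar, inner_neg_left, Circle.smul_def, smul_eq_mul]

theorem fourierInv_eq_integral_planeWave (f : Eucl d → ℂ) (x : Eucl d) :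
    𝓕⁻ f x = ∫ ξ, planeWave x ξ * f ξ := by
  rw [Real.fourierInv_eq]
  refine integral_congr_ae (.of_forall fun ξ => ?_)
  simp only [planeWave_eq_fourierChar, Circle.smul_def, smul_eq_mul, real_inner_comm]

theorem iteratedDeriv_cexp_mul_ofReal (c : ℂ) (k : ℕ) :
    iteratedDeriv k (fun t : ℝ => Complex.exp (c * t)) =
      fun t : ℝ => c ^ k * Complex.exp (c * t) := by
  induction k with
  | zero => simp
  | succ k ih =>
    rw [iteratedDeriv_succ, ih]
    ext t
    have h1 : HasDerivAt (fun t : ℝ => Complex.exp (c * t)) (Complex.exp (c * t) * c) t := by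
      have h2 : HasDerivAt (fun t : ℝ => c * (t : ℂ)) c t := by
        simpa using (Complex.ofRealCLM.hasDerivAt (x := t)).const_mul c
      exact h2.cexp
    rw [(h1.const_mul (c ^ k)).deriv]
    ring

/-- A plane wave is a one-variable exponential composed with ξ ↦ ⟨x, ξ⟩, so each derivative costs
one factor 2π‖x‖. This is the source of the polynomial growth of the localized inverse transforms.
-/
theorem norm_iteratedFDeriv_planeWave_le (x ξ : Eucl d) (k : ℕ) :
    ‖iteratedFDeriv ℝ k (planeWave x) ξ‖ ≤ (2 * Real.pi * ‖x‖) ^ k := by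
  let g : ℝ → ℂ := fun t => Complex.exp (2 * Real.pi * Complex.I * t)
  have hg : ContDiff ℝ ∞ g :=
    Complex.contDiff_exp.comp (contDiff_const.mul Complex.ofRealCLM.contDiff)
  have h1 : planeWave x = g ∘ (innerSL ℝ x) := by
    ext ξ
    simp [planeWave, g]
  rw [h1, ContinuousLinearMap.iteratedFDeriv_comp_right _ hg _ (mod_cast le_top)]
  refine (ContinuousMultilinearMap.norm_compContinuousLinearMap_le _ _).trans ?_
  rw [norm_iteratedFDeriv_eq_norm_iteratedDeriv, iteratedDeriv_cexp_mul_ofReal]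
  have h2 : ‖Complex.exp (2 * Real.pi * Complex.I * ((innerSL ℝ x) ξ : ℝ))‖ = 1 := by
    have := norm_planeWave x ξ
    simpa [planeWave] using this
  rw [norm_mul, h2, mul_one, Finset.prod_const, Finset.card_univ, Fintype.card_fin,
    innerSL_apply_norm, norm_pow, ← mul_pow]
  simp [abs_of_pos Real.pi_pos]

/-! ### Differentiation under the integral sign -/

theorem linearIsometryEquiv_integral_fderiv {X E G G' : Type*} [MeasurableSpace X]
    {μ : Measure X} [NormedAddCommGroup E] [NormedSpace ℝ E] [NormedAddCommGroup G]
    [NormedSpace ℝ G] [NormedAddCommGroup G'] [NormedSpace ℝ G'] [CompleteSpace G]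
    [CompleteSpace G'] (e : (E →L[ℝ] G) ≃ₗᵢ[ℝ] G') {D : X → E → G} {ξ : E}
    (hm : AEStronglyMeasurable (fun x => fderiv ℝ (D x) ξ) μ) {b : X → ℝ} (hb : Integrable b μ)
    (hD : ∀ x, ‖fderiv ℝ (D x) ξ‖ ≤ b x) :
    e (∫ x, fderiv ℝ (D x) ξ ∂μ) = ∫ x, e (fderiv ℝ (D x) ξ) ∂μ :=
  (ContinuousLinearMap.integral_comp_comm (e.toContinuousLinearEquiv.toContinuousLinearMap)
    (hb.mono' hm (.of_forall hD))).symm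

/-- Induction on the order. The majorants do not depend on ξ, so the theorem on dominated
differentiation can be applied with the whole space as neighbourhood; what remains is to carry the
integral through the currying isometries. -/
theorem iteratedFDeriv_integral {X E : Type*} [MeasurableSpace X] {μ : Measure X}
    [NormedAddCommGroup E] [NormedSpace ℝ E] {F : X → E → ℂ} (hF : ∀ x, ContDiff ℝ ∞ (F x))
    (hm : ∀ k ξ, AEStronglyMeasurable (fun x => iteratedFDeriv ℝ k (F x) ξ) μ) {b : ℕ → X → ℝ}
    (hb : ∀ k, Integrable (b k) μ) (hFb : ∀ k x ξ, ‖iteratedFDeriv ℝ k (F x) ξ‖ ≤ b k x) (k : ℕ) :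
    iteratedFDeriv ℝ k (fun ξ => ∫ x, F x ξ ∂μ) = fun ξ => ∫ x, iteratedFDeriv ℝ k (F x) ξ ∂μ := by
  induction k with
  | zero =>
    ext1 ξ
    simp only [iteratedFDeriv_zero_eq_comp, Function.comp_apply]
    exact ((continuousMultilinearCurryFin0 ℝ E ℂ).symm.toContinuousLinearEquiv.integral_comp_comm
      _).symm
  | succ k ih =>
    ext1 ξ
    rw [iteratedFDeriv_succ_eq_comp_left]
    simp only [Function.comp_apply, ih]
    have hsm : ∀ x, ContDiff ℝ ∞ (iteratedFDeriv ℝ k (F x)) := fun x =>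
      (hF x).iteratedFDeriv_right (mod_cast le_top)
    have hnorm : ∀ x ξ, ‖fderiv ℝ (iteratedFDeriv ℝ k (F x)) ξ‖ ≤ b (k + 1) x := by
      intro x ξ
      rw [norm_fderiv_iteratedFDeriv]
      exact hFb (k + 1) x ξ
    have hsucc : ∀ x ξ, iteratedFDeriv ℝ (k + 1) (F x) ξ =
        (continuousMultilinearCurryLeftEquiv ℝ (fun _ : Fin (k + 1) => E) ℂ).symm
          (fderiv ℝ (iteratedFDeriv ℝ k (F x)) ξ) := fun x ξ => by
      rw [iteratedFDeriv_succ_eq_comp_left]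
      rfl
    have hm' : AEStronglyMeasurable (fun x => fderiv ℝ (iteratedFDeriv ℝ k (F x)) ξ) μ := by
      have := (continuousMultilinearCurryLeftEquiv ℝ (fun _ : Fin (k + 1) => E)
        ℂ).continuous.comp_aestronglyMeasurable (hm (k + 1) ξ)
      refine this.congr (.of_forall fun x => ?_)
      simp only [hsucc, LinearIsometryEquiv.apply_symm_apply]
    have key := hasFDerivAt_integral_of_dominated_of_fderiv_le (𝕜 := ℝ) (μ := μ)
      (F := fun ξ x => iteratedFDeriv ℝ k (F x) ξ)
      (F' := fun ξ x => fderiv ℝ (iteratedFDeriv ℝ k (F x)) ξ) (x₀ := ξ) (bound := b (k + 1))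
      Filter.univ_mem (.of_forall fun η => hm k η)
      ((hb k).mono' (hm k ξ) (.of_forall fun x => hFb k x ξ)) hm'
      (.of_forall fun x η _ => hnorm x η) (hb (k + 1))
      (.of_forall fun x η _ => ((hsm x).differentiable (by simp)).differentiableAt.hasFDerivAt)
    rw [key.fderiv]
    simp only [hsucc]
    exact linearIsometryEquiv_integral_fderiv _ hm' (hb (k + 1)) (fun x => hnorm x ξ)

/-! ### Extension of dominated functionals -/

/-- The bound forces ker j ⊆ ker T, so T factors through the range of j, where it is bounded;
Hahn–Banach extends it. This moves a distribution to a Banach space, where functionals commute with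
Bochner integrals. -/
theorem exists_continuousLinearMap_comp_eq {V X : Type*} [AddCommGroup V] [Module ℂ V]
    [NormedAddCommGroup X] [NormedSpace ℂ X] (j : V →ₗ[ℂ] X) (T : V →ₗ[ℂ] ℂ) {C : ℝ}
    (h : ∀ v, ‖T v‖ ≤ C * ‖j v‖) : ∃ L : X →L[ℂ] ℂ, ∀ v, L (j v) = T v := by
  have hker : LinearMap.ker j ≤ LinearMap.ker T := by
    intro v hv
    rw [LinearMap.mem_ker] at hv ⊢
    have := h v
    rw [hv, norm_zero, mul_zero] at this
    exact norm_le_zero_iff.1 this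
  let T' : LinearMap.range j →ₗ[ℂ] ℂ :=
    (LinearMap.ker j).liftQ T hker ∘ₗ j.quotKerEquivRange.symm.toLinearMap
  have hT' : ∀ v, T' ⟨j v, LinearMap.mem_range_self j v⟩ = T v := by
    intro v
    have : j.quotKerEquivRange.symm ⟨j v, LinearMap.mem_range_self j v⟩ =
        (LinearMap.ker j).mkQ v := j.quotKerEquivRange_symm_apply_image v _
    simp only [T', LinearMap.comp_apply, LinearEquiv.coe_coe, this]
    rfl
  obtain ⟨L, hL, -⟩ := exists_extension_norm_eq (LinearMap.range j)
    (T'.mkContinuous C (by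
      rintro ⟨_, v, rfl⟩
      rw [hT']
      exact h v))
  refine ⟨L, fun v => ?_⟩
  have := hL ⟨j v, LinearMap.mem_range_self j v⟩
  rw [this]
  exact hT' v

end

noncomputable section

variable {d : ℕ} {Ω : Opens (Eucl d)} {I J : Type*}

/-! ### Localized inverse Fourier transforms of distributions -/

theorem SchwartzMap.integrable_one_add_norm_pow_mul (u : 𝓢(Eucl d, ℂ)) (k : ℕ) :
    Integrable (fun x => (1 + ‖x‖) ^ k * ‖u x‖) := by
  have h := ((u.integrable (μ := volume)).norm.add (u.integrable_pow_mul volume k)).const_mul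
    (2 ^ (k - 1))
  refine h.mono' (by fun_prop) (.of_forall fun x => ?_)
  rw [Real.norm_of_nonneg (by positivity)]
  calc (1 + ‖x‖) ^ k * ‖u x‖ ≤ (2 ^ (k - 1) * (1 ^ k + ‖x‖ ^ k)) * ‖u x‖ := by
        gcongr
        exact add_pow_le zero_le_one (norm_nonneg x) k
    _ = 2 ^ (k - 1) * (‖u x‖ + ‖x‖ ^ k * ‖u x‖) := by ring

/-- The support of a test function as a compact set. -/
def TestFunction.suppCompacts (χ : 𝓓(Ω, ℂ)) : Compacts (Eucl d) := ⟨tsupport χ, χ.hasCompactSupport⟩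

/-- The product of a test function with a smooth function, as a function supported in the support
of the test function. -/
def TestFunction.mulSupp (χ : 𝓓(Ω, ℂ)) (h : Eucl d → ℂ) (hh : ContDiff ℝ ∞ h) :
    𝓓_{χ.suppCompacts}(Eucl d, ℂ) :=
  .of_support_subset (f := fun ξ => χ ξ * h ξ) (χ.contDiff.mul hh)
    (fun ξ hξ => subset_closure (fun h => hξ (by simp [h])))

theorem TestFunction.coe_mulSupp (χ : 𝓓(Ω, ℂ)) (h : Eucl d → ℂ) (hh : ContDiff ℝ ∞ h) :
    (χ.mulSupp h hh : Eucl d → ℂ) = fun ξ => χ ξ * h ξ := rfl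

@[simp]
theorem TestFunction.mulSmooth_apply (χ : 𝓓(Ω, ℂ)) (h : Eucl d → ℂ) (hh : ContDiff ℝ ∞ h)
    (ξ : Eucl d) : χ.mulSmooth h hh ξ = χ ξ * h ξ := rfl

/-- With the support held in a fixed compact set, convergence means uniform convergence of each
derivative. The derivatives are jointly continuous in (x, ξ), and compactness of the support makes
their continuity in x uniform in ξ. -/
theorem TestFunction.continuous_mulSupp_planeWave (χ : 𝓓(Ω, ℂ)) :
    Continuous (fun x => χ.mulSupp (planeWave x) (contDiff_planeWave x)) := by
  rw [ContDiffMapSupportedIn.continuous_iff_comp]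
  intro i
  let G : Eucl d × Eucl d → ℂ := fun p => χ p.2 * planeWave p.1 p.2
  have hG : ContDiff ℝ ∞ G := (χ.contDiff.comp contDiff_snd).mul contDiff_planeWave_uncurry
  have key : ∀ x ξ, iteratedFDeriv ℝ i (χ.mulSupp (planeWave x) (contDiff_planeWave x)) ξ =
      (iteratedFDeriv ℝ i G (x, ξ)).compContinuousLinearMap
        (fun _ => ContinuousLinearMap.inr ℝ (Eucl d) (Eucl d)) := by
    intro x ξ
    have h1 : (χ.mulSupp (planeWave x) (contDiff_planeWave x) : Eucl d → ℂ) =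
        (fun p => G (p + (x, 0))) ∘ (ContinuousLinearMap.inr ℝ (Eucl d) (Eucl d)) := by
      ext η
      simp [G, TestFunction.coe_mulSupp]
    have h2 : ContDiff ℝ ∞ (fun p : Eucl d × Eucl d => G (p + (x, 0))) :=
      hG.comp (contDiff_id.add contDiff_const)
    rw [h1, ContinuousLinearMap.iteratedFDeriv_comp_right _ h2 _ (mod_cast le_top),
      iteratedFDeriv_comp_add_right]
    simp
  have hc : Continuous (fun p : Eucl d × Eucl d =>
      iteratedFDeriv ℝ i (χ.mulSupp (planeWave p.1) (contDiff_planeWave p.1)) p.2) := by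
    simp only [key]
    exact (ContinuousMultilinearMap.compContinuousLinearMapL
      (fun _ : Fin i => ContinuousLinearMap.inr ℝ (Eucl d) (Eucl d))).continuous.comp
        (hG.continuous_iteratedFDeriv (mod_cast le_top))
  rw [continuous_iff_continuousAt]
  intro x
  rw [ContinuousAt, BoundedContinuousFunction.tendsto_iff_tendstoUniformly]
  intro u hu
  obtain ⟨v, hv, hvu⟩ := χ.suppCompacts.isCompact.mem_uniformity_of_prod (s := Set.univ)
    (f := fun x ξ => iteratedFDeriv ℝ i (χ.mulSupp (planeWave x) (contDiff_planeWave x)) ξ)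
    hc.continuousOn (Set.mem_univ x) (symm_le_uniformity hu)
  rw [nhdsWithin_univ] at hv
  filter_upwards [hv] with y hy ξ
  simp only [Function.comp_apply, ContDiffMapSupportedIn.structureMapCLM_top_apply]
  by_cases hξ : ξ ∈ χ.suppCompacts
  · exact hvu y hy ξ hξ
  · rw [ContDiffMapSupportedIn.iteratedFDeriv_zero_on_compl _ hξ,
      ContDiffMapSupportedIn.iteratedFDeriv_zero_on_compl _ hξ]
    exact refl_mem_uniformity hu

/-- Leibniz' rule, with bounded derivatives of χ and growth of order k − i from the plane wave. -/
theorem TestFunction.exists_norm_iteratedFDeriv_mulSupp_planeWave_le (χ : 𝓓(Ω, ℂ)) (k : ℕ) :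
    ∃ C : ℝ, 0 ≤ C ∧ ∀ x ξ, ‖iteratedFDeriv ℝ k (χ.mulSupp (planeWave x) (contDiff_planeWave x)) ξ‖
      ≤ C * (1 + ‖x‖) ^ k := by
  have hbd : ∀ i : ℕ, ∃ B : ℝ, ∀ ξ, ‖iteratedFDeriv ℝ i χ ξ‖ ≤ B := fun i =>
    (χ.hasCompactSupport.iteratedFDeriv i).exists_bound_of_continuous
      (χ.contDiff.continuous_iteratedFDeriv (mod_cast le_top))
  choose B hB using hbd
  have hB0 : ∀ i, 0 ≤ B i := fun i => (norm_nonneg _).trans (hB i 0)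
  refine ⟨∑ i ∈ Finset.range (k + 1), k.choose i * B i * (2 * Real.pi) ^ (k - i),
    Finset.sum_nonneg fun i _ => mul_nonneg (mul_nonneg (by positivity) (hB0 i))
      (by positivity), fun x ξ => ?_⟩
  rw [TestFunction.coe_mulSupp]
  refine (norm_iteratedFDeriv_mul_le χ.contDiff (contDiff_planeWave x) ξ (n := k)
    (mod_cast le_top)).trans ?_
  rw [Finset.sum_mul]
  refine Finset.sum_le_sum fun i hi => ?_
  have h1 : (2 * Real.pi * ‖x‖) ^ (k - i) ≤ (2 * Real.pi) ^ (k - i) * (1 + ‖x‖) ^ k := by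
    rw [mul_pow]
    gcongr
    calc ‖x‖ ^ (k - i) ≤ (1 + ‖x‖) ^ (k - i) := by gcongr; linarith
      _ ≤ (1 + ‖x‖) ^ k := pow_le_pow_right₀ (by linarith [norm_nonneg x]) (Nat.sub_le k i)
  calc _ ≤ k.choose i * B i * ((2 * Real.pi) ^ (k - i) * (1 + ‖x‖) ^ k) := by
        have := hB0 i
        gcongr
        · exact hB i ξ
        · exact (norm_iteratedFDeriv_planeWave_le x ξ _).trans h1
    _ = _ := by ring

/-- The function `x ↦ ⟨χ T, e_x⟩`, the inverse Fourier transform of `χ T`. -/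
def DistributionOn.locFn (T : DistributionOn Ω) (χ : 𝓓(Ω, ℂ)) (x : Eucl d) : ℂ :=
  T (χ.mulSmooth (planeWave x) (contDiff_planeWave x))

theorem DistributionOn.continuous_locFn (T : DistributionOn Ω) (χ : 𝓓(Ω, ℂ)) :
    Continuous (T.locFn χ) :=
  (T.toStrongDual).continuous.comp (continuous_mulSmooth_planeWave χ)

theorem contDiff_fourierInv_schwartz (u : 𝓢(Eucl d, ℂ)) : ContDiff ℝ ∞ (𝓕⁻ (u : Eucl d → ℂ)) := by
  rw [← SchwartzMap.fourierInv_coe]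
  exact (𝓕⁻ u).smooth ⊤

/-- Families of bounded continuous candidates for the derivatives of the orders in `s`. -/
def JetSpace (d : ℕ) (s : Finset ℕ) : Type :=
  (i : s) → BoundedContinuousFunction (Eucl d) (Eucl d [×(i : ℕ)]→L[ℝ] ℂ)

/-! ### Jets of test functions in a Banach space -/

namespace JetSpace

variable {s : Finset ℕ}

instance : NormedAddCommGroup (JetSpace d s) :=
  inferInstanceAs (NormedAddCommGroup
    ((i : s) → BoundedContinuousFunction (Eucl d) (Eucl d [×(i : ℕ)]→L[ℝ] ℂ)))

instance : NormedSpace ℂ (JetSpace d s) :=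
  inferInstanceAs (NormedSpace ℂ
    ((i : s) → BoundedContinuousFunction (Eucl d) (Eucl d [×(i : ℕ)]→L[ℝ] ℂ)))

instance : CompleteSpace (JetSpace d s) :=
  inferInstanceAs (CompleteSpace
    ((i : s) → BoundedContinuousFunction (Eucl d) (Eucl d [×(i : ℕ)]→L[ℝ] ℂ)))

/-- The derivatives of a test function. -/
def ofTest (s : Finset ℕ) (K : Compacts (Eucl d)) : 𝓓_{K}(Eucl d, ℂ) →ₗ[ℂ] JetSpace d s :=
  LinearMap.pi fun i : s => ContDiffMapSupportedIn.structureMapLM ℂ ⊤ (i : ℕ)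

theorem norm_le_iff {C : ℝ} (hC : 0 ≤ C) (F : JetSpace d s) :
    ‖F‖ ≤ C ↔ ∀ (i : s) (ξ : Eucl d), ‖F i ξ‖ ≤ C := by
  refine (pi_norm_le_iff_of_nonneg hC).trans (forall_congr' fun i => ?_)
  exact BoundedContinuousFunction.norm_le hC

theorem ofTest_apply {K : Compacts (Eucl d)} (φ : 𝓓_{K}(Eucl d, ℂ)) (i : s) (ξ : Eucl d) :
    ofTest s K φ i ξ = iteratedFDeriv ℝ i φ ξ :=
  congrFun (ContDiffMapSupportedIn.structureMapLM_top_apply (𝕜 := ℂ) (i := (i : ℕ)) φ) ξ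

theorem continuous_ofTest (K : Compacts (Eucl d)) :
    Continuous (ofTest s K : 𝓓_{K}(Eucl d, ℂ) → JetSpace d s) :=
  continuous_pi fun i : s => (ContDiffMapSupportedIn.structureMapCLM ℂ ⊤ (i : ℕ)).continuous

/-- Evaluation of the candidate for the `i`-th derivative. -/
def eval (i : s) (ξ : Eucl d) (v : Fin (i : ℕ) → Eucl d) : JetSpace d s →L[ℂ] ℂ :=
  LinearMap.mkContinuous
    { toFun := fun F => F i ξ v
      map_add' := fun _ _ => rfl
      map_smul' := fun _ _ => rfl } (∏ j, ‖v j‖) (fun F => by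
    refine ((F i ξ).le_opNorm v).trans ?_
    rw [mul_comm]
    gcongr
    exact (norm_le_iff (norm_nonneg F) F).1 le_rfl i ξ)

theorem eval_apply (i : s) (ξ : Eucl d) (v : Fin (i : ℕ) → Eucl d) (F : JetSpace d s) :
    eval i ξ v F = F i ξ v := rfl

end JetSpace

/-- On functions supported in a fixed compact set a distribution has finite order: it is dominated
by the sup norms of finitely many derivatives. Hence it factors, by Hahn–Banach, through the Banach
space of the corresponding jets. -/
theorem DistributionOn.exists_dominated (T : DistributionOn Ω) (χ : 𝓓(Ω, ℂ)) :
    ∃ (s : Finset ℕ) (L : JetSpace d s →L[ℂ] ℂ), ∀ h hh,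
      L (JetSpace.ofTest s _ (χ.mulSupp h hh)) = T (χ.mulSmooth h hh) := by
  have hK : (χ.suppCompacts : Set (Eucl d)) ⊆ Ω := χ.tsupport_subset
  let TK : 𝓓_{χ.suppCompacts}(Eucl d, ℂ) →L[ℂ] ℂ :=
    T.toStrongDual ∘L TestFunction.ofSupportedInCLM ℂ hK
  obtain ⟨s, C, -, hC⟩ := Seminorm.bound_of_continuous
    (ContDiffMapSupportedIn.withSeminorms ℂ (Eucl d) ℂ ⊤ χ.suppCompacts)
    ((normSeminorm ℂ ℂ).comp TK.toLinearMap) (continuous_norm.comp TK.continuous)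
  obtain ⟨L, hL⟩ := exists_continuousLinearMap_comp_eq (JetSpace.ofTest s χ.suppCompacts)
    TK.toLinearMap (C := C) (by
      intro v
      refine (hC v).trans ?_
      rw [smul_apply, NNReal.smul_def, smul_eq_mul]
      gcongr
      refine Seminorm.finset_sup_apply_le (norm_nonneg _) fun i hi => ?_
      exact norm_le_pi_norm (JetSpace.ofTest s χ.suppCompacts v) ⟨i, hi⟩)
  exact ⟨s, L, fun h hh => hL (χ.mulSupp h hh)⟩

/-- The easy half of Paley–Wiener–Schwartz: the exponent is the local order of T on the support of
χ, since each derivative of χ e_x grows polynomially in x. -/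
theorem DistributionOn.exists_norm_locFn_le (T : DistributionOn Ω) (χ : 𝓓(Ω, ℂ)) :
    ∃ (C : ℝ) (m : ℕ), 0 ≤ C ∧ ∀ x, ‖T.locFn χ x‖ ≤ C * (1 + ‖x‖) ^ m := by
  obtain ⟨s, L, hL⟩ := T.exists_dominated χ
  choose B hB0 hB using χ.exists_norm_iteratedFDeriv_mulSupp_planeWave_le
  refine ⟨‖L‖ * ∑ i ∈ s, B i, s.sup id, mul_nonneg (norm_nonneg _)
    (Finset.sum_nonneg fun i _ => hB0 i), fun x => ?_⟩
  rw [DistributionOn.locFn, ← hL, mul_assoc]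
  refine (L.le_opNorm _).trans ?_
  gcongr
  have hS : 0 ≤ ∑ i ∈ s, B i := Finset.sum_nonneg fun i _ => hB0 i
  refine (JetSpace.norm_le_iff (by positivity) _).2 fun i ξ => ?_
  rw [JetSpace.ofTest_apply]
  refine (hB i x ξ).trans ?_
  gcongr
  · exact Finset.single_le_sum (f := B) (fun i _ => hB0 i) i.2
  · linarith [norm_nonneg x]
  · exact Finset.le_sup (f := id) i.2

theorem DistributionOn.integrable_locFn_mul (T : DistributionOn Ω) (χ : 𝓓(Ω, ℂ))
    (u : 𝓢(Eucl d, ℂ)) : Integrable (fun x => T.locFn χ x * u x) := by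
  obtain ⟨C, m, -, hC⟩ := T.exists_norm_locFn_le χ
  refine ((u.integrable_one_add_norm_pow_mul m).const_mul C).mono'
    ((T.continuous_locFn χ).mul u.continuous).aestronglyMeasurable (.of_forall fun x => ?_)
  rw [norm_mul, ← mul_assoc]
  gcongr
  exact hC x

/-- A distribution with compact support can be interchanged with the inverse Fourier integral. -/
theorem DistributionOn.integral_locFn_mul (T : DistributionOn Ω) (χ : 𝓓(Ω, ℂ))
    (u : 𝓢(Eucl d, ℂ)) :
    ∫ x, T.locFn χ x * u x =
      T (χ.mulSmooth (𝓕⁻ (u : Eucl d → ℂ)) (contDiff_fourierInv_schwartz u)) := by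
  obtain ⟨s, L, hL⟩ := T.exists_dominated χ
  choose B hB0 hB using χ.exists_norm_iteratedFDeriv_mulSupp_planeWave_le
  let tw : Eucl d → 𝓓_{χ.suppCompacts}(Eucl d, ℂ) := fun x =>
    χ.mulSupp (planeWave x) (contDiff_planeWave x)
  -- The integrand u(x) χ e_x is treated as a jet-valued Bochner integrand. The Schwartz decay of u
  -- beats the polynomial growth of the jets.
  let g : Eucl d → JetSpace d s := fun x => u x • JetSpace.ofTest s _ (tw x)
  have hgc : Continuous g :=
    u.continuous.smul ((JetSpace.continuous_ofTest _).comp χ.continuous_mulSupp_planeWave)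
  have hgi : Integrable g := by
    have hdom : Integrable (fun x => ∑ i ∈ s, B i * ((1 + ‖x‖) ^ i * ‖u x‖)) :=
      integrable_finsetSum _ fun i _ => (u.integrable_one_add_norm_pow_mul i).const_mul (B i)
    refine hdom.mono' hgc.aestronglyMeasurable (.of_forall fun x => ?_)
    have h0 : ∀ i ∈ s, 0 ≤ B i * ((1 + ‖x‖) ^ i * ‖u x‖) := fun i _ =>
      mul_nonneg (hB0 i) (by positivity)
    refine (JetSpace.norm_le_iff (Finset.sum_nonneg h0) _).2 fun i ξ => ?_
    refine le_trans ?_ (Finset.single_le_sum h0 i.2)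
    change ‖u x • (JetSpace.ofTest s _ (tw x) i ξ)‖ ≤ _
    rw [norm_smul, JetSpace.ofTest_apply]
    calc _ ≤ ‖u x‖ * (B i * (1 + ‖x‖) ^ (i : ℕ)) := by gcongr; exact hB i x ξ
      _ = _ := by ring
  have hsm : ∀ (k : ℕ) (x ξ : Eucl d), iteratedFDeriv ℝ k (u x • (tw x : Eucl d → ℂ)) ξ =
      u x • iteratedFDeriv ℝ k (tw x) ξ := fun k x ξ =>
    iteratedFDeriv_const_smul_apply ((tw x).contDiff.contDiffAt.of_le (mod_cast le_top))
  have hcont : ∀ (k : ℕ) (ξ : Eucl d), Continuous fun x => u x • iteratedFDeriv ℝ k (tw x) ξ := by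
    intro k ξ
    refine u.continuous.smul ?_
    have h3 : Continuous fun x => (ContDiffMapSupportedIn.structureMapCLM ℂ ⊤ k (tw x)) ξ :=
      (BoundedContinuousFunction.evalCLM ℂ ξ).continuous.comp
        ((ContDiffMapSupportedIn.structureMapCLM ℂ ⊤ k).continuous.comp
          χ.continuous_mulSupp_planeWave)
    simpa only [ContDiffMapSupportedIn.structureMapCLM_top_apply] using h3
  have hbd : ∀ (k : ℕ) (x ξ : Eucl d), ‖u x • iteratedFDeriv ℝ k (tw x) ξ‖ ≤
      B k * ((1 + ‖x‖) ^ k * ‖u x‖) := by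
    intro k x ξ
    rw [norm_smul]
    calc _ ≤ ‖u x‖ * (B k * (1 + ‖x‖) ^ k) := by gcongr; exact hB k x ξ
      _ = _ := by ring
  have hbi : ∀ k : ℕ, Integrable (fun x => B k * ((1 + ‖x‖) ^ k * ‖u x‖)) := fun k =>
    (u.integrable_one_add_norm_pow_mul k).const_mul (B k)
  -- The integral is identified coordinatewise: evaluating the derivative of order i at ξ on v
  -- commutes with the integral, and differentiation under the integral sign recognizes the jet of χ
  -- 𝓕⁻u.
  have hint : ∫ x, g x = JetSpace.ofTest s _
      (χ.mulSupp (𝓕⁻ (u : Eucl d → ℂ)) (contDiff_fourierInv_schwartz u)) := by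
    funext i
    ext ξ v
    rw [← JetSpace.eval_apply, ← (JetSpace.eval i ξ v).integral_comp_comm hgi, JetSpace.ofTest_apply]
    have h2 : (χ.mulSupp (𝓕⁻ (u : Eucl d → ℂ)) (contDiff_fourierInv_schwartz u) : Eucl d → ℂ) =
        fun ξ => ∫ x, (u x • (tw x : Eucl d → ℂ)) ξ := by
      funext ξ
      change χ ξ * 𝓕⁻ (u : Eucl d → ℂ) ξ = _
      rw [fourierInv_eq_integral_planeWave, ← integral_const_mul]
      refine integral_congr_ae (.of_forall fun x => ?_)
      simp only [tw, TestFunction.coe_mulSupp, Pi.smul_apply, smul_eq_mul, planeWave_comm ξ x]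
      ring
    have h3 := iteratedFDeriv_integral (μ := volume) (F := fun x => u x • (tw x : Eucl d → ℂ))
      (fun x => (tw x).contDiff.const_smul (u x))
      (fun k ξ => by simpa only [hsm] using (hcont k ξ).aestronglyMeasurable) hbi
      (fun k x ξ => (hsm k x ξ).symm ▸ hbd k x ξ) (i : ℕ)
    rw [h2, h3]
    simp only [hsm]
    rw [ContinuousMultilinearMap.integral_apply ((hbi i).mono' (hcont i ξ).aestronglyMeasurable
      (.of_forall fun x => hbd i x ξ))]
    refine integral_congr_ae (.of_forall fun x => ?_)
    change u x • (JetSpace.ofTest s _ (tw x) i ξ v) = _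
    rw [JetSpace.ofTest_apply]
    rfl
  rw [← hL, ← hint, ← L.integral_comp_comm hgi]
  refine integral_congr_ae (.of_forall fun x => ?_)
  simp only [g, map_smul, tw, hL, smul_eq_mul, DistributionOn.locFn]
  ring

end

noncomputable section

variable {d : ℕ} {Ω : Opens (Eucl d)} {I J : Type*}

/-! ### Convergence of series of distributions -/

theorem hasSum_weakDual_iff {V ι : Type*} [AddCommGroup V] [Module ℂ V] [TopologicalSpace V]
    {T : ι → WeakDual ℂ V} {L : WeakDual ℂ V} :
    HasSum T L ↔ ∀ v, HasSum (fun n => T n v) (L v) := by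
  unfold HasSum
  rw [tendsto_iff_forall_eval_tendsto_topDualPairing]
  refine forall_congr' fun v => ?_
  have : ∀ s : Finset ι, (∑ n ∈ s, T n) v = ∑ n ∈ s, T n v := fun s => by
    classical
    induction s using Finset.induction_on with
    | empty => rfl
    | insert a s ha ih => rw [Finset.sum_insert ha, Finset.sum_insert ha, ← ih]; rfl
  simp only [← this]
  rfl

/-- The test function as a Schwartz function, after Fourier transformation. -/
theorem fourier_testToSchwartz_apply (ψ : 𝓓(Ω, ℂ)) (x : Eucl d) :
    (𝓕 (testToSchwartz Ω ψ)) x = 𝓕 (ψ : Eucl d → ℂ) x := by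
  rw [SchwartzMap.fourier_coe]
  rfl

/-- The norm of `𝓕 ψ` in `L^1 ∩ L^∞`. -/
def fourierNorm (ψ : 𝓓(Ω, ℂ)) : ℝ≥0∞ :=
  eLpNorm (𝓕 (ψ : Eucl d → ℂ)) 1 volume + eLpNorm (𝓕 (ψ : Eucl d → ℂ)) ⊤ volume

/-- The Fourier transform maps C_c^∞ continuously into the Schwartz space, which embeds continuously
into L^1 and L^∞. The continuous real-valued version is used to prove continuity of limit
functionals. -/
theorem exists_continuous_fourierNorm (Ω : Opens (Eucl d)) :
    ∃ r : 𝓓(Ω, ℂ) → ℝ, Continuous r ∧ r 0 = 0 ∧ (∀ ψ, 0 ≤ r ψ) ∧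
      ∀ ψ, fourierNorm ψ = ENNReal.ofReal (r ψ) := by
  let A : 𝓓(Ω, ℂ) → 𝓢(Eucl d, ℂ) := fun ψ => 𝓕 (testToSchwartz Ω ψ)
  have hA : Continuous A := (FourierTransform.fourierCLM ℂ 𝓢(Eucl d, ℂ)).continuous.comp
    (continuous_testToSchwartz Ω)
  have hA0 : A 0 = 0 := by
    simp only [A, map_zero]
    exact (FourierTransform.fourierCLM ℂ 𝓢(Eucl d, ℂ)).map_zero
  refine ⟨fun ψ => ‖(A ψ).toLp 1‖ + ‖(A ψ).toLp ⊤‖, ?_, ?_, fun ψ => by positivity, fun ψ => ?_⟩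
  · exact (((SchwartzMap.toLpCLM ℝ ℂ 1 volume).continuous.comp hA).norm).add
      (((SchwartzMap.toLpCLM ℝ ℂ ⊤ volume).continuous.comp hA).norm)
  · have h1 : (0 : 𝓢(Eucl d, ℂ)).toLp 1 = 0 := (SchwartzMap.toLpCLM ℝ ℂ 1 volume).map_zero
    have h2 : (0 : 𝓢(Eucl d, ℂ)).toLp ⊤ = 0 := (SchwartzMap.toLpCLM ℝ ℂ ⊤ volume).map_zero
    simp [hA0, h1, h2]
  · have hcoe : (A ψ : Eucl d → ℂ) = 𝓕 (ψ : Eucl d → ℂ) :=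
      funext fun x => fourier_testToSchwartz_apply ψ x
    rw [ENNReal.ofReal_add (norm_nonneg _) (norm_nonneg _), SchwartzMap.norm_toLp,
      SchwartzMap.norm_toLp, ENNReal.ofReal_toReal ((A ψ).eLpNorm_lt_top 1 volume).ne,
      ENNReal.ofReal_toReal ((A ψ).eLpNorm_lt_top ⊤ volume).ne, hcoe, fourierNorm]

theorem fourierNorm_lt_top (ψ : 𝓓(Ω, ℂ)) : fourierNorm ψ < ⊤ := by
  obtain ⟨r, -, -, -, hr⟩ := exists_continuous_fourierNorm Ω
  rw [hr]
  exact ENNReal.ofReal_lt_top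

/-- A series of distributions that is absolutely convergent, locally dominated by the
`L^1 ∩ L^∞`-norm on the Fourier side, converges unconditionally. -/
theorem exists_hasSum_distribution {ι : Type*} {T : ι → DistributionOn Ω}
    (h : ∀ K : Set (Eucl d), IsCompact K → K ⊆ Ω → ∃ C : ℝ≥0∞, C < ⊤ ∧
      ∀ ψ : 𝓓(Ω, ℂ), tsupport ψ ⊆ K → ∑' n, ‖T n ψ‖ₑ ≤ C * fourierNorm ψ) :
    ∃ L, HasSum T L := by
  have hs : ∀ ψ : 𝓓(Ω, ℂ), Summable (fun n => ‖T n ψ‖) := by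
    intro ψ
    obtain ⟨C, hC, hψ⟩ := h (tsupport ψ) ψ.hasCompactSupport ψ.tsupport_subset
    exact tsum_enorm_ne_top_iff_summable_norm.1
      ((hψ ψ subset_rfl).trans_lt (ENNReal.mul_lt_top hC (fourierNorm_lt_top ψ))).ne
  obtain ⟨r, hrc, hr0, hrn, hr⟩ := exists_continuous_fourierNorm Ω
  let L : 𝓓(Ω, ℂ) →ₗ[ℂ] ℂ :=
    { toFun := fun ψ => ∑' n, T n ψ
      map_add' := fun ψ χ => by
        simp only [map_add]
        exact (hs ψ).of_norm.tsum_add (hs χ).of_norm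
      map_smul' := fun c ψ => by
        simp only [map_smul, smul_eq_mul, RingHom.id_apply]
        exact tsum_mul_left }
  -- By the inductive limit topology it suffices to look at functions supported in a fixed K, and by
  -- linearity at the origin, where the hypothesis squeezes L between 0 and a multiple of the
  -- continuous norm.
  have hL : Continuous L := by
    rw [TestFunction.continuous_iff_continuous_comp]
    intro K hK
    obtain ⟨C, hC, hψ⟩ := h K K.isCompact hK
    let LK : 𝓓_{K}(Eucl d, ℂ) →ₗ[ℂ] ℂ :=
      L ∘ₗ (TestFunction.ofSupportedInCLM ℂ hK).toLinearMap
    change Continuous LK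
    refine continuous_of_continuousAt_zero LK ?_
    rw [ContinuousAt, map_zero]
    have hlim : Filter.Tendsto (fun ψ : 𝓓_{K}(Eucl d, ℂ) =>
        C.toReal * r (TestFunction.ofSupportedIn hK ψ)) (nhds 0) (nhds 0) := by
      have hc : Continuous (fun ψ : 𝓓_{K}(Eucl d, ℂ) =>
          C.toReal * r (TestFunction.ofSupportedIn hK ψ)) :=
        continuous_const.mul (hrc.comp (TestFunction.continuous_ofSupportedIn hK))
      have h0 : TestFunction.ofSupportedIn hK (0 : 𝓓_{K}(Eucl d, ℂ)) = 0 := rfl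
      have := hc.tendsto 0
      rwa [h0, hr0, mul_zero] at this
    refine squeeze_zero_norm (fun ψ => ?_) hlim
    have h1 : ‖∑' n, T n (TestFunction.ofSupportedIn hK ψ)‖ₑ ≤
        C * fourierNorm (TestFunction.ofSupportedIn hK ψ) :=
      enorm_tsum_le_tsum_enorm.trans (hψ _ ψ.tsupport_subset)
    rw [hr, ← ENNReal.ofReal_toReal hC.ne, ← ENNReal.ofReal_mul ENNReal.toReal_nonneg,
      ← ofReal_norm] at h1
    exact (ENNReal.ofReal_le_ofReal_iff (mul_nonneg ENNReal.toReal_nonneg (hrn _))).1 h1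
  refine ⟨StrongDual.toWeakDual ⟨L, hL⟩, hasSum_weakDual_iff.2 fun ψ => ?_⟩
  exact (hs ψ).of_norm.hasSum

theorem FourierDistribution.fourier_apply (f : FourierDistribution Ω) (ψ : 𝓓(Ω, ℂ)) :
    f.fourier ψ = f (fourierTestCLE Ω ψ) := rfl

theorem FourierDistribution.fourier_fourierInv (T : DistributionOn Ω) :
    T.fourierInv.fourier = T := by
  refine DFunLike.ext _ _ fun ψ => ?_
  change T ((fourierTestCLE Ω).symm (fourierTestCLE Ω ψ)) = T ψ
  rw [ContinuousLinearEquiv.symm_apply_apply]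

theorem FourierDistribution.fourier_injective :
    Function.Injective (FourierDistribution.fourier (Ω := Ω)) := by
  intro f g h
  refine DFunLike.ext _ _ fun z => ?_
  obtain ⟨ψ, rfl⟩ := (fourierTestCLE Ω).surjective z
  exact DFunLike.congr_fun h ψ

theorem FourierDistribution.hasSum_iff {ι : Type*} {f : ι → FourierDistribution Ω}
    {g : FourierDistribution Ω} :
    HasSum f g ↔ ∀ ψ : 𝓓(Ω, ℂ), HasSum (fun n => (f n).fourier ψ) (g.fourier ψ) := by
  rw [hasSum_weakDual_iff]
  refine ⟨fun h ψ => h _, fun h z => ?_⟩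
  obtain ⟨ψ, rfl⟩ := (fourierTestCLE Ω).surjective z
  exact h ψ

theorem FourierDistribution.exists_hasSum {ι : Type*} {f : ι → FourierDistribution Ω}
    (h : ∀ K : Set (Eucl d), IsCompact K → K ⊆ Ω → ∃ C : ℝ≥0∞, C < ⊤ ∧
      ∀ ψ : 𝓓(Ω, ℂ), tsupport ψ ⊆ K → ∑' n, ‖(f n).fourier ψ‖ₑ ≤ C * fourierNorm ψ) :
    ∃ g, HasSum f g := by
  obtain ⟨L, hL⟩ := exists_hasSum_distribution h
  refine ⟨L.fourierInv, FourierDistribution.hasSum_iff.2 fun ψ => ?_⟩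
  rw [FourierDistribution.fourier_fourierInv]
  exact hasSum_weakDual_iff.1 hL ψ

/-! ### Fourier transforms of integrable functions -/

theorem integral_fourier_mul_eq_flip {a b : Eucl d → ℂ} (ha : Integrable a) (hb : Integrable b) :
    ∫ ξ, 𝓕 a ξ * b ξ = ∫ x, a x * 𝓕 b x := by
  have := VectorFourier.integral_fourierIntegral_smul_eq_flip (e := Real.fourierChar)
    (L := innerₗ (Eucl d)) (μ := volume) (ν := volume) Real.continuous_fourierChar
    continuous_inner ha hb
  simp only [flip_innerₗ, smul_eq_mul] at this
  exact this

theorem integral_fourierInv_mul_eq_flip {a b : Eucl d → ℂ} (ha : Integrable a)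
    (hb : Integrable b) : ∫ ξ, 𝓕⁻ a ξ * b ξ = ∫ x, a x * 𝓕⁻ b x := by
  have h := integral_fourier_mul_eq_flip ha hb.comp_neg
  have hb' : 𝓕 (fun x => b (-x)) = 𝓕⁻ b := (Real.fourierInv_eq_fourier_comp_neg b).symm
  rw [hb'] at h
  rw [← h, ← integral_neg_eq_self]
  simp only [Real.fourierInv_eq_fourier_neg, neg_neg]

theorem norm_fourierInv_le_lintegral (a : Eucl d → ℂ) (x : Eucl d) :
    ‖𝓕⁻ a x‖ₑ ≤ eLpNorm a 1 volume := by
  rw [fourierInv_eq_integral_planeWave, eLpNorm_one_eq_lintegral_enorm]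
  refine (enorm_integral_le_lintegral_enorm _).trans (lintegral_mono fun ξ => ?_)
  rw [enorm_mul, enorm_planeWave, one_mul]

theorem norm_fourier_le_lintegral (a : Eucl d → ℂ) (x : Eucl d) :
    ‖𝓕 a x‖ₑ ≤ eLpNorm a 1 volume := by
  rw [fourier_eq_integral_planeWave, eLpNorm_one_eq_lintegral_enorm]
  refine (enorm_integral_le_lintegral_enorm _).trans (lintegral_mono fun ξ => ?_)
  rw [enorm_mul, enorm_planeWave, one_mul]

theorem TestFunction.sum_apply {ι : Type*} (F : Finset ι) (g : ι → 𝓓(Ω, ℂ)) (ξ : Eucl d) :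
    (∑ i ∈ F, g i) ξ = ∑ i ∈ F, g i ξ := by
  classical
  induction F using Finset.induction_on with
  | empty => rfl
  | insert a s ha ih => rw [Finset.sum_insert ha, Finset.sum_insert ha, ← ih]; rfl

theorem TestFunction.integrable' (χ : 𝓓(Ω, ℂ)) : Integrable χ :=
  χ.continuous.integrable_of_hasCompactSupport χ.hasCompactSupport

theorem fourierInv_fourier_test (χ : 𝓓(Ω, ℂ)) : 𝓕⁻ (𝓕 (χ : Eucl d → ℂ)) = χ := by
  have h : 𝓕⁻ (𝓕 (testToSchwartz Ω χ) : 𝓢(Eucl d, ℂ)) = testToSchwartz Ω χ :=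
    FourierTransform.fourierInv_fourier_eq _
  have h2 := congrArg (fun f : 𝓢(Eucl d, ℂ) => (f : Eucl d → ℂ)) h
  simp only [SchwartzMap.fourierInv_coe, SchwartzMap.fourier_coe] at h2
  exact h2

/-- The inverse Fourier transform of a test function as a Schwartz function. -/
theorem fourierInv_testToSchwartz_apply (ψ : 𝓓(Ω, ℂ)) (x : Eucl d) :
    (𝓕⁻ (testToSchwartz Ω ψ)) x = 𝓕⁻ (ψ : Eucl d → ℂ) x := by
  rw [SchwartzMap.fourierInv_coe]
  rfl

/-- Modulation becomes translation. This identity turns the pairing of a distribution with χ e_x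
into a convolution with 𝓕⁻χ. -/
theorem fourier_mulSmooth_planeWave (χ : 𝓓(Ω, ℂ)) (x y : Eucl d) :
    𝓕 (χ.mulSmooth (planeWave x) (contDiff_planeWave x) : Eucl d → ℂ) y =
      𝓕⁻ (χ : Eucl d → ℂ) (x - y) := by
  rw [fourier_eq_integral_planeWave, fourierInv_eq_integral_planeWave]
  refine integral_congr_ae (.of_forall fun ξ => ?_)
  simp only [TestFunction.mulSmooth_apply]
  rw [sub_eq_add_neg, planeWave_add_left, planeWave_comm (-ξ), planeWave_neg_right]
  ring

/-! ### Pairings of localized distributions -/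

/-- The interchange formula applied to u = 𝓕ψ, whose inverse transform is ψ again. It replaces
distributional pairings by absolutely convergent integrals of pieces. -/
theorem DistributionOn.apply_mulSmooth (T : DistributionOn Ω) (χ ψ : 𝓓(Ω, ℂ)) :
    T (χ.mulSmooth ψ ψ.contDiff) = ∫ x, T.locFn χ x * 𝓕 (ψ : Eucl d → ℂ) x := by
  have h := T.integral_locFn_mul χ (𝓕 (testToSchwartz Ω ψ))
  simp only [fourier_testToSchwartz_apply] at h
  rw [h]
  congr 1
  ext ξ
  simp only [TestFunction.mulSmooth_apply]
  have h2 : ((𝓕 (testToSchwartz Ω ψ) : 𝓢(Eucl d, ℂ)) : Eucl d → ℂ) = 𝓕 (ψ : Eucl d → ℂ) :=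
    funext (fourier_testToSchwartz_apply ψ)
  rw [h2, fourierInv_fourier_test]

theorem DistributionOn.integrable_locFn_mul_fourier (T : DistributionOn Ω) (χ ψ : 𝓓(Ω, ℂ)) :
    Integrable (fun x => T.locFn χ x * 𝓕 (ψ : Eucl d → ℂ) x) := by
  have h := T.integrable_locFn_mul χ (𝓕 (testToSchwartz Ω ψ))
  simpa only [fourier_testToSchwartz_apply] using h

/-- Take ψ e_x in place of ψ in the preceding formula: a second localization in frequency is a
convolution in space. -/
theorem DistributionOn.locFn_mulSmooth (T : DistributionOn Ω) (χ ψ : 𝓓(Ω, ℂ)) (x : Eucl d) :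
    T.locFn (χ.mulSmooth ψ ψ.contDiff) x = ∫ y, T.locFn χ y * 𝓕⁻ (ψ : Eucl d → ℂ) (x - y) := by
  have h := T.apply_mulSmooth χ (ψ.mulSmooth (planeWave x) (contDiff_planeWave x))
  simp only [fourier_mulSmooth_planeWave] at h
  rw [← h, DistributionOn.locFn]
  congr 1
  ext ξ
  simp only [TestFunction.mulSmooth_apply, mul_assoc]

variable {Q : AdmissibleCover Ω I}

theorem BAPU.piece_eq_locFn (Φ : BAPU Q) (f : FourierDistribution Ω) (i : I) :
    Φ.piece f i = f.fourier.locFn (Φ.fn i) := rfl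

/-- Reconstruction of a distribution from its pieces. -/
theorem BAPU.fourier_apply_eq_sum (Φ : BAPU Q) (f : FourierDistribution Ω) {ψ : 𝓓(Ω, ℂ)}
    {F : Finset I} (hF : ∀ i ∉ F, Disjoint (Q.carrier i) (tsupport ψ)) :
    f.fourier ψ = ∑ i ∈ F, ∫ x, Φ.piece f i x * 𝓕 (ψ : Eucl d → ℂ) x := by
  have h : ψ = ∑ i ∈ F, (Φ.fn i).mulSmooth ψ ψ.contDiff := by
    ext ξ
    simp only [TestFunction.sum_apply, TestFunction.mulSmooth_apply]
    rw [← Finset.sum_mul]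
    by_cases hξ : ξ ∈ tsupport ψ
    · rw [Φ.sum_eq_one ψ.tsupport_subset hF hξ, one_mul]
    · rw [image_eq_zero_of_notMem_tsupport hξ, mul_zero]
  nth_rewrite 1 [h]
  rw [map_sum]
  exact Finset.sum_congr rfl fun i _ => DistributionOn.apply_mulSmooth _ _ _

/-! ### Functions as distributions -/

theorem FourierDistribution.fourier_ofFun_apply {u : Eucl d → ℂ} {p : ℝ≥0∞} (hp : 1 ≤ p)
    (hu : MemLp u p volume) (ψ : 𝓓(Ω, ℂ)) :
    (FourierDistribution.ofFun Ω u).fourier ψ = ∫ x, u x * 𝓕 (ψ : Eucl d → ℂ) x := by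
  rw [FourierDistribution.fourier_apply, FourierDistribution.ofFun_apply hp hu]
  simp only [FourierTestSpace.toSchwartz_fourier]

theorem FourierDistribution.locFn_ofFun {u : Eucl d → ℂ} {p : ℝ≥0∞} (hp : 1 ≤ p)
    (hu : MemLp u p volume) (χ : 𝓓(Ω, ℂ)) (x : Eucl d) :
    (FourierDistribution.ofFun Ω u).fourier.locFn χ x =
      ∫ y, u y * 𝓕⁻ (χ : Eucl d → ℂ) (x - y) := by
  rw [DistributionOn.locFn, FourierDistribution.fourier_ofFun_apply hp hu]
  simp only [fourier_mulSmooth_planeWave]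

theorem regularDistribution_apply {u : Eucl d → ℂ} (hu : LocallyIntegrableOn u Ω)
    (ψ : 𝓓(Ω, ℂ)) : regularDistribution Ω u ψ = ∫ ξ, ψ ξ * u ξ :=
  TestFunction.integralAgainstBilinCLM_eq_integral hu

theorem FourierDistribution.fourier_ofFun_fourierInv_test (φ ψ : 𝓓(Ω, ℂ)) :
    (FourierDistribution.ofFun Ω (𝓕⁻ (testToSchwartz Ω φ) : 𝓢(Eucl d, ℂ))).fourier ψ =
      ∫ ξ, φ ξ * ψ ξ := by
  rw [FourierDistribution.fourier_ofFun_apply le_rfl ((𝓕⁻ (testToSchwartz Ω φ)).memLp 1)]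
  simp only [fourierInv_testToSchwartz_apply]
  have h : Integrable (𝓕 (ψ : Eucl d → ℂ)) := by
    have := (𝓕 (testToSchwartz Ω ψ)).integrable (μ := volume)
    exact this.congr (.of_forall (fourier_testToSchwartz_apply ψ))
  rw [integral_fourierInv_mul_eq_flip φ.integrable' h, fourierInv_fourier_test]

end

noncomputable section

variable {d : ℕ} {Ω : Opens (Eucl d)} {I J : Type*}

/-! ### Products and convolutions -/

theorem continuous_fourierInv {a : Eucl d → ℂ} (ha : Integrable a) : Continuous (𝓕⁻ a) := by
  have : 𝓕⁻ a = fun x => 𝓕 a (-x) := funext fun x => Real.fourierInv_eq_fourier_neg a x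
  rw [this]
  exact (VectorFourier.fourierIntegral_continuous Real.continuous_fourierChar
    continuous_inner ha).comp continuous_neg

theorem continuous_fourier {a : Eucl d → ℂ} (ha : Integrable a) : Continuous (𝓕 a) :=
  VectorFourier.fourierIntegral_continuous Real.continuous_fourierChar continuous_inner ha

theorem integrable_fourier_test (χ : 𝓓(Ω, ℂ)) : Integrable (𝓕 (χ : Eucl d → ℂ)) := by
  have := (𝓕 (testToSchwartz Ω χ)).integrable (μ := volume)
  exact this.congr (.of_forall (fourier_testToSchwartz_apply χ))

theorem memLp_fourierInv_test (χ : 𝓓(Ω, ℂ)) (p : ℝ≥0∞) :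
    MemLp (𝓕⁻ (χ : Eucl d → ℂ)) p volume := by
  have h : ((𝓕⁻ (testToSchwartz Ω χ) : 𝓢(Eucl d, ℂ)) : Eucl d → ℂ) = 𝓕⁻ (χ : Eucl d → ℂ) :=
    funext (fourierInv_testToSchwartz_apply χ)
  rw [← h]
  exact (𝓕⁻ (testToSchwartz Ω χ)).memLp p

theorem continuous_fourierInv_test (χ : 𝓓(Ω, ℂ)) : Continuous (𝓕⁻ (χ : Eucl d → ℂ)) :=
  continuous_fourierInv χ.integrable'

theorem continuous_fourier_test (χ : 𝓓(Ω, ℂ)) : Continuous (𝓕 (χ : Eucl d → ℂ)) :=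
  continuous_fourier χ.integrable'

/-- The inverse Fourier transform of a product with a test function is a convolution. -/
theorem fourierInv_mul_test {a : Eucl d → ℂ} (ha : Integrable a) (b : 𝓓(Ω, ℂ)) (x : Eucl d) :
    𝓕⁻ (fun ξ => a ξ * b ξ) x = ∫ y, 𝓕⁻ a y * 𝓕⁻ (b : Eucl d → ℂ) (x - y) := by
  have h := integral_fourierInv_mul_eq_flip ha
    (integrable_fourier_test (b.mulSmooth (planeWave x) (contDiff_planeWave x)))
  simp only [fourierInv_fourier_test, fourier_mulSmooth_planeWave,
    TestFunction.mulSmooth_apply] at h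
  rw [h, fourierInv_eq_integral_planeWave]
  refine integral_congr_ae (.of_forall fun ξ => ?_)
  simp only [planeWave_comm x ξ]
  ring

theorem enorm_fourierInv_mul_test_le {a : Eucl d → ℂ} (ha : Integrable a) (b : 𝓓(Ω, ℂ))
    (x : Eucl d) : ‖𝓕⁻ (fun ξ => a ξ * b ξ) x‖ₑ ≤
      ∫⁻ y, ‖𝓕⁻ a (x - y)‖ₑ * ‖𝓕⁻ (b : Eucl d → ℂ) y‖ₑ := by
  rw [fourierInv_mul_test ha,
    ← lintegral_sub_left_eq_self (fun y => ‖𝓕⁻ a (x - y)‖ₑ * ‖𝓕⁻ (b : Eucl d → ℂ) y‖ₑ) x]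
  refine (enorm_integral_le_lintegral_enorm _).trans (lintegral_mono fun y => ?_)
  simp only [enorm_mul, sub_sub_cancel, le_refl]

/-- A continuous integrable function is bounded by the `L^1`-norm of its Fourier transform. -/
theorem enorm_le_eLpNorm_fourierInv {a : Eucl d → ℂ} (hc : Continuous a) (ha : Integrable a)
    (ξ : Eucl d) : ‖a ξ‖ₑ ≤ eLpNorm (𝓕⁻ a) 1 volume := by
  by_cases h : eLpNorm (𝓕⁻ a) 1 volume = ⊤
  · rw [h]
    exact le_top
  · have hi : Integrable (𝓕⁻ a) := memLp_one_iff_integrable.1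
      ⟨(continuous_fourierInv ha).aestronglyMeasurable, lt_top_iff_ne_top.2 h⟩
    have hi' : Integrable (𝓕 a) := by
      have := hi.comp_neg
      refine this.congr (.of_forall fun x => ?_)
      simp only [Real.fourierInv_eq_fourier_neg, neg_neg]
    rw [← congrFun (hc.fourier_fourierInv_eq ha hi') ξ]
    exact norm_fourier_le_lintegral _ _

theorem enorm_le_eLpNorm_fourier_test (ψ : 𝓓(Ω, ℂ)) (ξ : Eucl d) :
    ‖ψ ξ‖ₑ ≤ eLpNorm (𝓕 (ψ : Eucl d → ℂ)) 1 volume := by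
  rw [← fourierInv_fourier_test ψ]
  refine (norm_fourierInv_le_lintegral _ _).trans ?_
  rw [fourierInv_fourier_test]

/-! ### Pieces of Fourier test functions -/

variable {Q : AdmissibleCover Ω I}

/-- The pieces of the inverse Fourier transform of a test function. -/
theorem BAPU.piece_ofFun_fourierInv_test (Φ : BAPU Q) (φ : 𝓓(Ω, ℂ)) (i : I) (x : Eucl d) :
    Φ.piece (.ofFun Ω (𝓕⁻ (testToSchwartz Ω φ) : 𝓢(Eucl d, ℂ))) i x =
      𝓕⁻ ((Φ.fn i).mulSmooth φ φ.contDiff : Eucl d → ℂ) x := by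
  change (FourierDistribution.ofFun Ω _).fourier _ = _
  rw [FourierDistribution.fourier_ofFun_fourierInv_test, fourierInv_eq_integral_planeWave]
  refine integral_congr_ae (.of_forall fun ξ => ?_)
  simp only [TestFunction.mulSmooth_apply]
  ring

theorem BAPU.decompositionNorm_lt_top_of_finite (Φ : BAPU Q) {p q : ℝ≥0∞} (hq : 1 ≤ q)
    (w : I → ℝ) {f : FourierDistribution Ω} {F : Finset I}
    (h0 : ∀ i ∉ F, Φ.piece f i = 0) (hf : ∀ i ∈ F, eLpNorm (Φ.piece f i) p volume < ⊤) :
    Φ.decompositionNorm p q w f < ⊤ := by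
  unfold BAPU.decompositionNorm ellNorm
  have h0' : ∀ i ∉ F, eLpNorm (Φ.piece f i) p volume = 0 := fun i hi => by simp [h0 i hi]
  split_ifs with h
  · have : ⨆ i, ENNReal.ofReal (w i) * eLpNorm (Φ.piece f i) p volume ≤
        ∑ i ∈ F, ENNReal.ofReal (w i) * eLpNorm (Φ.piece f i) p volume := by
      refine iSup_le fun i => ?_
      by_cases hi : i ∈ F
      · exact Finset.single_le_sum
          (f := fun i => ENNReal.ofReal (w i) * eLpNorm (Φ.piece f i) p volume)
          (fun _ _ => zero_le) hi
      · simp [h0' i hi]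
    exact this.trans_lt (ENNReal.sum_lt_top.2 fun i hi =>
      ENNReal.mul_lt_top ENNReal.ofReal_lt_top (hf i hi))
  · have hq' : 0 < q.toReal := ENNReal.toReal_pos (zero_lt_one.trans_le hq).ne' h
    refine ENNReal.rpow_lt_top_of_nonneg (by positivity) ?_
    rw [tsum_eq_sum (s := F) fun i hi => by simp [h0' i hi, hq']]
    exact (ENNReal.sum_lt_top.2 fun i hi => ENNReal.rpow_lt_top_of_nonneg hq'.le
      (ENNReal.mul_lt_top ENNReal.ofReal_lt_top (hf i hi)).ne).ne

theorem BAPU.mulSmooth_eq_zero (Φ : BAPU Q) {φ : 𝓓(Ω, ℂ)} {i : I}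
    (hi : Disjoint (Q.carrier i) (tsupport φ)) : (Φ.fn i).mulSmooth φ φ.contDiff = 0 := by
  ext ξ
  simp only [TestFunction.mulSmooth_apply]
  by_cases hξ : ξ ∈ tsupport φ
  · rw [Φ.fn_eq_zero fun h => hi.le_bot ⟨h, hξ⟩, zero_mul]
    rfl
  · rw [image_eq_zero_of_notMem_tsupport hξ, mul_zero]
    rfl

/-- This gives S_O ⊂ D(Q, L^p, ℓ^q_w): a compact support meets finitely many Q_i, and each of the
finitely many pieces is a Schwartz function. -/
theorem BAPU.decompositionNorm_fourierInv_test_lt_top (Φ : BAPU Q) {p q : ℝ≥0∞} (hq : 1 ≤ q)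
    (w : I → ℝ) (φ : 𝓓(Ω, ℂ)) :
    Φ.decompositionNorm p q w (.ofFun Ω (𝓕⁻ (testToSchwartz Ω φ) : 𝓢(Eucl d, ℂ))) < ⊤ := by
  obtain ⟨F, hF⟩ := Φ.exists_finset_of_isCompact φ.hasCompactSupport φ.tsupport_subset
  have h := Φ.piece_ofFun_fourierInv_test φ
  refine Φ.decompositionNorm_lt_top_of_finite hq w (F := F) (fun i hi => ?_) fun i _ => ?_
  · ext x
    rw [h, Φ.mulSmooth_eq_zero (hF i hi), fourierInv_eq_integral_planeWave]
    change ∫ ξ, planeWave x ξ * (0 : ℂ) = 0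
    simp
  · rw [funext (h i)]
    exact (memLp_fourierInv_test _ p).2

/-! ### The functions `t_α` -/

namespace GSISystem

variable (G : GSISystem d J)

theorem absDet_pos (j : J) : 0 < G.absDet j :=
  abs_pos.2 ((Matrix.isUnit_iff_isUnit_det _).1 (G.C j).isUnit).ne_zero

theorem continuous_fourier (j : J) : Continuous (𝓕 (G.g j)) := (G.contDiff_fourier j).continuous

theorem zero_mem_dualLattice (j : J) : (0 : Eucl d) ∈ G.dualLattice j := by
  refine ⟨0, ?_⟩
  have : intVec (0 : Fin d → ℤ) = 0 := by ext; simp [intVec]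
  simp only [this, map_zero]

theorem neg_mem_dualLattice {j : J} {α : Eucl d} (h : α ∈ G.dualLattice j) :
    -α ∈ G.dualLattice j := by
  obtain ⟨k, rfl⟩ := h
  refine ⟨-k, ?_⟩
  have : intVec (-k) = -intVec k := by ext; simp [intVec]
  simp only [this, map_neg]

theorem countable_dualLattice (j : J) : (G.dualLattice j).Countable :=
  Set.countable_range _

theorem countable_frequencies [Countable J] : G.frequencies.Countable :=
  Set.countable_iUnion G.countable_dualLattice

/-- Interchange of the sums over frequencies and over generators. -/
theorem tsum_frequencies_comm (P : Eucl d → Prop) (X : J → Eucl d → ℝ≥0∞) :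
    ∑' α : {α : Eucl d // α ∈ G.frequencies ∧ P α}, ∑' j : {j : J // (α : Eucl d) ∈ G.dualLattice j},
      X j α = ∑' j, ∑' α : {α : Eucl d // α ∈ G.dualLattice j ∧ P α}, X j α := by
  rw [← ENNReal.tsum_sigma' (fun p : (j : J) × {α : Eucl d // α ∈ G.dualLattice j ∧ P α} =>
      X p.1 p.2),
    ← ENNReal.tsum_sigma' (fun p : (α : {α : Eucl d // α ∈ G.frequencies ∧ P α}) ×
      {j : J // (α : Eucl d) ∈ G.dualLattice j} => X p.2 p.1)]
  let e : ((α : {α : Eucl d // α ∈ G.frequencies ∧ P α}) ×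
      {j : J // (α : Eucl d) ∈ G.dualLattice j}) ≃
      ((j : J) × {α : Eucl d // α ∈ G.dualLattice j ∧ P α}) :=
    { toFun := fun p => ⟨p.2, ⟨p.1, p.2.2, p.1.2.2⟩⟩
      invFun := fun p => ⟨⟨p.2, Set.mem_iUnion.2 ⟨p.1, p.2.2.1⟩, p.2.2.2⟩, ⟨p.1, p.2.2.1⟩⟩
      left_inv := fun p => rfl
      right_inv := fun p => rfl }
  exact e.tsum_eq (fun p => X p.1 p.2)

/-- The sum of the absolute values of the terms defining `t_α`. -/
def tAbs (α ξ : Eucl d) : ℝ≥0∞ :=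
  ∑' j : {j : J // α ∈ G.dualLattice j},
    ENNReal.ofReal (G.absDet j)⁻¹ * (‖𝓕 (G.g j) ξ‖ₑ * ‖𝓕 (G.g j) (ξ + α)‖ₑ)

theorem enorm_t_term (j : J) (α ξ : Eucl d) :
    ‖((G.absDet j)⁻¹ : ℂ) * (conj (𝓕 (G.g j) ξ) * 𝓕 (G.g j) (ξ + α))‖ₑ =
      ENNReal.ofReal (G.absDet j)⁻¹ * (‖𝓕 (G.g j) ξ‖ₑ * ‖𝓕 (G.g j) (ξ + α)‖ₑ) := by
  rw [enorm_mul, enorm_mul, RCLike.enorm_conj, ← Complex.ofReal_inv, ← ofReal_norm,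
    Complex.norm_real, Real.norm_of_nonneg (inv_nonneg.2 (G.absDet_pos j).le)]

theorem enorm_t_le (α ξ : Eucl d) : ‖G.t α ξ‖ₑ ≤ G.tAbs α ξ := by
  refine enorm_tsum_le_tsum_enorm.trans (ENNReal.tsum_le_tsum fun j => ?_)
  rw [G.enorm_t_term]

theorem measurable_tAbs_term (j : J) (α : Eucl d) : Measurable fun ξ =>
    ENNReal.ofReal (G.absDet j)⁻¹ * (‖𝓕 (G.g j) ξ‖ₑ * ‖𝓕 (G.g j) (ξ + α)‖ₑ) := by
  have h1 := (G.continuous_fourier j).enorm.measurable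
  have h2 := ((G.continuous_fourier j).comp (continuous_add_const α)).enorm.measurable
  exact (h1.mul h2).const_mul _

theorem measurable_tAbs [Countable J] (α : Eucl d) : Measurable (G.tAbs α) :=
  Measurable.tsum fun j => G.measurable_tAbs_term j α

/-- From 2ab ≤ a² + b² and the upper bound B, used at ξ and at ξ + α; translates of null sets are
null. The bound is uniform in α, though the exceptional set may depend on α. -/
theorem exists_tAbs_le : ∃ B : ℝ≥0, ∀ α, ∀ᵐ ξ, G.tAbs α ξ ≤ B := by
  obtain ⟨A, B, -, -, hAB⟩ := G.exists_bounds
  refine ⟨B.toNNReal, fun α => ?_⟩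
  have h2 := (measurePreserving_add_right (volume : Measure (Eucl d)) α).quasiMeasurePreserving.ae
    hAB
  have hsq : ∀ (j : J) (ξ : Eucl d), ENNReal.ofReal (|(G.C j).val.det|⁻¹ * ‖𝓕 (G.g j) ξ‖ ^ 2) =
      ENNReal.ofReal (G.absDet j)⁻¹ * ‖𝓕 (G.g j) ξ‖ₑ ^ 2 := fun j ξ => by
    change ENNReal.ofReal ((G.absDet j)⁻¹ * _) = _
    rw [ENNReal.ofReal_mul (inv_nonneg.2 (G.absDet_pos j).le), ENNReal.ofReal_pow (norm_nonneg _),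
      ofReal_norm]
  simp only [hsq] at hAB h2
  filter_upwards [hAB, h2] with ξ h1 h2
  have key : 2 * G.tAbs α ξ ≤ 2 * ENNReal.ofReal B := by
    calc 2 * G.tAbs α ξ ≤ ∑' j : {j : J // α ∈ G.dualLattice j},
          (ENNReal.ofReal (G.absDet j)⁻¹ * ‖𝓕 (G.g j) ξ‖ₑ ^ 2 +
            ENNReal.ofReal (G.absDet j)⁻¹ * ‖𝓕 (G.g j) (ξ + α)‖ₑ ^ 2) := by
          rw [tAbs, ← ENNReal.tsum_mul_left]
          refine ENNReal.tsum_le_tsum fun j => ?_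
          rw [← mul_add, mul_left_comm, ← mul_assoc 2]
          gcongr
          have h := two_mul_le_add_sq ‖𝓕 (G.g j) ξ‖₊ ‖𝓕 (G.g j) (ξ + α)‖₊
          simp only [enorm_eq_nnnorm]
          exact_mod_cast h
      _ ≤ ENNReal.ofReal B + ENNReal.ofReal B := by
          rw [ENNReal.tsum_add]
          refine add_le_add (le_trans ?_ h1.2) (le_trans ?_ h2.2)
          · exact ENNReal.tsum_comp_le_tsum_of_injective Subtype.val_injective
              (fun j => ENNReal.ofReal (G.absDet j)⁻¹ * ‖𝓕 (G.g j) ξ‖ₑ ^ 2)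
          · exact ENNReal.tsum_comp_le_tsum_of_injective Subtype.val_injective
              (fun j => ENNReal.ofReal (G.absDet j)⁻¹ * ‖𝓕 (G.g j) (ξ + α)‖ₑ ^ 2)
      _ = 2 * ENNReal.ofReal B := (two_mul _).symm
  exact (ENNReal.mul_le_mul_iff_right two_ne_zero ENNReal.ofNat_ne_top).1 key

theorem hasSum_t {α ξ : Eucl d} (h : G.tAbs α ξ < ⊤) :
    HasSum (fun j : {j : J // α ∈ G.dualLattice j} =>
      ((G.absDet j)⁻¹ : ℂ) * (conj (𝓕 (G.g j) ξ) * 𝓕 (G.g j) (ξ + α))) (G.t α ξ) := by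
  refine Summable.hasSum (Summable.of_norm (tsum_enorm_ne_top_iff_summable_norm.1 ?_))
  simp only [G.enorm_t_term]
  exact h.ne

/-- Almost everywhere the series converges absolutely, so t_α is the limit of its continuous partial
sums. The default value of `tsum` for divergent series matters only on a null set. -/
theorem aestronglyMeasurable_t [Countable J] (α : Eucl d) :
    AEStronglyMeasurable (G.t α) volume := by
  obtain ⟨B, hB⟩ := G.exists_tAbs_le
  refine aestronglyMeasurable_of_tendsto_ae Filter.atTop
    (f := fun (s : Finset {j : J // α ∈ G.dualLattice j}) ξ =>
      ∑ j ∈ s, ((G.absDet j)⁻¹ : ℂ) * (conj (𝓕 (G.g j) ξ) * 𝓕 (G.g j) (ξ + α)))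
    (fun s => ?_) ?_
  · refine Continuous.aestronglyMeasurable (continuous_finsetSum _ fun j _ => ?_)
    exact continuous_const.mul ((Complex.continuous_conj.comp (G.continuous_fourier j)).mul
      ((G.continuous_fourier j).comp (continuous_add_const α)))
  · filter_upwards [hB α] with ξ hξ
    exact G.hasSum_t (hξ.trans_lt ENNReal.coe_lt_top)

theorem exists_enorm_t_le : ∃ B : ℝ≥0, ∀ α, ∀ᵐ ξ, ‖G.t α ξ‖ₑ ≤ B := by
  obtain ⟨B, hB⟩ := G.exists_tAbs_le
  exact ⟨B, fun α => (hB α).mono fun ξ h => (G.enorm_t_le α ξ).trans h⟩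

theorem integrable_t_mul [Countable J] (α : Eucl d) {u : Eucl d → ℂ} (hu : Integrable u) :
    Integrable (fun ξ => G.t α ξ * u ξ) := by
  obtain ⟨B, hB⟩ := G.exists_enorm_t_le
  refine hu.bdd_mul (c := B) (G.aestronglyMeasurable_t α) ?_
  filter_upwards [hB α] with ξ hξ
  rwa [← ofReal_norm, ENNReal.ofReal_le_iff_le_toReal ENNReal.coe_ne_top] at hξ

/-- The consequence of the local integrability condition for the indicator of a compact set. -/
theorem AlphaLIC.tsum_lintegral_lt_top {G : GSISystem d J} (h : G.AlphaLIC Ω)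
    {K : Set (Eucl d)} (hK : IsCompact K) (hKΩ : K ⊆ Ω) :
    ∑' j, ENNReal.ofReal (G.absDet j)⁻¹ * ∑' α : G.dualLattice j,
      ∫⁻ ξ : Eucl d, K.indicator 1 ξ * K.indicator 1 (ξ + α) *
        (‖𝓕 (G.g j) ξ‖ₑ * ‖𝓕 (G.g j) (ξ + α)‖ₑ) < ⊤ := by
  -- The condition is tested on the function in L^2 whose Fourier transform is the indicator
  -- function of K.
  let u : LTwo d := indicatorConstLp 2 hK.measurableSet hK.measure_lt_top.ne (1 : ℂ)
  have hu : u =ᵐ[volume] K.indicator fun _ => 1 := indicatorConstLp_coeFn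
  have hf : 𝓕 (𝓕⁻ u) = u := FourierTransform.fourier_fourierInv_eq u
  have := h (𝓕⁻ u) ⟨?_, K, hK, hKΩ, ?_⟩
  · rw [hf] at this
    convert this using 6 with j α
    have h2 := (measurePreserving_add_right (volume : Measure (Eucl d))
      (α : Eucl d)).quasiMeasurePreserving.ae hu
    refine lintegral_congr_ae ?_
    filter_upwards [hu, h2] with ξ h1 h2
    simp only [h1, h2, enorm_mul, mul_assoc]
    congr 1
    · by_cases hx : ξ ∈ K <;> simp [hx]
    · congr 1
      by_cases hx : ξ + α ∈ K <;> simp [hx]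
  · rw [hf]
    exact (memLp_indicator_const ⊤ hK.measurableSet (1 : ℂ) (.inr hK.measure_lt_top.ne)).ae_eq
      hu.symm
  · rw [hf]
    filter_upwards [hu] with ξ h1 hξ
    rw [h1, Set.indicator_of_notMem hξ]

theorem tsum_lintegral_tAbs_eq [Countable J] (P : Eucl d → Prop)
    {m : Eucl d → Eucl d → ℝ≥0∞} (hm : ∀ α, Measurable (m α)) :
    ∑' α : {α : Eucl d // α ∈ G.frequencies ∧ P α}, ∫⁻ ξ, m α ξ * G.tAbs α ξ =
      ∑' j, ENNReal.ofReal (G.absDet j)⁻¹ * ∑' α : {α : Eucl d // α ∈ G.dualLattice j ∧ P α},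
        ∫⁻ ξ, m α ξ * (‖𝓕 (G.g j) ξ‖ₑ * ‖𝓕 (G.g j) (ξ + α)‖ₑ) := by
  simp only [← ENNReal.tsum_mul_left]
  rw [← G.tsum_frequencies_comm P (fun j α => ENNReal.ofReal (G.absDet j)⁻¹ *
    ∫⁻ ξ, m α ξ * (‖𝓕 (G.g j) ξ‖ₑ * ‖𝓕 (G.g j) (ξ + α)‖ₑ))]
  refine tsum_congr fun α => ?_
  simp only [tAbs, ← ENNReal.tsum_mul_left]
  refine (lintegral_tsum fun j : {j : J // (α : Eucl d) ∈ G.dualLattice j} =>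
    ((hm α).mul (G.measurable_tAbs_term j α)).aemeasurable).trans ?_
  refine tsum_congr fun j => ?_
  rw [← lintegral_const_mul]
  · exact lintegral_congr fun ξ => mul_left_comm _ _ _
  · have h1 := (G.continuous_fourier j).enorm.measurable
    have h2 := ((G.continuous_fourier j).comp (continuous_add_const (α : Eucl d))).enorm.measurable
    exact (hm α).mul (h1.mul h2)

/-- The local integrability condition bounds the sum over all frequencies. -/
theorem AlphaLIC.tsum_lintegral_tAbs_lt_top [Countable J] {G : GSISystem d J} (h : G.AlphaLIC Ω)
    {K : Set (Eucl d)} (hK : IsCompact K) (hKΩ : K ⊆ Ω) :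
    ∑' α : {α : Eucl d // α ∈ G.frequencies ∧ α ≠ 0},
      ∫⁻ ξ, K.indicator 1 ξ * K.indicator 1 (ξ + α) * G.tAbs α ξ < ⊤ := by
  rw [G.tsum_lintegral_tAbs_eq (m := fun α ξ => K.indicator 1 ξ * K.indicator 1 (ξ + α))]
  · refine lt_of_le_of_lt (ENNReal.tsum_le_tsum fun j => ?_) (h.tsum_lintegral_lt_top hK hKΩ)
    gcongr
    exact ENNReal.tsum_comp_le_tsum_of_injective
      (f := fun α : {α : Eucl d // α ∈ G.dualLattice j ∧ α ≠ 0} =>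
        (⟨α, α.2.1⟩ : G.dualLattice j))
      (fun a b hab => Subtype.ext (congrArg (fun x : G.dualLattice j => (x : Eucl d)) hab))
      (fun α : G.dualLattice j => ∫⁻ ξ : Eucl d, K.indicator 1 ξ * K.indicator 1 (ξ + (α : Eucl d)) *
        (‖𝓕 (G.g j) ξ‖ₑ * ‖𝓕 (G.g j) (ξ + α)‖ₑ))
  · intro α
    have h1 : Measurable (K.indicator (1 : Eucl d → ℝ≥0∞)) :=
      measurable_one.indicator hK.measurableSet
    exact h1.mul (h1.comp (measurable_add_const α))

end GSISystem

end

noncomputable section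

variable {d : ℕ} {Ω : Opens (Eucl d)} {I J : Type*} {Q : AdmissibleCover Ω I}

/-! ### The remainder -/

theorem TestFunction.integrable_comp_add_mul (χ φ : 𝓓(Ω, ℂ)) (α : Eucl d) :
    Integrable (fun ξ => χ (ξ + α) * φ ξ) :=
  ((χ.continuous.comp (continuous_add_const α)).mul φ.continuous).integrable_of_hasCompactSupport
    φ.hasCompactSupport.mul_left

/-- The product `φ_i^* φ`. -/
def BAPU.starMul (Φ : BAPU Q) (φ : 𝓓(Ω, ℂ)) (i : I) : 𝓓(Ω, ℂ) :=
  ∑ l ∈ Q.neighbors i, (Φ.fn l).mulSmooth φ φ.contDiff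

theorem BAPU.starMul_apply (Φ : BAPU Q) (φ : 𝓓(Ω, ℂ)) (i : I) (ξ : Eucl d) :
    Φ.starMul φ i ξ = (∑ l ∈ Q.neighbors i, Φ.fn l ξ) * φ ξ := by
  simp only [BAPU.starMul, TestFunction.sum_apply, TestFunction.mulSmooth_apply, Finset.sum_mul]

/-- Since φ_i^* = 1 wherever φ_i ≠ 0, the factor can be inserted for free. It separates the kernel
φ_i(·+α) t_α φ_l from a second factor that still belongs to f. -/
theorem BAPU.fn_mul_starMul (Φ : BAPU Q) (φ : 𝓓(Ω, ℂ)) (i : I) (ξ : Eucl d) :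
    Φ.fn i ξ * Φ.starMul φ i ξ = Φ.fn i ξ * φ ξ := by
  rw [Φ.starMul_apply, ← Φ.sum_neighbors_mul_fn i ξ]
  simp only [← mul_assoc]
  congr 1
  rw [Φ.sum_neighbors_mul_fn i ξ, mul_comm, Φ.sum_neighbors_mul_fn i ξ]

/-- Here clustering enters: the inverse transform of φ_i^* f̂ is the sum of the pieces of f over
i^*, which is the source of the factor ‖Γ‖ in the remainder estimate. -/
theorem BAPU.fourierInv_starMul (Φ : BAPU Q) (φ : 𝓓(Ω, ℂ)) (i : I) (x : Eucl d) :
    𝓕⁻ (Φ.starMul φ i : Eucl d → ℂ) x = ∑ l ∈ Q.neighbors i,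
      Φ.piece (.ofFun Ω (𝓕⁻ (testToSchwartz Ω φ) : 𝓢(Eucl d, ℂ))) l x := by
  simp only [Φ.piece_ofFun_fourierInv_test, fourierInv_eq_integral_planeWave]
  rw [← integral_finsetSum]
  · refine integral_congr_ae (.of_forall fun ξ => ?_)
    simp only [BAPU.starMul, TestFunction.sum_apply, Finset.mul_sum]
  · intro l _
    have h := ((Φ.fn l).mulSmooth φ φ.contDiff).mulSmooth (planeWave x) (contDiff_planeWave x)
      |>.integrable'
    refine h.congr (.of_forall fun ξ => ?_)
    simp only [TestFunction.mulSmooth_apply]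
    ring

namespace GSISystem

variable (G : GSISystem d J)

theorem integrable_tildeEntry (Φ : BAPU Q) (i l : I) (j : J) (α : Eucl d) :
    Integrable (fun ξ => Φ.fn i (ξ - α) * conj (𝓕 (G.g j) ξ) * 𝓕 (G.g j) (ξ - α) * Φ.fn l ξ) := by
  refine Continuous.integrable_of_hasCompactSupport ?_ ?_
  · exact ((((Φ.fn i).continuous.comp (continuous_sub_right α)).mul
      (Complex.continuous_conj.comp (G.continuous_fourier j))).mul
      ((G.continuous_fourier j).comp (continuous_sub_right α))).mul (Φ.fn l).continuous
  · exact (Φ.fn l).hasCompactSupport.mul_left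

theorem continuous_tildeEntry (Φ : BAPU Q) (i l : I) (j : J) (α : Eucl d) :
    Continuous (fun ξ => Φ.fn i (ξ - α) * conj (𝓕 (G.g j) ξ) * 𝓕 (G.g j) (ξ - α) * Φ.fn l ξ) :=
  ((((Φ.fn i).continuous.comp (continuous_sub_right α)).mul
      (Complex.continuous_conj.comp (G.continuous_fourier j))).mul
      ((G.continuous_fourier j).comp (continuous_sub_right α))).mul (Φ.fn l).continuous

/-- Symmetry of the dual lattice. -/
theorem tsum_dualLattice_neg (j : J) (X : Eucl d → ℝ≥0∞) :
    ∑' α : {α : Eucl d // α ∈ G.dualLattice j ∧ α ≠ 0}, X (-α) =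
      ∑' α : {α : Eucl d // α ∈ G.dualLattice j ∧ α ≠ 0}, X α := by
  let e : {α : Eucl d // α ∈ G.dualLattice j ∧ α ≠ 0} ≃
      {α : Eucl d // α ∈ G.dualLattice j ∧ α ≠ 0} :=
    { toFun := fun α => ⟨-α, G.neg_mem_dualLattice α.2.1, neg_ne_zero.2 α.2.2⟩
      invFun := fun α => ⟨-α, G.neg_mem_dualLattice α.2.1, neg_ne_zero.2 α.2.2⟩
      left_inv := fun α => Subtype.ext (neg_neg _)
      right_inv := fun α => Subtype.ext (neg_neg _) }
  exact e.tsum_eq (fun α => X α)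

end GSISystem

namespace GSISystem

variable [Countable J] (G : GSISystem d J)

theorem remainderTerm_apply (φ ψ : 𝓓(Ω, ℂ)) (α : Eucl d) :
    G.remainderTerm Ω (𝓕⁻ (testToSchwartz Ω φ)) α ψ = ∫ ξ, ψ (ξ + α) * (G.t α ξ * φ ξ) := by
  have hφ : 𝓕 ((𝓕⁻ (testToSchwartz Ω φ) : 𝓢(Eucl d, ℂ)) : Eucl d → ℂ) = φ := by
    rw [← SchwartzMap.fourier_coe, FourierTransform.fourier_fourierInv_eq]
    rfl
  rw [remainderTerm, hφ, regularDistribution_apply]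
  · rw [← integral_add_right_eq_self _ α]
    simp only [add_sub_cancel_right]
  · exact ((G.integrable_t_mul α φ.integrable').comp_sub_right α).locallyIntegrable
      |>.locallyIntegrableOn _

theorem enorm_remainderTerm_le (φ ψ : 𝓓(Ω, ℂ)) (α : Eucl d) :
    ‖G.remainderTerm Ω (𝓕⁻ (testToSchwartz Ω φ)) α ψ‖ₑ ≤
      ∫⁻ ξ, ‖ψ (ξ + α)‖ₑ * ‖φ ξ‖ₑ * G.tAbs α ξ := by
  rw [remainderTerm_apply]
  refine (enorm_integral_le_lintegral_enorm _).trans (lintegral_mono fun ξ => ?_)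
  simp only [enorm_mul]
  rw [mul_comm ‖G.t α ξ‖ₑ, ← mul_assoc]
  gcongr
  exact G.enorm_t_le α ξ

/-- A test function is bounded by a multiple of the indicator function of its support. -/
theorem enorm_le_indicator {K : Set (Eucl d)} {ψ : 𝓓(Ω, ℂ)} (h : tsupport ψ ⊆ K) (ξ : Eucl d) :
    ‖ψ ξ‖ₑ ≤ eLpNorm (𝓕 (ψ : Eucl d → ℂ)) 1 volume * K.indicator 1 ξ := by
  by_cases hξ : ξ ∈ K
  · simpa [hξ] using enorm_le_eLpNorm_fourier_test ψ ξ
  · rw [image_eq_zero_of_notMem_tsupport fun h' => hξ (h h')]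
    simp

/-- For ψ supported in K, the product |ψ(ξ+α) φ(ξ)| is at most ‖𝓕ψ‖_1 ‖𝓕φ‖_1 times the indicator
functions of K' = K ∪ supp φ at ξ and ξ + α. The α-LIC for K' then bounds the sum over α uniformly
in ψ. -/
theorem exists_hasSum_remainderTerm {G : GSISystem d J} (hG : G.AlphaLIC Ω) (φ : 𝓓(Ω, ℂ)) :
    ∃ L, HasSum (fun α : {α : Eucl d // α ∈ G.frequencies ∧ α ≠ 0} =>
      G.remainderTerm Ω (𝓕⁻ (testToSchwartz Ω φ)) α) L := by
  refine exists_hasSum_distribution fun K hK hKΩ => ?_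
  have hfin := hG.tsum_lintegral_tAbs_lt_top (hK.union φ.hasCompactSupport)
    (Set.union_subset hKΩ φ.tsupport_subset)
  set K' := K ∪ tsupport φ
  set A := eLpNorm (𝓕 (φ : Eucl d → ℂ)) 1 volume
  have hA : A < ⊤ := (memLp_one_iff_integrable.2 (integrable_fourier_test φ)).2
  refine ⟨_, ENNReal.mul_lt_top hA hfin, fun ψ hψ => ?_⟩
  rw [mul_right_comm, ← ENNReal.tsum_mul_left]
  refine ENNReal.tsum_le_tsum fun α => (G.enorm_remainderTerm_le φ ψ α).trans ?_
  have hm1 : Measurable (K'.indicator (1 : Eucl d → ℝ≥0∞)) :=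
    measurable_one.indicator (hK.union φ.hasCompactSupport).measurableSet
  have hm2 : Measurable fun ξ => K'.indicator 1 ξ * K'.indicator 1 (ξ + α) * G.tAbs α ξ :=
    (hm1.mul (hm1.comp (measurable_add_const (α : Eucl d)))).mul (G.measurable_tAbs α)
  rw [← lintegral_const_mul _ hm2]
  refine lintegral_mono fun ξ => ?_
  rw [← mul_assoc]
  refine mul_le_mul' ?_ le_rfl
  have h1 := enorm_le_indicator (hψ.trans (Set.subset_union_left (t := tsupport φ))) (ξ + α)
  have h2 := enorm_le_indicator (Set.subset_union_right (s := K) (t := tsupport φ)) ξ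
  calc ‖ψ (ξ + α)‖ₑ * ‖φ ξ‖ₑ ≤ (eLpNorm (𝓕 (ψ : Eucl d → ℂ)) 1 volume * K'.indicator 1 (ξ + α)) *
        (A * K'.indicator 1 ξ) := by gcongr
    _ ≤ (fourierNorm ψ * K'.indicator 1 (ξ + α)) * (A * K'.indicator 1 ξ) := by
        gcongr
        exact le_self_add
    _ = _ := by ring

theorem integrable_entry (Φ : BAPU Q) (i l : I) (α : Eucl d) :
    Integrable (fun ξ => Φ.fn i (ξ + α) * G.t α ξ * Φ.fn l ξ) := by
  refine (G.integrable_t_mul α ((Φ.fn i).integrable_comp_add_mul (Φ.fn l) α)).congr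
    (.of_forall fun ξ => ?_)
  ring

/-- The translation by α leaves only the unimodular constant e_x(α), and the finite expansion φ =
∑_l φ_l φ_l^* φ exhibits the entries of N as convolution kernels. -/
theorem remainderTerm_fn_planeWave (Φ : BAPU Q) (φ : 𝓓(Ω, ℂ)) {F : Finset I}
    (hF : ∀ i ∉ F, Disjoint (Q.carrier i) (tsupport φ)) (α x : Eucl d) (i : I) :
    G.remainderTerm Ω (𝓕⁻ (testToSchwartz Ω φ)) α
        ((Φ.fn i).mulSmooth (planeWave x) (contDiff_planeWave x)) =
      planeWave x α * ∑ l ∈ F, 𝓕⁻ (fun ξ => (Φ.fn i (ξ + α) * G.t α ξ * Φ.fn l ξ) *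
        Φ.starMul φ l ξ) x := by
  rw [remainderTerm_apply]
  simp only [fourierInv_eq_integral_planeWave]
  have hint : ∀ l, Integrable (fun ξ => planeWave x ξ * ((Φ.fn i (ξ + α) * G.t α ξ * Φ.fn l ξ) *
      Φ.starMul φ l ξ)) := fun l => by
    refine (G.integrable_t_mul α ((Φ.fn i).integrable_comp_add_mul
      (((Φ.fn l).mulSmooth _ (Φ.starMul φ l).contDiff).mulSmooth _ (contDiff_planeWave x)) α)).congr
      (.of_forall fun ξ => ?_)
    simp only [TestFunction.mulSmooth_apply]
    ring
  rw [← integral_finsetSum _ fun l _ => hint l, ← integral_const_mul]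
  refine integral_congr_ae (.of_forall fun ξ => ?_)
  simp only [TestFunction.mulSmooth_apply, mul_assoc, Φ.fn_mul_starMul]
  have h1 : φ ξ = ∑ l ∈ F, Φ.fn l ξ * φ ξ := by
    rw [← Finset.sum_mul]
    by_cases hξ : ξ ∈ tsupport φ
    · rw [Φ.sum_eq_one φ.tsupport_subset hF hξ, one_mul]
    · rw [image_eq_zero_of_notMem_tsupport hξ, mul_zero]
  rw [← Finset.mul_sum, ← Finset.mul_sum, ← Finset.mul_sum, ← h1, add_comm ξ α,
    planeWave_add_right]
  ring

theorem enorm_remainderTerm_fn_planeWave_le (Φ : BAPU Q) (φ : 𝓓(Ω, ℂ)) (α x : Eucl d) (i : I) :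
    ‖G.remainderTerm Ω (𝓕⁻ (testToSchwartz Ω φ)) α
        ((Φ.fn i).mulSmooth (planeWave x) (contDiff_planeWave x))‖ₑ ≤
      ∑' l, ∫⁻ y, ‖𝓕⁻ (fun ξ => Φ.fn i (ξ + α) * G.t α ξ * Φ.fn l ξ) (x - y)‖ₑ *
        ‖𝓕⁻ (Φ.starMul φ l : Eucl d → ℂ) y‖ₑ := by
  obtain ⟨F, hF⟩ := Φ.exists_finset_of_isCompact φ.hasCompactSupport φ.tsupport_subset
  rw [G.remainderTerm_fn_planeWave Φ φ hF, enorm_mul, enorm_planeWave, one_mul]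
  refine (enorm_sum_le _ _).trans ((Finset.sum_le_sum fun l _ => ?_).trans
    (ENNReal.sum_le_tsum F))
  exact enorm_fourierInv_mul_test_le (G.integrable_entry Φ i l α) (Φ.starMul φ l) x

theorem enorm_piece_remainder_le {G : GSISystem d J} (hG : G.AlphaLIC Ω) (Φ : BAPU Q)
    (φ : 𝓓(Ω, ℂ)) (i : I) (x : Eucl d) :
    ‖Φ.piece (G.remainder Ω (𝓕⁻ (testToSchwartz Ω φ))) i x‖ₑ ≤
      ∑' l, ∫⁻ y, (∑' α : {α : Eucl d // α ∈ G.frequencies ∧ α ≠ 0},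
        ‖𝓕⁻ (fun ξ => Φ.fn i (ξ + α) * G.t α ξ * Φ.fn l ξ) (x - y)‖ₑ) *
        ‖𝓕⁻ (Φ.starMul φ l : Eucl d → ℂ) y‖ₑ := by
  have : Countable {α : Eucl d // α ∈ G.frequencies ∧ α ≠ 0} :=
    (G.countable_frequencies.mono fun α h => h.1 : {α | α ∈ G.frequencies ∧ α ≠ 0}.Countable)
  obtain ⟨L, hL⟩ := exists_hasSum_remainderTerm hG φ
  rw [BAPU.piece, remainder, hL.tsum_eq, FourierDistribution.fourier_fourierInv,
    ← (hasSum_weakDual_iff.1 hL _).tsum_eq]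
  refine enorm_tsum_le_tsum_enorm.trans
    ((ENNReal.tsum_le_tsum fun α : {α : Eucl d // α ∈ G.frequencies ∧ α ≠ 0} =>
      G.enorm_remainderTerm_fn_planeWave_le Φ φ α x i).trans ?_)
  rw [ENNReal.tsum_comm]
  refine ENNReal.tsum_le_tsum fun l => ?_
  rw [← lintegral_tsum]
  · simp only [ENNReal.tsum_mul_right, le_refl]
  · intro α
    have h1 := continuous_fourierInv (G.integrable_entry Φ i l α)
    have h2 := continuous_fourierInv_test (Φ.starMul φ l)
    exact ((h1.comp (continuous_sub_left x)).enorm.measurable.mul h2.enorm.measurable).aemeasurable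

/-- The remainder is bounded on Fourier test functions. -/
theorem decompositionNorm_remainder_le {G : GSISystem d J} (hG : G.AlphaLIC Ω) (Φ : BAPU Q)
    {w : I → ℝ} (hw : Q.IsModerate w) {p q : ℝ≥0∞} (hp : 1 ≤ p) (hq : 1 ≤ q) (φ : 𝓓(Ω, ℂ)) :
    Φ.decompositionNorm p q w (G.remainder Ω (𝓕⁻ (testToSchwartz Ω φ))) ≤
      schurNorm (G.matrixN Φ w) * Q.clusteringNorm w q *
        Φ.decompositionNorm p q w (.ofFun Ω (𝓕⁻ (testToSchwartz Ω φ) : 𝓢(Eucl d, ℂ))) := by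
  have : Countable I := Φ.countable_index
  have : Countable {α : Eucl d // α ∈ G.frequencies ∧ α ≠ 0} :=
    (G.countable_frequencies.mono fun α h => h.1 : {α | α ∈ G.frequencies ∧ α ≠ 0}.Countable)
  set f := FourierDistribution.ofFun Ω (𝓕⁻ (testToSchwartz Ω φ) : 𝓢(Eucl d, ℂ)) with hf
  -- The sum over α is taken inside, before any norm in x. The integral of this kernel is the
  -- unweighted entry of N.
  let m : I → I → Eucl d → ℝ≥0∞ := fun i l y =>
    ∑' α : {α : Eucl d // α ∈ G.frequencies ∧ α ≠ 0},
      ‖𝓕⁻ (fun ξ => Φ.fn i (ξ + α) * G.t α ξ * Φ.fn l ξ) y‖ₑ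
  have hc : ∀ i l (α : Eucl d),
      Continuous fun y => ‖𝓕⁻ (fun ξ => Φ.fn i (ξ + α) * G.t α ξ * Φ.fn l ξ) y‖ₑ :=
    fun i l α => (continuous_fourierInv (G.integrable_entry Φ i l α)).enorm
  have hm : ∀ i l, Measurable (m i l) := fun i l =>
    Measurable.tsum fun α => (hc i l α).measurable
  have hmint : ∀ i l, ∫⁻ y, m i l y = ∑' α : {α : Eucl d // α ∈ G.frequencies ∧ α ≠ 0},
      eLpNorm (𝓕⁻ (fun ξ => Φ.fn i (ξ + α) * G.t α ξ * Φ.fn l ξ)) 1 volume := fun i l => by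
    simp only [m, eLpNorm_one_eq_lintegral_enorm]
    exact lintegral_tsum fun α => (hc i l α).measurable.aemeasurable
  let H : I → Eucl d → ℝ≥0∞ := fun l y => ‖𝓕⁻ (Φ.starMul φ l : Eucl d → ℂ) y‖ₑ
  have hH : ∀ l, Measurable (H l) := fun l =>
    (continuous_fourierInv_test (Φ.starMul φ l)).enorm.measurable
  have hHle : ∀ l, eLpNorm (H l) p volume ≤
      ∑ k ∈ Q.neighbors l, eLpNorm (Φ.piece f k) p volume := fun l => by
    have h1 : eLpNorm (H l) p volume =
        eLpNorm (∑ k ∈ Q.neighbors l, Φ.piece f k) p volume := by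
      refine eLpNorm_congr_enorm_ae (.of_forall fun y => ?_)
      simp only [H, enorm_enorm, Φ.fourierInv_starMul, Finset.sum_apply, hf]
    rw [h1]
    exact eLpNorm_sum_le (fun k _ => (Φ.continuous_piece f k).aestronglyMeasurable) hp
  have hpiece : ∀ i, eLpNorm (Φ.piece (G.remainder Ω (𝓕⁻ (testToSchwartz Ω φ))) i) p volume ≤
      ∑' l, (∫⁻ y, m i l y) * ∑ k ∈ Q.neighbors l, eLpNorm (Φ.piece f k) p volume := fun i => by
    calc _ ≤ eLpNorm (fun x => ∑' l, ∫⁻ y, m i l (x - y) * H l y) p volume :=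
          eLpNorm_mono_enorm fun x => (enorm_piece_remainder_le hG Φ φ i x).trans_eq
            (enorm_eq_self _).symm
      _ ≤ ∑' l, eLpNorm (fun x => ∫⁻ y, m i l (x - y) * H l y) p volume := by
          refine eLpNorm_tsum_le hp fun l => Measurable.aemeasurable ?_
          exact Measurable.lintegral_prod_right' (f := fun z : Eucl d × Eucl d =>
            m i l (z.1 - z.2) * H l z.2)
            (((hm i l).comp (measurable_fst.sub measurable_snd)).mul ((hH l).comp measurable_snd))
      _ ≤ _ := ENNReal.tsum_le_tsum fun l =>
          (eLpNorm_lintegral_sub_le (hm i l) (hH l) hp).trans (by gcongr; exact hHle l)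
  -- The weighted Schur test restores the quotients w_i / w_l of N; the clustered norms of the
  -- pieces cost ‖Γ‖.
  refine (ellNorm_mono q w hpiece).trans ((ellNorm_tsum_mul_le hq hw.1 _ _).trans ?_)
  rw [mul_assoc]
  refine mul_le_mul' (le_of_eq ?_) (AdmissibleCover.ellNorm_sum_neighbors_le hq hw.1
    (Φ.decompositionNorm_fourierInv_test_lt_top hq w φ))
  congr 1
  ext i l
  rw [hmint]
  rfl

/-! ### The stronger matrix condition -/

/-- Termwise integration of the series for t_α is justified by the integrable majorant B |φ_i(·+α)
φ_l|; then the triangle inequality is used. The shift appears as `ξ - -α` to match the sign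
convention in Ñ. -/
theorem eLpNorm_fourierInv_entry_le (Φ : BAPU Q) (i l : I) (α : Eucl d) :
    eLpNorm (𝓕⁻ (fun ξ => Φ.fn i (ξ + α) * G.t α ξ * Φ.fn l ξ)) 1 volume ≤
      ∑' j : {j : J // α ∈ G.dualLattice j}, ENNReal.ofReal (G.absDet j)⁻¹ *
        eLpNorm (𝓕⁻ (fun ξ => Φ.fn i (ξ - -α) * conj (𝓕 (G.g j) ξ) * 𝓕 (G.g j) (ξ - -α) *
          Φ.fn l ξ)) 1 volume := by
  set e : J → Eucl d → ℂ := fun j ξ => Φ.fn i (ξ - -α) * conj (𝓕 (G.g j) ξ) *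
    𝓕 (G.g j) (ξ - -α) * Φ.fn l ξ with he
  have hterm : ∀ x, ‖𝓕⁻ (fun ξ => Φ.fn i (ξ + α) * G.t α ξ * Φ.fn l ξ) x‖ₑ ≤
      ∑' j : {j : J // α ∈ G.dualLattice j}, ENNReal.ofReal (G.absDet j)⁻¹ * ‖𝓕⁻ (e j) x‖ₑ := by
    intro x
    obtain ⟨B, hB⟩ := G.exists_tAbs_le
    have hsum : ∀ ξ, ∑' j : {j : J // α ∈ G.dualLattice j},
        ‖planeWave x ξ * (((G.absDet j)⁻¹ : ℂ) * e j ξ)‖ₑ =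
        ‖Φ.fn i (ξ + α) * Φ.fn l ξ‖ₑ * G.tAbs α ξ := fun ξ => by
      rw [tAbs, ← ENNReal.tsum_mul_left]
      refine tsum_congr fun j => ?_
      rw [← G.enorm_t_term, ← enorm_mul, enorm_mul, enorm_planeWave, one_mul, he]
      simp only [sub_neg_eq_add]
      congr 1
      ring
    have h1 : 𝓕⁻ (fun ξ => Φ.fn i (ξ + α) * G.t α ξ * Φ.fn l ξ) x =
        ∑' j : {j : J // α ∈ G.dualLattice j}, ((G.absDet j)⁻¹ : ℂ) * 𝓕⁻ (e j) x := by
      simp only [fourierInv_eq_integral_planeWave, ← integral_const_mul]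
      have hmeas : ∀ j : {j : J // α ∈ G.dualLattice j}, AEStronglyMeasurable
          (fun ξ => planeWave x ξ * (((G.absDet j)⁻¹ : ℂ) * e j ξ)) volume := fun j =>
        ((contDiff_planeWave x).continuous.mul
          (continuous_const.mul (G.continuous_tildeEntry Φ i l j (-α)))).aestronglyMeasurable
      have := integral_tsum hmeas ?_
      · simp only [mul_left_comm _ (planeWave x _)]
        rw [← this]
        refine integral_congr_ae ?_
        filter_upwards [hB α] with ξ hξ
        have hs := ((G.hasSum_t (hξ.trans_lt ENNReal.coe_lt_top)).mul_left
          (planeWave x ξ * (Φ.fn i (ξ + α) * Φ.fn l ξ))).tsum_eq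
        rw [mul_right_comm (Φ.fn i (ξ + α)), ← mul_assoc, ← hs]
        refine tsum_congr fun j => ?_
        simp only [he, sub_neg_eq_add]
        ring
      · rw [← lintegral_tsum fun j => (hmeas j).enorm]
        simp only [hsum]
        refine ne_of_lt (lt_of_le_of_lt (lintegral_mono_ae (g := fun ξ =>
          ‖Φ.fn i (ξ + α) * Φ.fn l ξ‖ₑ * B) ?_) ?_)
        · filter_upwards [hB α] with ξ hξ
          gcongr
        · have hi := (Φ.fn i).integrable_comp_add_mul (Φ.fn l) α
          rw [lintegral_mul_const' _ _ ENNReal.coe_ne_top]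
          exact ENNReal.mul_lt_top hi.2 ENNReal.coe_lt_top
    rw [h1]
    refine enorm_tsum_le_tsum_enorm.trans (ENNReal.tsum_le_tsum fun j => le_of_eq ?_)
    rw [enorm_mul, ← Complex.ofReal_inv, ← ofReal_norm, Complex.norm_real,
      Real.norm_of_nonneg (inv_nonneg.2 (G.absDet_pos j).le)]
  have hc : ∀ j, Continuous (𝓕⁻ (e j)) := fun j =>
    continuous_fourierInv (G.integrable_tildeEntry Φ i l j (-α))
  simp only [eLpNorm_one_eq_lintegral_enorm]
  refine (lintegral_mono hterm).trans ?_
  refine (lintegral_tsum fun j : {j : J // α ∈ G.dualLattice j} =>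
    ((hc j).enorm.measurable.const_mul _).aemeasurable).trans_le ?_
  exact ENNReal.tsum_le_tsum fun j =>
    (lintegral_const_mul _ (hc j).enorm.measurable).le

/-- Besides the triangle inequality, the sums over α and j are exchanged and each dual lattice is
reflected, since N shifts by +α and Ñ by −α. -/
theorem matrixN_le_matrixNTilde (Φ : BAPU Q) (w : I → ℝ) (i l : I) :
    G.matrixN Φ w i l ≤ G.matrixNTilde Φ w i l := by
  refine mul_le_mul' (ENNReal.ofReal_le_ofReal (le_max_right _ _)) ?_
  refine (ENNReal.tsum_le_tsum fun α : {α : Eucl d // α ∈ G.frequencies ∧ α ≠ 0} =>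
    G.eLpNorm_fourierInv_entry_le Φ i l α).trans_eq ?_
  rw [G.tsum_frequencies_comm (fun α => α ≠ 0) (fun j α => ENNReal.ofReal (G.absDet j)⁻¹ *
    eLpNorm (𝓕⁻ (fun ξ => Φ.fn i (ξ - -α) * conj (𝓕 (G.g j) ξ) * 𝓕 (G.g j) (ξ - -α) *
      Φ.fn l ξ)) 1 volume)]
  refine tsum_congr fun j => ?_
  rw [ENNReal.tsum_mul_left, G.tsum_dualLattice_neg j (fun α => eLpNorm (𝓕⁻ (fun ξ =>
    Φ.fn i (ξ - α) * conj (𝓕 (G.g j) ξ) * 𝓕 (G.g j) (ξ - α) * Φ.fn l ξ)) 1 volume)]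

end GSISystem

theorem schurNorm_mono {M N : I → J → ℝ≥0∞} (h : ∀ i j, M i j ≤ N i j) :
    schurNorm M ≤ schurNorm N :=
  max_le_max (iSup_mono fun i => ENNReal.tsum_le_tsum fun j => h i j)
    (iSup_mono fun j => ENNReal.tsum_le_tsum fun i => h i j)

theorem le_schurNorm (M : I → J → ℝ≥0∞) (i : I) (j : J) : M i j ≤ schurNorm M :=
  (ENNReal.le_tsum j).trans ((le_iSup (fun i => ∑' j, M i j) i).trans (le_max_left _ _))

namespace GSISystem

variable (G : GSISystem d J)

theorem tsum_dualLattice_eq (j : J) (X : Eucl d → ℝ≥0∞) :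
    ∑' α : G.dualLattice j, X α =
      X 0 + ∑' α : {α : Eucl d // α ∈ G.dualLattice j ∧ α ≠ 0}, X α := by
  have h1 : ∑' α : {α : Eucl d // α ∈ G.dualLattice j ∧ α ≠ 0}, X α =
      ∑' α, {α | α ∈ G.dualLattice j ∧ α ≠ 0}.indicator X α :=
    tsum_subtype {α | α ∈ G.dualLattice j ∧ α ≠ 0} X
  rw [h1, tsum_subtype (G.dualLattice j) X, ENNReal.tsum_eq_add_tsum_ite 0,
    Set.indicator_of_mem (G.zero_mem_dualLattice j)]
  congr 1
  refine tsum_congr fun α => ?_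
  by_cases h0 : α = 0 <;> by_cases h : α ∈ G.dualLattice j <;> simp [h0, h]

theorem tAbs_zero (ξ : Eucl d) : G.tAbs 0 ξ =
    ∑' j, ENNReal.ofReal (G.absDet j)⁻¹ * (‖𝓕 (G.g j) ξ‖ₑ * ‖𝓕 (G.g j) ξ‖ₑ) := by
  simp only [tAbs, add_zero]
  exact (Equiv.subtypeUnivEquiv (fun j => G.zero_mem_dualLattice j)).tsum_eq
    (fun j => ENNReal.ofReal (G.absDet j)⁻¹ * (‖𝓕 (G.g j) ξ‖ₑ * ‖𝓕 (G.g j) ξ‖ₑ))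

/-- When ξ and ξ − α both lie in K, the functions φ_i with i ∈ F sum to 1 at both points. The
product of the generators thus expands into finitely many integrands of Ñ, each of which is
continuous and bounded by the L^1 norm of its inverse transform. -/
theorem lintegral_indicator_le (Φ : BAPU Q) {K : Set (Eucl d)} (hK : IsCompact K) (hKΩ : K ⊆ Ω)
    {F : Finset I} (hF : ∀ i ∉ F, Disjoint (Q.carrier i) K) (j : J) (α : Eucl d) :
    ∫⁻ ξ, K.indicator 1 ξ * K.indicator 1 (ξ - α) * (‖𝓕 (G.g j) ξ‖ₑ * ‖𝓕 (G.g j) (ξ - α)‖ₑ) ≤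
      volume K * ∑ i ∈ F, ∑ l ∈ F, eLpNorm (𝓕⁻ (fun ξ => Φ.fn i (ξ - α) * conj (𝓕 (G.g j) ξ) *
        𝓕 (G.g j) (ξ - α) * Φ.fn l ξ)) 1 volume := by
  have h : ∀ ξ, K.indicator 1 ξ * K.indicator 1 (ξ - α) *
      (‖𝓕 (G.g j) ξ‖ₑ * ‖𝓕 (G.g j) (ξ - α)‖ₑ) ≤ K.indicator (fun _ => ∑ i ∈ F, ∑ l ∈ F,
        eLpNorm (𝓕⁻ (fun ξ => Φ.fn i (ξ - α) * conj (𝓕 (G.g j) ξ) *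
        𝓕 (G.g j) (ξ - α) * Φ.fn l ξ)) 1 volume) ξ := fun ξ => by
    by_cases h1 : ξ ∈ K
    · by_cases h2 : ξ - α ∈ K
      · simp only [h1, h2, Set.indicator_of_mem, Pi.one_apply, one_mul]
        have h3 : conj (𝓕 (G.g j) ξ) * 𝓕 (G.g j) (ξ - α) = ∑ i ∈ F, ∑ l ∈ F,
            Φ.fn i (ξ - α) * conj (𝓕 (G.g j) ξ) * 𝓕 (G.g j) (ξ - α) * Φ.fn l ξ := by
          simp only [← Finset.mul_sum, ← Finset.sum_mul, Φ.sum_eq_one hKΩ hF h1,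
            Φ.sum_eq_one hKΩ hF h2, one_mul, mul_one]
        have h4 : ‖𝓕 (G.g j) ξ‖ₑ * ‖𝓕 (G.g j) (ξ - α)‖ₑ =
            ‖conj (𝓕 (G.g j) ξ) * 𝓕 (G.g j) (ξ - α)‖ₑ := by
          rw [enorm_mul, RCLike.enorm_conj]
        rw [h4, h3]
        refine (enorm_sum_le _ _).trans (Finset.sum_le_sum fun i _ =>
          (enorm_sum_le _ _).trans (Finset.sum_le_sum fun l _ => ?_))
        exact enorm_le_eLpNorm_fourierInv (G.continuous_tildeEntry Φ i l j α)
          (G.integrable_tildeEntry Φ i l j α) ξ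
      · simp [h2]
    · simp [h1]
  refine (lintegral_mono h).trans ?_
  rw [lintegral_indicator_const hK.measurableSet, mul_comm]

/-- The stronger matrix condition implies the local integrability condition. -/
theorem alphaLIC_of_matrixNTilde [Countable J] (Φ : BAPU Q) (w : I → ℝ)
    (h : schurNorm (G.matrixNTilde Φ w) < ⊤) : G.AlphaLIC Ω := by
  rintro f ⟨hb, K, hK, hKΩ, h0⟩
  obtain ⟨F, hF⟩ := Φ.exists_finset_of_isCompact hK hKΩ
  set u : Eucl d → ℂ := ((𝓕 f : LTwo d) : Eucl d → ℂ)
  set c := eLpNorm u ⊤ volume with hc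
  have hu : ∀ᵐ ξ, ‖u ξ‖ₑ ≤ c * K.indicator 1 ξ := by
    filter_upwards [h0, enorm_ae_le_eLpNormEssSup u volume] with ξ h0 h1
    by_cases hξ : ξ ∈ K
    · rw [← eLpNorm_exponent_top, ← hc] at h1
      rw [Set.indicator_of_mem hξ, Pi.one_apply, mul_one]
      exact h1
    · simp [h0 hξ]
  let X : J → Eucl d → ℝ≥0∞ := fun j α => ∫⁻ ξ, K.indicator 1 ξ * K.indicator 1 (ξ + α) *
    (‖𝓕 (G.g j) ξ‖ₑ * ‖𝓕 (G.g j) (ξ + α)‖ₑ)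
  have hm1 : Measurable (K.indicator (1 : Eucl d → ℝ≥0∞)) :=
    measurable_one.indicator hK.measurableSet
  have hterm : ∀ (j : J) (α : Eucl d), ∫⁻ ξ : Eucl d, ‖u ξ * u (ξ + α) *
        𝓕 (G.g j) ξ * 𝓕 (G.g j) (ξ + α)‖ₑ ≤ c ^ 2 * X j α := fun j α => by
    rw [← lintegral_const_mul' _ _ (ENNReal.pow_ne_top hb.2.ne)]
    refine lintegral_mono_ae ?_
    filter_upwards [hu, (measurePreserving_add_right (volume : Measure (Eucl d))
      α).quasiMeasurePreserving.ae hu] with ξ h1 h2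
    calc _ = ‖u ξ‖ₑ * ‖u (ξ + α)‖ₑ * (‖𝓕 (G.g j) ξ‖ₑ * ‖𝓕 (G.g j) (ξ + α)‖ₑ) := by
          simp only [enorm_mul, mul_assoc]
      _ ≤ (c * K.indicator 1 ξ) * (c * K.indicator 1 (ξ + α)) *
          (‖𝓕 (G.g j) ξ‖ₑ * ‖𝓕 (G.g j) (ξ + α)‖ₑ) := by gcongr
      _ = _ := by ring
  -- The matrix Ñ says nothing about α = 0; this part is bounded by B times the finite measure of K.
  have hzero : ∑' j, ENNReal.ofReal (G.absDet j)⁻¹ * X j 0 < ⊤ := by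
    obtain ⟨B, hB⟩ := G.exists_tAbs_le
    have h1 : ∑' j, ENNReal.ofReal (G.absDet j)⁻¹ * X j 0 ≤
        ∫⁻ ξ, K.indicator 1 ξ * G.tAbs 0 ξ := by
      simp only [G.tAbs_zero, ← ENNReal.tsum_mul_left]
      rw [lintegral_tsum]
      · refine ENNReal.tsum_le_tsum fun j => ?_
        rw [← lintegral_const_mul' _ _ ENNReal.ofReal_ne_top]
        refine lintegral_mono fun ξ => ?_
        by_cases hξ : ξ ∈ K <;> simp [hξ]
      · intro j
        have h2 := (G.continuous_fourier j).enorm.measurable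
        exact (hm1.mul ((h2.mul h2).const_mul _)).aemeasurable
    refine h1.trans_lt (lt_of_le_of_lt (lintegral_mono_ae (g := K.indicator fun _ => (B : ℝ≥0∞)) ?_)
      ?_)
    · filter_upwards [hB 0] with ξ hξ
      by_cases hξ' : ξ ∈ K
      · simpa [hξ'] using hξ
      · simp [hξ']
    · rw [lintegral_indicator_const hK.measurableSet]
      exact ENNReal.mul_lt_top ENNReal.coe_lt_top hK.measure_lt_top
  have hnonzero : ∑' j, ENNReal.ofReal (G.absDet j)⁻¹ *
      ∑' α : {α : Eucl d // α ∈ G.dualLattice j ∧ α ≠ 0}, X j α < ⊤ := by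
    have h1 : ∀ j, ENNReal.ofReal (G.absDet j)⁻¹ *
        ∑' α : {α : Eucl d // α ∈ G.dualLattice j ∧ α ≠ 0}, X j α ≤
        volume K * ∑ i ∈ F, ∑ l ∈ F, ENNReal.ofReal (G.absDet j)⁻¹ *
          ∑' α : {α : Eucl d // α ∈ G.dualLattice j ∧ α ≠ 0},
            eLpNorm (𝓕⁻ (fun ξ => Φ.fn i (ξ - α) * conj (𝓕 (G.g j) ξ) *
              𝓕 (G.g j) (ξ - α) * Φ.fn l ξ)) 1 volume := fun j => by
      rw [← G.tsum_dualLattice_neg j]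
      simp only [← Finset.mul_sum]
      rw [mul_left_comm]
      gcongr
      simp only [← Summable.tsum_finsetSum fun _ _ => ENNReal.summable]
      rw [← ENNReal.tsum_mul_left]
      refine ENNReal.tsum_le_tsum fun α => ?_
      have := G.lintegral_indicator_le Φ hK hKΩ hF j α
      simpa only [X, ← sub_eq_add_neg] using this
    refine (ENNReal.tsum_le_tsum h1).trans_lt ?_
    rw [ENNReal.tsum_mul_left]
    refine ENNReal.mul_lt_top hK.measure_lt_top ?_
    rw [Summable.tsum_finsetSum fun _ _ => ENNReal.summable]
    refine ENNReal.sum_lt_top.2 fun i _ => ?_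
    rw [Summable.tsum_finsetSum fun _ _ => ENNReal.summable]
    refine ENNReal.sum_lt_top.2 fun l _ => lt_of_le_of_lt ?_ ((le_schurNorm _ i l).trans_lt h)
    rw [matrixNTilde]
    -- The 1 in max{1, w_i/w_l} ensures that an entry of Ñ dominates the sum without weights, as the
    -- α-LIC does not involve w.
    refine le_mul_of_one_le_left zero_le ?_
    rw [ENNReal.one_le_ofReal]
    exact le_max_left _ _
  refine lt_of_le_of_lt (ENNReal.tsum_le_tsum fun j => mul_le_mul' le_rfl
    (ENNReal.tsum_le_tsum fun α : G.dualLattice j => hterm j α)) ?_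
  simp only [ENNReal.tsum_mul_left, G.tsum_dualLattice_eq _ (X _), mul_left_comm _ (c ^ 2)]
  refine ENNReal.mul_lt_top (ENNReal.pow_lt_top hb.2) ?_
  simp only [mul_add, ENNReal.tsum_add]
  exact ENNReal.add_lt_top.2 ⟨hzero, hnonzero⟩

end GSISystem

end

noncomputable section

variable {d : ℕ} {Ω : Opens (Eucl d)} {I J : Type*} {Q : AdmissibleCover Ω I}

/-! ### Dominated series in decomposition spaces -/

/-- The partition of unity reconstructs f from integrals of its pieces, so equality almost
everywhere suffices. All operator identities below are checked in this way. -/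
theorem BAPU.fourier_injective_of_piece (Φ : BAPU Q) {f g : FourierDistribution Ω}
    (h : ∀ i, Φ.piece f i =ᵐ[volume] Φ.piece g i) : f = g := by
  refine FourierDistribution.fourier_injective (DFunLike.ext _ _ fun ψ => ?_)
  obtain ⟨F, hF⟩ := Φ.exists_finset_of_isCompact ψ.hasCompactSupport ψ.tsupport_subset
  rw [Φ.fourier_apply_eq_sum f hF, Φ.fourier_apply_eq_sum g hF]
  refine Finset.sum_congr rfl fun i _ => integral_congr_ae ?_
  filter_upwards [h i] with x hx
  rw [hx]

/-- A series of Fourier distributions whose pieces are dominated by `L^p`-functions converges. -/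
theorem BAPU.exists_hasSum_of_dominated (Φ : BAPU Q) {ι : Type*} [Countable ι]
    {f : ι → FourierDistribution Ω} {p : ℝ≥0∞} (hp : 1 ≤ p) {B : I → Eucl d → ℝ≥0∞}
    (hB : ∀ m, Measurable (B m)) (hBp : ∀ m, eLpNorm (B m) p volume < ⊤)
    (h : ∀ m x, ∑' n, ‖Φ.piece (f n) m x‖ₑ ≤ B m x) : ∃ g, HasSum f g := by
  refine FourierDistribution.exists_hasSum fun K hK hKΩ => ?_
  obtain ⟨F, hF⟩ := Φ.exists_finset_of_isCompact hK hKΩ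
  -- Only the finitely many m ∈ F are seen by test functions supported in K, so the sum of these
  -- constants serves for all of them.
  choose C hC hCu using fun m => exists_lintegral_mul_le hp (hB m) (hBp m)
  refine ⟨∑ m ∈ F, C m, ENNReal.sum_lt_top.2 fun m _ => hC m, fun ψ hψ => ?_⟩
  have hcψ := (continuous_fourier_test ψ).enorm.measurable
  calc ∑' n, ‖(f n).fourier ψ‖ₑ
      ≤ ∑' n, ∑ m ∈ F, ∫⁻ x, ‖Φ.piece (f n) m x‖ₑ * ‖𝓕 (ψ : Eucl d → ℂ) x‖ₑ := by
        refine ENNReal.tsum_le_tsum fun n => ?_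
        rw [Φ.fourier_apply_eq_sum (f n) fun i hi => (hF i hi).mono_right hψ]
        refine (enorm_sum_le _ _).trans (Finset.sum_le_sum fun m _ => ?_)
        refine (enorm_integral_le_lintegral_enorm _).trans_eq ?_
        simp only [enorm_mul]
    _ = ∑ m ∈ F, ∫⁻ x, (∑' n, ‖Φ.piece (f n) m x‖ₑ) * ‖𝓕 (ψ : Eucl d → ℂ) x‖ₑ := by
        rw [Summable.tsum_finsetSum fun _ _ => ENNReal.summable]
        refine Finset.sum_congr rfl fun m _ => ?_
        simp only [← ENNReal.tsum_mul_right]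
        exact (lintegral_tsum fun n =>
          ((Φ.continuous_piece (f n) m).enorm.measurable.mul hcψ).aemeasurable).symm
    _ ≤ ∑ m ∈ F, C m * fourierNorm ψ := by
        refine Finset.sum_le_sum fun m _ => (lintegral_mono fun x =>
          mul_le_mul' (h m x) le_rfl).trans ?_
        have := hCu m (fun x => ‖𝓕 (ψ : Eucl d → ℂ) x‖ₑ) (eLpNorm (𝓕 (ψ : Eucl d → ℂ)) ⊤ volume) ?_
        · rwa [← eLpNorm_one_eq_lintegral_enorm] at this
        · rw [eLpNorm_exponent_top]
          exact enorm_ae_le_eLpNormEssSup _ _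
    _ = _ := (Finset.sum_mul _ _ _).symm

theorem BAPU.hasSum_piece (Φ : BAPU Q) {ι : Type*} {f : ι → FourierDistribution Ω}
    {g : FourierDistribution Ω} (h : HasSum f g) (m : I) (x : Eucl d) :
    HasSum (fun n => Φ.piece (f n) m x) (Φ.piece g m x) :=
  FourierDistribution.hasSum_iff.1 h _

theorem BAPU.enorm_piece_le_of_hasSum (Φ : BAPU Q) {ι : Type*} {f : ι → FourierDistribution Ω}
    {g : FourierDistribution Ω} (h : HasSum f g) (m : I) (x : Eucl d) :
    ‖Φ.piece g m x‖ₑ ≤ ∑' n, ‖Φ.piece (f n) m x‖ₑ := by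
  rw [← (Φ.hasSum_piece h m x).tsum_eq]
  exact enorm_tsum_le_tsum_enorm

/-! ### The localized atoms -/

namespace GSISystem

variable (G : GSISystem d J)

theorem fourier_atom (j : J) (k : Fin d → ℤ) (ξ : Eucl d) :
    𝓕 (G.atom j k) ξ = planeWave (-G.latticePoint j k) ξ * 𝓕 (G.g j) ξ := by
  simp only [fourier_eq_integral_planeWave]
  rw [← integral_const_mul, ← integral_add_right_eq_self _ (G.latticePoint j k)]
  refine integral_congr_ae (.of_forall fun x => ?_)
  simp only [atom, add_sub_cancel_right, neg_add, planeWave_add_left]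
  ring

theorem integrable_g (j : J) : Integrable (G.g j) := memLp_one_iff_integrable.1 (G.memLp_one j)

theorem memLp_atom (j : J) (k : Fin d → ℤ) : MemLp (G.atom j k) 1 volume :=
  memLp_one_iff_integrable.2 ((G.integrable_g j).comp_sub_right _)

/-- The function `φ_i ĝ_j`. -/
def genTest (Φ : BAPU Q) (i : I) (j : J) : 𝓓(Ω, ℂ) :=
  (Φ.fn i).mulSmooth (𝓕 (G.g j)) (G.contDiff_fourier j)

/-- The localized atom `φ̌_i * T_{C_j k} g_j`. -/
def locAtom (Φ : BAPU Q) (i : I) (j : J) (k : Fin d → ℤ) (x : Eucl d) : ℂ :=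
  𝓕⁻ (G.genTest Φ i j : Eucl d → ℂ) (x - G.latticePoint j k)

theorem continuous_locAtom (Φ : BAPU Q) (i : I) (j : J) (k : Fin d → ℤ) :
    Continuous (G.locAtom Φ i j k) :=
  (continuous_fourierInv_test _).comp (continuous_sub_right _)

theorem fourierInv_mulSmooth_fourier_eq_integral {g : Eucl d → ℂ} (hg : Integrable g)
    (hs : ContDiff ℝ ∞ (𝓕 g)) (φ : 𝓓(Ω, ℂ)) (x : Eucl d) :
    𝓕⁻ (φ.mulSmooth (𝓕 g) hs : Eucl d → ℂ) x = ∫ y, g y * 𝓕⁻ (φ : Eucl d → ℂ) (x - y) := by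
  have h := integral_fourier_mul_eq_flip hg
    (φ.mulSmooth (planeWave x) (contDiff_planeWave x)).integrable'
  simp only [fourier_mulSmooth_planeWave] at h
  rw [← h, fourierInv_eq_integral_planeWave]
  refine integral_congr_ae (.of_forall fun ξ => ?_)
  simp only [TestFunction.mulSmooth_apply]
  ring

theorem convolution_eq_fourierInv_genTest (Φ : BAPU Q) (i : I) (j : J) :
    ((𝓕⁻ (Φ.fn i : Eucl d → ℂ)) ⋆[ContinuousLinearMap.mul ℂ ℂ, volume] (G.g j)) =
      𝓕⁻ (G.genTest Φ i j : Eucl d → ℂ) := by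
  ext x
  rw [genTest, fourierInv_mulSmooth_fourier_eq_integral (G.integrable_g j), convolution_def,
    ← integral_sub_left_eq_self _ volume x]
  refine integral_congr_ae (.of_forall fun y => ?_)
  simp only [ContinuousLinearMap.mul_apply', sub_sub_cancel]
  ring

theorem fourierInv_mulSmooth_fourier_atom (Φ : BAPU Q) (i : I) (j : J) (k : Fin d → ℤ)
    (x : Eucl d) : 𝓕⁻ ((Φ.fn i).mulSmooth (𝓕 (G.atom j k)) (G.contDiff_fourier_atom j k) :
      Eucl d → ℂ) x = G.locAtom Φ i j k x := by
  rw [locAtom, fourierInv_eq_integral_planeWave, fourierInv_eq_integral_planeWave]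
  refine integral_congr_ae (.of_forall fun ξ => ?_)
  simp only [TestFunction.mulSmooth_apply, genTest, fourier_atom, sub_eq_add_neg,
    planeWave_add_left]
  ring

theorem piece_ofFun_atom (Φ : BAPU Q) (m : I) (j : J) (k : Fin d → ℤ) (x : Eucl d) :
    Φ.piece (.ofFun Ω (G.atom j k)) m x = G.locAtom Φ m j k x := by
  rw [Φ.piece_eq_locFn, FourierDistribution.locFn_ofFun le_rfl (G.memLp_atom j k),
    ← G.fourierInv_mulSmooth_fourier_atom,
    fourierInv_mulSmooth_fourier_eq_integral (memLp_one_iff_integrable.1 (G.memLp_atom j k))]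

theorem piece_frameTerm (Φ : BAPU Q) (f : FourierDistribution Ω) (m : I) (j : J)
    (k : Fin d → ℤ) (x : Eucl d) : Φ.piece (G.frameTerm Φ f (j, k)) m x =
      Φ.extendedPairing f (G.atom j k) (G.contDiff_fourier_atom j k) * G.locAtom Φ m j k x := by
  rw [← piece_ofFun_atom]
  rfl

theorem fourier_conjTest (χ : 𝓓(Ω, ℂ)) (x : Eucl d) :
    𝓕 (conjTest χ : Eucl d → ℂ) x = conj (𝓕⁻ (χ : Eucl d → ℂ) x) := by
  rw [fourier_eq_integral_planeWave, fourierInv_eq_integral_planeWave, ← integral_conj]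
  refine integral_congr_ae (.of_forall fun ξ => ?_)
  simp only [map_mul, conj_planeWave]
  rw [planeWave_comm (-ξ), planeWave_neg_right]
  rfl

theorem conjTest_apply (χ : 𝓓(Ω, ℂ)) (ξ : Eucl d) : conjTest χ ξ = conj (χ ξ) := rfl

/-- The terms of the extended inner product with an atom. -/
theorem pairingTerm_eq (Φ : BAPU Q) (f : FourierDistribution Ω) (i : I) (j : J)
    (k : Fin d → ℤ) : Φ.pairingTerm f (G.atom j k) (G.contDiff_fourier_atom j k) i =
      ∑ l ∈ Q.neighbors i, ∫ x, Φ.piece f l x * conj (G.locAtom Φ i j k x) := by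
  set χ := (Φ.fn i).mulSmooth (𝓕 (G.atom j k)) (G.contDiff_fourier_atom j k) with hχ
  -- The function χ vanishes off Q_i, where ∑_{l ∈ i^*} φ_l = 1; so only pieces of f with index in
  -- i^* occur.
  have h : conjTest χ = ∑ l ∈ Q.neighbors i, (Φ.fn l).mulSmooth _ (conjTest χ).contDiff := by
    ext ξ
    simp only [TestFunction.sum_apply, TestFunction.mulSmooth_apply]
    rw [← Finset.sum_mul]
    by_cases hξ : ξ ∈ Q.carrier i
    · rw [Φ.sum_neighbors_eq_one hξ, one_mul]
    · have : χ ξ = 0 := by rw [hχ, TestFunction.mulSmooth_apply, Φ.fn_eq_zero hξ, zero_mul]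
      rw [conjTest_apply, this, map_zero, mul_zero]
  rw [BAPU.pairingTerm, sesqPairing, ← hχ, h, map_sum]
  refine Finset.sum_congr rfl fun l _ => ?_
  rw [DistributionOn.apply_mulSmooth]
  simp only [fourier_conjTest, hχ, fourierInv_mulSmooth_fourier_atom]
  rfl

theorem integrable_piece_mul_conj_locAtom (Φ : BAPU Q) (f : FourierDistribution Ω) (l i : I)
    (j : J) (k : Fin d → ℤ) :
    Integrable (fun x => Φ.piece f l x * conj (G.locAtom Φ i j k x)) := by
  have h := f.fourier.integrable_locFn_mul_fourier (Φ.fn l) (conjTest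
    ((Φ.fn i).mulSmooth (𝓕 (G.atom j k)) (G.contDiff_fourier_atom j k)))
  simp only [fourier_conjTest, fourierInv_mulSmooth_fourier_atom] at h
  exact h

theorem enorm_pairingTerm_le (Φ : BAPU Q) (f : FourierDistribution Ω) (i : I) (j : J)
    (k : Fin d → ℤ) : ‖Φ.pairingTerm f (G.atom j k) (G.contDiff_fourier_atom j k) i‖ₑ ≤
      ∫⁻ x, ‖∑ l ∈ Q.neighbors i, Φ.piece f l x‖ₑ * ‖G.locAtom Φ i j k x‖ₑ := by
  rw [pairingTerm_eq, ← integral_finsetSum _ fun l _ =>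
    G.integrable_piece_mul_conj_locAtom Φ f l i j k]
  refine (enorm_integral_le_lintegral_enorm _).trans_eq (lintegral_congr fun x => ?_)
  rw [← Finset.sum_mul, enorm_mul, RCLike.enorm_conj]

/-! ### Amalgam norms -/

theorem measurableSet_cube (n : Fin d → ℤ) : MeasurableSet (cube n) := by
  have : cube n = ⋂ m, {x : Eucl d | (n m : ℝ) ≤ x m ∧ x m ≤ n m + 1} := by
    ext x
    simp [cube]
  rw [this]
  refine MeasurableSet.iInter fun m => ?_
  have hm : Measurable fun x : Eucl d => x m := by fun_prop
  exact (measurableSet_le measurable_const hm).inter (measurableSet_le hm measurable_const)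

theorem volume_cube (n : Fin d → ℤ) : volume (cube n) = 1 := by
  have : cube n = (WithLp.ofLp : Eucl d → Fin d → ℝ) ⁻¹'
      Set.Icc (fun m => (n m : ℝ)) (fun m => n m + 1) := by
    ext x
    simp [cube, Set.mem_Icc, Pi.le_def, forall_and]
  rw [this, (PiLp.volume_preserving_ofLp (Fin d)).measure_preimage
    measurableSet_Icc.nullMeasurableSet, Real.volume_Icc_pi]
  simp

theorem iUnion_cube : ⋃ n : Fin d → ℤ, cube n = Set.univ := by
  refine Set.eq_univ_of_forall fun x => Set.mem_iUnion.2 ⟨fun m => ⌊x m⌋, fun m => ?_⟩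
  exact ⟨Int.floor_le _, (Int.lt_floor_add_one _).le⟩

/-- The unit cubes cover space and have measure 1; overlaps are harmless for an upper bound. -/
theorem lintegral_enorm_le_amalgamNorm {h : Eucl d → ℂ} :
    ∫⁻ x, ‖h x‖ₑ ≤ amalgamNorm h := by
  rw [← setLIntegral_univ, ← iUnion_cube]
  refine (lintegral_iUnion_le _ _).trans (ENNReal.tsum_le_tsum fun n => ?_)
  have h1 : ∀ᵐ x ∂volume.restrict (cube n), ‖h x‖ₑ ≤ eLpNorm ((cube n).indicator h) ⊤ volume := by
    rw [ae_restrict_iff' (measurableSet_cube n), eLpNorm_exponent_top]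
    filter_upwards [enorm_ae_le_eLpNormEssSup ((cube n).indicator h) volume] with x hx hxn
    rwa [Set.indicator_of_mem hxn] at hx
  refine (lintegral_mono_ae h1).trans_eq ?_
  rw [lintegral_const, Measure.restrict_apply_univ, volume_cube, mul_one]

/-- The point x − k lies in the cube with index ⌊x⌋ − k, and k ↦ ⌊x⌋ − k permutes ℤ^d. Thus each
cube is used once, and |h(x − k)| is bounded there by the essential supremum for almost every x. -/
theorem ae_tsum_le_amalgamNorm (h : Eucl d → ℂ) :
    ∀ᵐ x, ∑' k : Fin d → ℤ, ‖h (x - intVec k)‖ₑ ≤ amalgamNorm h := by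
  have h1 : ∀ᵐ x, ∀ n : Fin d → ℤ,
      ‖(cube n).indicator h x‖ₑ ≤ eLpNorm ((cube n).indicator h) ⊤ volume :=
    ae_all_iff.2 fun n => by
      rw [eLpNorm_exponent_top]
      exact enorm_ae_le_eLpNormEssSup _ _
  have h2 : ∀ᵐ x, ∀ k n : Fin d → ℤ, ‖(cube n).indicator h (x - intVec k)‖ₑ ≤
      eLpNorm ((cube n).indicator h) ⊤ volume := ae_all_iff.2 fun k =>
    (measurePreserving_sub_right (volume : Measure (Eucl d))
      (intVec k)).quasiMeasurePreserving.ae h1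
  filter_upwards [h2] with x hx
  let e : (Fin d → ℤ) ≃ (Fin d → ℤ) := Equiv.subLeft fun m => ⌊x m⌋
  rw [amalgamNorm, ← e.tsum_eq (fun n => eLpNorm ((cube n).indicator h) ⊤ volume)]
  refine ENNReal.tsum_le_tsum fun k => ?_
  have hk := hx k (e k)
  rwa [Set.indicator_of_mem] at hk
  intro m
  have h3 : (x - intVec k) m = x m - k m := by simp [intVec]
  have h4 : ((e k m : ℤ) : ℝ) = ⌊x m⌋ - k m := by simp [e]
  rw [h3, h4]
  constructor
  · linarith [Int.floor_le (x m)]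
  · linarith [Int.lt_floor_add_one (x m)]

/-- The bound holds on a dense set, and for continuous h the sum is lower semicontinuous, so its
sublevel sets are closed. A bound at every point is what the series of pieces needs. -/
theorem tsum_le_amalgamNorm {h : Eucl d → ℂ} (hc : Continuous h) (x : Eucl d) :
    ∑' k : Fin d → ℤ, ‖h (x - intVec k)‖ₑ ≤ amalgamNorm h := by
  have hlsc : LowerSemicontinuous fun x => ∑' k : Fin d → ℤ, ‖h (x - intVec k)‖ₑ :=
    lowerSemicontinuous_tsum fun k =>
      (hc.comp (continuous_sub_right _)).enorm.lowerSemicontinuous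
  have hd := Measure.dense_of_ae (ae_tsum_le_amalgamNorm h)
  have hcl := hlsc.isClosed_preimage (amalgamNorm h)
  have := hcl.closure_eq ▸ hd.closure_eq
  exact (this ▸ Set.mem_univ x :
    x ∈ (fun x => ∑' k : Fin d → ℤ, ‖h (x - intVec k)‖ₑ) ⁻¹' Set.Iic (amalgamNorm h))

/-- The amalgam norm of `(φ̌_i * g_j) ∘ C_j`. -/
def locNorm (Φ : BAPU Q) (i : I) (j : J) : ℝ≥0∞ :=
  amalgamNorm fun x => 𝓕⁻ (G.genTest Φ i j : Eucl d → ℂ) (Matrix.toEuclideanLin (G.C j).val x)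

theorem adaptMatrix_eq (Φ : BAPU Q) (w : I → ℝ) (v : J → ℝ) (i : I) (j : J) :
    G.adaptMatrix Φ w v i j =
      ENNReal.ofReal (max (w i / v j) (v j / w i) * (G.absDet j) ^ (1 / 2 : ℝ)) *
        G.locNorm Φ i j := by
  rw [adaptMatrix, locNorm, convolution_eq_fourierInv_genTest]

theorem toEuclideanLin_det (A : Matrix (Fin d) (Fin d) ℝ) :
    LinearMap.det (Matrix.toEuclideanLin A) = A.det := by
  rw [Matrix.toEuclideanLin_eq_toLin_orthonormal, LinearMap.det_toLin]

theorem det_ne_zero (j : J) : (G.C j).val.det ≠ 0 :=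
  ((Matrix.isUnit_iff_isUnit_det _).1 (G.C j).isUnit).ne_zero

theorem surjective_toEuclideanLin (j : J) :
    Function.Surjective (Matrix.toEuclideanLin (G.C j).val : Eucl d → Eucl d) := by
  refine (LinearMap.equivOfDetNeZero (Matrix.toEuclideanLin (G.C j).val) ?_).surjective
  rw [toEuclideanLin_det]
  exact G.det_ne_zero j

theorem tsum_locAtom_le (Φ : BAPU Q) (i : I) (j : J) (x : Eucl d) :
    ∑' k, ‖G.locAtom Φ i j k x‖ₑ ≤ G.locNorm Φ i j := by
  obtain ⟨y, rfl⟩ := G.surjective_toEuclideanLin j x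
  have hc : Continuous fun x => 𝓕⁻ (G.genTest Φ i j : Eucl d → ℂ)
      (Matrix.toEuclideanLin (G.C j).val x) :=
    (continuous_fourierInv_test _).comp (LinearMap.continuous_of_finiteDimensional _)
  refine (le_of_eq (tsum_congr fun k => ?_)).trans (tsum_le_amalgamNorm hc y)
  rw [map_sub]
  rfl

/-- The translation is irrelevant, and the substitution x = C_j y produces the factor |det C_j|. -/
theorem lintegral_locAtom_le (Φ : BAPU Q) (i : I) (j : J) (k : Fin d → ℤ) :
    ∫⁻ x, ‖G.locAtom Φ i j k x‖ₑ ≤ ENNReal.ofReal (G.absDet j) * G.locNorm Φ i j := by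
  have h1 : ∫⁻ x, ‖G.locAtom Φ i j k x‖ₑ = ∫⁻ x, ‖𝓕⁻ (G.genTest Φ i j : Eucl d → ℂ) x‖ₑ :=
    lintegral_sub_right_eq_self (fun x => ‖𝓕⁻ (G.genTest Φ i j : Eucl d → ℂ) x‖ₑ) _
  have hdet : LinearMap.det (Matrix.toEuclideanLin (G.C j).val) ≠ 0 := by
    rw [toEuclideanLin_det]
    exact G.det_ne_zero j
  have h2 : ∫⁻ x, ‖𝓕⁻ (G.genTest Φ i j : Eucl d → ℂ) x‖ₑ = ENNReal.ofReal (G.absDet j) *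
      ∫⁻ x, ‖𝓕⁻ (G.genTest Φ i j : Eucl d → ℂ) (Matrix.toEuclideanLin (G.C j).val x)‖ₑ := by
    have h3 := Measure.map_linearMap_addHaar_eq_smul_addHaar (volume : Measure (Eucl d)) hdet
    have h4 : ∫⁻ x, ‖𝓕⁻ (G.genTest Φ i j : Eucl d → ℂ) x‖ₑ
        ∂(Measure.map (Matrix.toEuclideanLin (G.C j).val) (volume : Measure (Eucl d))) =
      ∫⁻ x, ‖𝓕⁻ (G.genTest Φ i j : Eucl d → ℂ) (Matrix.toEuclideanLin (G.C j).val x)‖ₑ :=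
      lintegral_map (continuous_fourierInv_test _).enorm.measurable
        (LinearMap.continuous_of_finiteDimensional _).measurable
    rw [← h4, h3, lintegral_smul_measure, smul_eq_mul, ← mul_assoc, ← ENNReal.ofReal_mul
      (G.absDet_pos j).le, toEuclideanLin_det, abs_inv]
    change _ = ENNReal.ofReal (G.absDet j * (G.absDet j)⁻¹) * _
    rw [mul_inv_cancel₀ (G.absDet_pos j).ne', ENNReal.ofReal_one, one_mul]
  rw [h1, h2]
  gcongr
  exact lintegral_enorm_le_amalgamNorm

end GSISystem

end

noncomputable section

variable {d : ℕ} {Ω : Opens (Eucl d)} {I J : Type*} {Q : AdmissibleCover Ω I}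

theorem schurNorm_transpose (M : I → J → ℝ≥0∞) : schurNorm (fun j i => M i j) = schurNorm M :=
  max_comm _ _

/-! ### Estimates for the frame operator -/

namespace GSISystem

variable (G : GSISystem d J) (Φ : BAPU Q)

/-- A bound for the frame coefficients of a distribution with pieces dominated by `H`. -/
def coeffBound (H : I → Eucl d → ℝ≥0∞) (j : J) (k : Fin d → ℤ) : ℝ≥0∞ :=
  ∑' i, ∫⁻ y, H i y * ‖G.locAtom Φ i j k y‖ₑ

/-- A bound for the pieces of the frame operator. -/
def frameBound (H : I → Eucl d → ℝ≥0∞) (m : I) (x : Eucl d) : ℝ≥0∞ :=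
  ∑' j, ∑' k, G.coeffBound Φ H j k * ‖G.locAtom Φ m j k x‖ₑ

theorem measurable_enorm_locAtom (i : I) (j : J) (k : Fin d → ℤ) :
    Measurable fun x => ‖G.locAtom Φ i j k x‖ₑ :=
  (G.continuous_locAtom Φ i j k).enorm.measurable

theorem measurable_frameBound [Countable J] (H : I → Eucl d → ℝ≥0∞) (m : I) :
    Measurable (G.frameBound Φ H m) :=
  Measurable.tsum fun j => Measurable.tsum fun k =>
    (G.measurable_enorm_locAtom Φ m j k).const_mul _

/-- Analysis followed by synthesis for one generator is an integral operator with kernel K(x, y) =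
∑_k |a_{m,k}(x)| |a_{i,k}(y)|. In either variable, the sum over k is bounded by one amalgam norm and
the integral by |det C_j| times the other, so the Schur test applies. -/
theorem eLpNorm_tsum_locAtom_le {p : ℝ≥0∞} (hp : 1 ≤ p) {H : Eucl d → ℝ≥0∞} (hH : Measurable H)
    (i m : I) (j : J) :
    eLpNorm (fun x => ∑' k, (∫⁻ y, H y * ‖G.locAtom Φ i j k y‖ₑ) * ‖G.locAtom Φ m j k x‖ₑ) p
        volume ≤
      (ENNReal.ofReal (G.absDet j) * G.locNorm Φ i j * G.locNorm Φ m j) * eLpNorm H p volume := by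
  let K : Eucl d → Eucl d → ℝ≥0∞ := fun x y =>
    ∑' k, ‖G.locAtom Φ m j k x‖ₑ * ‖G.locAtom Φ i j k y‖ₑ
  have hm := G.measurable_enorm_locAtom Φ
  have hK : Measurable (Function.uncurry K) := Measurable.tsum fun k =>
    ((hm m j k).comp measurable_fst).mul ((hm i j k).comp measurable_snd)
  have hbound : ∀ (i m : I) (x : Eucl d),
      ∫⁻ y, ∑' k, ‖G.locAtom Φ m j k x‖ₑ * ‖G.locAtom Φ i j k y‖ₑ ≤
        ENNReal.ofReal (G.absDet j) * G.locNorm Φ i j * G.locNorm Φ m j := fun i m x => by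
    rw [lintegral_tsum fun k => ((hm i j k).const_mul _).aemeasurable]
    calc _ = ∑' k, ‖G.locAtom Φ m j k x‖ₑ * ∫⁻ y, ‖G.locAtom Φ i j k y‖ₑ :=
          tsum_congr fun k => lintegral_const_mul _ (hm i j k)
      _ ≤ ∑' k, ‖G.locAtom Φ m j k x‖ₑ * (ENNReal.ofReal (G.absDet j) * G.locNorm Φ i j) :=
          ENNReal.tsum_le_tsum fun k => by
            gcongr
            exact G.lintegral_locAtom_le Φ i j k
      _ ≤ _ := by
          rw [ENNReal.tsum_mul_right, mul_comm]
          gcongr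
          exact G.tsum_locAtom_le Φ m j x
  have h := eLpNorm_lintegral_mul_le (K := K) (μ := volume) (ν := volume) hK
    (.of_forall fun x => hbound i m x) (.of_forall fun y => ?_) hp hH
  · refine (le_of_eq ?_).trans h
    congr 1
    ext x
    have : ∀ y, K x y * H y =
        ∑' k, ‖G.locAtom Φ m j k x‖ₑ * (H y * ‖G.locAtom Φ i j k y‖ₑ) := fun y => by
      rw [← ENNReal.tsum_mul_right]
      exact tsum_congr fun k => by ring
    simp only [this]
    have hHm : ∀ k, Measurable fun y => H y * ‖G.locAtom Φ i j k y‖ₑ := fun k => hH.mul (hm i j k)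
    rw [lintegral_tsum fun k => ((hHm k).const_mul _).aemeasurable]
    refine tsum_congr fun k => ?_
    rw [mul_comm]
    exact (lintegral_const_mul _ (hHm k)).symm
  · refine (le_of_eq ?_).trans ((hbound m i y).trans_eq (mul_right_comm _ _ _))
    exact lintegral_congr fun x => tsum_congr fun k => mul_comm _ _

theorem eLpNorm_frameBound_le [Countable J] {p : ℝ≥0∞} (hp : 1 ≤ p) {H : I → Eucl d → ℝ≥0∞}
    (hH : ∀ i, Measurable (H i)) (m : I) :
    eLpNorm (G.frameBound Φ H m) p volume ≤ ∑' j, ∑' i,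
      (ENNReal.ofReal (G.absDet j) * G.locNorm Φ i j * G.locNorm Φ m j) *
        eLpNorm (H i) p volume := by
  have : Countable I := Φ.countable_index
  have hm := G.measurable_enorm_locAtom Φ
  have h : G.frameBound Φ H m = fun x => ∑' j, ∑' i, ∑' k,
      (∫⁻ y, H i y * ‖G.locAtom Φ i j k y‖ₑ) * ‖G.locAtom Φ m j k x‖ₑ := by
    ext x
    refine tsum_congr fun j => ?_
    rw [ENNReal.tsum_comm]
    exact tsum_congr fun k => (ENNReal.tsum_mul_right).symm
  have hmeas : ∀ (i : I) (j : J), Measurable fun x => ∑' k,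
      (∫⁻ y, H i y * ‖G.locAtom Φ i j k y‖ₑ) * ‖G.locAtom Φ m j k x‖ₑ := fun i j =>
    Measurable.tsum fun k => (hm m j k).const_mul _
  rw [h]
  refine (eLpNorm_tsum_le hp fun j => (Measurable.tsum fun i => hmeas i j).aemeasurable).trans
    (ENNReal.tsum_le_tsum fun j => ?_)
  refine (eLpNorm_tsum_le hp fun i => (hmeas i j).aemeasurable).trans
    (ENNReal.tsum_le_tsum fun i => ?_)
  exact G.eLpNorm_tsum_locAtom_le Φ hp (hH i) i m j

/-- The factor |det C_j| splits into two square roots, and w_m = (w_m/v_j)(v_j/w_i) w_i. One half of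
each is absorbed by the entry (m, j), the other by (i, j), each using one branch of the maximum. So
the weighted estimate is M Mᵀ applied to the norms of H, and two Schur tests give the square. -/
theorem ellNorm_frameBound_le [Countable J] {p q : ℝ≥0∞} (hp : 1 ≤ p) (hq : 1 ≤ q) {w : I → ℝ}
    (hw : ∀ i, 0 < w i) {v : J → ℝ} (hv : ∀ j, 0 < v j) {H : I → Eucl d → ℝ≥0∞}
    (hH : ∀ i, Measurable (H i)) :
    ellNorm q w (fun m => eLpNorm (G.frameBound Φ H m) p volume) ≤
      schurNorm (G.adaptMatrix Φ w v) ^ 2 * ellNorm q w (fun i => eLpNorm (H i) p volume) := by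
  have : Countable I := Φ.countable_index
  set M := G.adaptMatrix Φ w v with hM
  have hterm : ∀ m j i, ENNReal.ofReal (w m) *
      ((ENNReal.ofReal (G.absDet j) * G.locNorm Φ i j * G.locNorm Φ m j) *
        eLpNorm (H i) p volume) ≤
      M m j * (M i j * (ENNReal.ofReal (w i) * eLpNorm (H i) p volume)) := fun m j i => by
    have hD := G.absDet_pos j
    have hsq : G.absDet j ^ (1 / 2 : ℝ) * G.absDet j ^ (1 / 2 : ℝ) = G.absDet j := by
      rw [← Real.rpow_add hD]
      norm_num
    have h1 : ENNReal.ofReal (w m) * ENNReal.ofReal (G.absDet j) ≤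
        ENNReal.ofReal (max (w m / v j) (v j / w m) * G.absDet j ^ (1 / 2 : ℝ)) *
        ENNReal.ofReal (max (w i / v j) (v j / w i) * G.absDet j ^ (1 / 2 : ℝ)) *
          ENNReal.ofReal (w i) := by
      have hwm := hw m
      have hwi := hw i
      have hvj := hv j
      rw [← ENNReal.ofReal_mul hwm.le, ← ENNReal.ofReal_mul (by positivity),
        ← ENNReal.ofReal_mul (by positivity)]
      refine ENNReal.ofReal_le_ofReal ?_
      calc w m * G.absDet j = (w m / v j * G.absDet j ^ (1 / 2 : ℝ)) *
            (v j / w i * G.absDet j ^ (1 / 2 : ℝ)) * w i := by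
            nth_rewrite 1 [← hsq]
            field_simp
        _ ≤ _ := by
            gcongr
            · exact le_max_left _ _
            · exact le_max_right _ _
    rw [hM, adaptMatrix_eq, adaptMatrix_eq]
    calc _ = (ENNReal.ofReal (w m) * ENNReal.ofReal (G.absDet j)) *
          (G.locNorm Φ i j * G.locNorm Φ m j * eLpNorm (H i) p volume) := by ring
      _ ≤ _ := mul_le_mul' h1 le_rfl
      _ = _ := by ring
  rw [ellNorm_eq_ellNorm_one, ellNorm_eq_ellNorm_one q w (fun i => eLpNorm (H i) p volume)]
  calc _ ≤ ellNorm q 1 (fun m => ∑' j, M m j *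
        ∑' i, M i j * (ENNReal.ofReal (w i) * eLpNorm (H i) p volume)) := by
        refine ellNorm_mono _ _ fun m => ?_
        refine (mul_le_mul' le_rfl (G.eLpNorm_frameBound_le Φ hp hH m)).trans ?_
        simp only [← ENNReal.tsum_mul_left]
        exact ENNReal.tsum_le_tsum fun j => ENNReal.tsum_le_tsum fun i => hterm m j i
    _ ≤ schurNorm M * ellNorm q 1 (fun j =>
        ∑' i, M i j * (ENNReal.ofReal (w i) * eLpNorm (H i) p volume)) :=
        ellNorm_one_tsum_mul_le hq _ _
    _ ≤ schurNorm M * (schurNorm (fun j i => M i j) *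
        ellNorm q 1 (fun i => ENNReal.ofReal (w i) * eLpNorm (H i) p volume)) := by
        gcongr
        exact ellNorm_one_tsum_mul_le hq (fun j i => M i j) _
    _ = _ := by
        rw [schurNorm_transpose, sq, mul_assoc]

/-- Absolute convergence of the inner products is deduced from the norm bound. If the coefficient
bound at (j, k) were infinite, any localized atom that is nonzero at a point would make the frame
bound infinite on an open set, against its L^p-integrability. If all localized atoms at (j, k)
vanish, the coefficient bound is 0. -/
theorem coeffBound_lt_top [Countable J] {p : ℝ≥0∞} (hp : 1 ≤ p) {H : I → Eucl d → ℝ≥0∞}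
    (h : ∀ m, eLpNorm (G.frameBound Φ H m) p volume < ⊤) (j : J) (k : Fin d → ℤ) :
    G.coeffBound Φ H j k < ⊤ := by
  by_contra htop
  rw [not_lt, top_le_iff] at htop
  have hzero : ∀ m x, G.locAtom Φ m j k x = 0 := by
    intro m x
    by_contra hx
    obtain ⟨C, hC, hCu⟩ := exists_lintegral_mul_le hp (G.measurable_frameBound Φ H m) (h m)
    let U := Function.support (G.locAtom Φ m j k) ∩ Metric.ball x 1
    have hUo : IsOpen U := (G.continuous_locAtom Φ m j k).isOpen_support.inter Metric.isOpen_ball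
    have hUpos : 0 < volume U := hUo.measure_pos volume ⟨x, hx, Metric.mem_ball_self one_pos⟩
    have hUfin : volume U < ⊤ :=
      (measure_mono Set.inter_subset_right).trans_lt measure_ball_lt_top
    have h1 := hCu (U.indicator 1) 1 (.of_forall fun y => by
      by_cases hy : y ∈ U <;> simp [hy])
    rw [lintegral_indicator_one hUo.measurableSet] at h1
    have h2 : ∫⁻ y, G.frameBound Φ H m y * U.indicator 1 y = ⊤ := by
      have h3 : ∀ y, G.frameBound Φ H m y * U.indicator 1 y = U.indicator (fun _ => ⊤) y := by
        intro y
        by_cases hy : y ∈ U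
        · simp only [hy, Set.indicator_of_mem, Pi.one_apply, mul_one]
          refine top_le_iff.1 ?_
          have h4 : (⊤ : ℝ≥0∞) = G.coeffBound Φ H j k * ‖G.locAtom Φ m j k y‖ₑ := by
            rw [htop, ENNReal.top_mul (enorm_ne_zero.2 hy.1)]
          rw [h4]
          exact (ENNReal.le_tsum k).trans (ENNReal.le_tsum
            (f := fun j => ∑' k, G.coeffBound Φ H j k * ‖G.locAtom Φ m j k y‖ₑ) j)
        · simp [hy]
      simp only [h3]
      rw [lintegral_indicator_const hUo.measurableSet, ENNReal.top_mul hUpos.ne']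
    rw [h2, top_le_iff] at h1
    exact (ENNReal.mul_lt_top hC (ENNReal.add_lt_top.2 ⟨hUfin, ENNReal.one_lt_top⟩)).ne h1
  have : G.coeffBound Φ H j k = 0 := by simp [coeffBound, hzero]
  rw [this] at htop
  exact ENNReal.zero_ne_top htop

variable {Φ}

theorem tsum_enorm_pairingTerm_le {f : FourierDistribution Ω} {H : I → Eucl d → ℝ≥0∞}
    (hf : ∀ i x, ‖∑ l ∈ Q.neighbors i, Φ.piece f l x‖ₑ ≤ H i x) (j : J) (k : Fin d → ℤ) :
    ∑' i, ‖Φ.pairingTerm f (G.atom j k) (G.contDiff_fourier_atom j k) i‖ₑ ≤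
      G.coeffBound Φ H j k :=
  ENNReal.tsum_le_tsum fun i => (G.enorm_pairingTerm_le Φ f i j k).trans
    (lintegral_mono fun x => mul_le_mul' (hf i x) le_rfl)

theorem enorm_extendedPairing_le {f : FourierDistribution Ω} {H : I → Eucl d → ℝ≥0∞}
    (hf : ∀ i x, ‖∑ l ∈ Q.neighbors i, Φ.piece f l x‖ₑ ≤ H i x) (j : J) (k : Fin d → ℤ) :
    ‖Φ.extendedPairing f (G.atom j k) (G.contDiff_fourier_atom j k)‖ₑ ≤ G.coeffBound Φ H j k :=
  enorm_tsum_le_tsum_enorm.trans (G.tsum_enorm_pairingTerm_le hf j k)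

theorem tsum_enorm_piece_frameTerm_le {f : FourierDistribution Ω} {H : I → Eucl d → ℝ≥0∞}
    (hf : ∀ i x, ‖∑ l ∈ Q.neighbors i, Φ.piece f l x‖ₑ ≤ H i x) (m : I) (x : Eucl d) :
    ∑' jk, ‖Φ.piece (G.frameTerm Φ f jk) m x‖ₑ ≤ G.frameBound Φ H m x := by
  rw [frameBound, ← ENNReal.tsum_prod]
  refine ENNReal.tsum_le_tsum fun jk => ?_
  rw [piece_frameTerm, enorm_mul]
  gcongr
  exact G.enorm_extendedPairing_le hf _ _

end GSISystem

/-- The absolute values of the clustered pieces. -/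
def BAPU.starAbs (Φ : BAPU Q) (f : FourierDistribution Ω) (i : I) (x : Eucl d) : ℝ≥0∞ :=
  ‖∑ l ∈ Q.neighbors i, Φ.piece f l x‖ₑ

theorem BAPU.measurable_starAbs (Φ : BAPU Q) (f : FourierDistribution Ω) (i : I) :
    Measurable (Φ.starAbs f i) :=
  (continuous_finsetSum _ fun l _ => Φ.continuous_piece f l).enorm.measurable

theorem BAPU.ellNorm_starAbs_le (Φ : BAPU Q) {p q : ℝ≥0∞} (hp : 1 ≤ p) (hq : 1 ≤ q) {w : I → ℝ}
    (hw : ∀ i, 0 < w i) {f : FourierDistribution Ω} (hf : Φ.decompositionNorm p q w f < ⊤) :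
    ellNorm q w (fun i => eLpNorm (Φ.starAbs f i) p volume) ≤
      Q.clusteringNorm w q * Φ.decompositionNorm p q w f := by
  refine (ellNorm_mono q w fun i => ?_).trans (AdmissibleCover.ellNorm_sum_neighbors_le hq hw hf)
  have h1 : eLpNorm (Φ.starAbs f i) p volume =
      eLpNorm (∑ k ∈ Q.neighbors i, Φ.piece f k) p volume := by
    refine eLpNorm_congr_enorm_ae (.of_forall fun y => ?_)
    simp only [BAPU.starAbs, enorm_enorm, Finset.sum_apply]
  rw [h1]
  exact eLpNorm_sum_le (fun k _ => (Φ.continuous_piece f k).aestronglyMeasurable) hp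

namespace GSISystem

variable [Countable J] (G : GSISystem d J) {Φ : BAPU Q} {p q : ℝ≥0∞} {w : I → ℝ} {v : J → ℝ}

theorem summable_pairingTerm (hp : 1 ≤ p) (hq : 1 ≤ q) (hw : Q.IsModerate w) (hv : ∀ j, 0 < v j)
    (hG : G.IsAdapted Φ w v) {f : FourierDistribution Ω} (hf : Φ.decompositionNorm p q w f < ⊤)
    (j : J) (k : Fin d → ℤ) :
    Summable fun i => ‖Φ.pairingTerm f (G.atom j k) (G.contDiff_fourier_atom j k) i‖ := by
  have : Countable I := Φ.countable_index
  refine tsum_enorm_ne_top_iff_summable_norm.1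
    ((G.tsum_enorm_pairingTerm_le (H := Φ.starAbs f) (fun i x => le_rfl) j k).trans_lt ?_).ne
  refine G.coeffBound_lt_top Φ hp (lt_top_of_ellNorm_lt_top hq hw.1 ?_) j k
  refine (G.ellNorm_frameBound_le Φ hp hq hw.1 hv (Φ.measurable_starAbs f)).trans_lt ?_
  refine ENNReal.mul_lt_top (ENNReal.pow_lt_top hG) ((Φ.ellNorm_starAbs_le hp hq hw.1 hf).trans_lt
    (ENNReal.mul_lt_top (AdmissibleCover.clusteringNorm_lt_top hq hw) hf))

/-- The frame operator converges and is bounded. -/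
theorem exists_hasSum_frameTerm (hp : 1 ≤ p) (hq : 1 ≤ q) (hw : Q.IsModerate w)
    (hv : ∀ j, 0 < v j) (hG : G.IsAdapted Φ w v) {f : FourierDistribution Ω}
    (hf : Φ.decompositionNorm p q w f < ⊤) :
    ∃ g, HasSum (G.frameTerm Φ f) g ∧ Φ.decompositionNorm p q w g ≤
      schurNorm (G.adaptMatrix Φ w v) ^ 2 * Q.clusteringNorm w q *
        Φ.decompositionNorm p q w f := by
  have : Countable I := Φ.countable_index
  have hle : ellNorm q w (fun m => eLpNorm (G.frameBound Φ (Φ.starAbs f) m) p volume) ≤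
      schurNorm (G.adaptMatrix Φ w v) ^ 2 * Q.clusteringNorm w q *
        Φ.decompositionNorm p q w f := by
    refine (G.ellNorm_frameBound_le Φ hp hq hw.1 hv (Φ.measurable_starAbs f)).trans ?_
    rw [mul_assoc]
    gcongr
    exact Φ.ellNorm_starAbs_le hp hq hw.1 hf
  have hfin := hle.trans_lt (ENNReal.mul_lt_top (ENNReal.mul_lt_top (ENNReal.pow_lt_top hG)
    (AdmissibleCover.clusteringNorm_lt_top hq hw)) hf)
  have hterm := G.tsum_enorm_piece_frameTerm_le (f := f) (Φ := Φ) (H := Φ.starAbs f)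
    (fun i x => le_rfl)
  obtain ⟨g, hg⟩ := Φ.exists_hasSum_of_dominated hp (G.measurable_frameBound Φ (Φ.starAbs f))
    (lt_top_of_ellNorm_lt_top hq hw.1 hfin) hterm
  refine ⟨g, hg, (ellNorm_mono q w fun m => eLpNorm_mono_enorm fun x => ?_).trans hle⟩
  rw [enorm_eq_self]
  exact (Φ.enorm_piece_le_of_hasSum hg m x).trans (hterm m x)

end GSISystem

end

noncomputable section

variable {d : ℕ} {Ω : Opens (Eucl d)} {I J : Type*} {Q : AdmissibleCover Ω I}

/-! ### Fourier multipliers -/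

theorem TestFunction.continuous_mul_of_continuousOn (χ : 𝓓(Ω, ℂ)) {h : Eucl d → ℂ}
    (hh : ContinuousOn h Ω) : Continuous (fun ξ => χ ξ * h ξ) := by
  rw [continuous_iff_continuousAt]
  intro ξ
  by_cases hξ : ξ ∈ tsupport χ
  · exact χ.continuous.continuousAt.mul
      (hh.continuousAt (Ω.isOpen.mem_nhds (χ.tsupport_subset hξ)))
  · have h1 : (fun ξ => χ ξ * h ξ) =ᶠ[nhds ξ] fun _ => 0 := by
      filter_upwards [(isClosed_tsupport χ).isOpen_compl.mem_nhds hξ] with η hη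
      rw [image_eq_zero_of_notMem_tsupport hη, zero_mul]
    exact continuousAt_const.congr h1.symm

theorem TestFunction.integrable_mul_of_continuousOn (χ : 𝓓(Ω, ℂ)) {h : Eucl d → ℂ}
    (hh : ContinuousOn h Ω) : Integrable (fun ξ => χ ξ * h ξ) :=
  (χ.continuous_mul_of_continuousOn hh).integrable_of_hasCompactSupport
    χ.hasCompactSupport.mul_right

namespace BAPU

variable (Φ : BAPU Q)

/-- The function `φ_i^*` as a test function. -/
def star (i : I) : 𝓓(Ω, ℂ) := ∑ l ∈ Q.neighbors i, Φ.fn l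

theorem star_apply (i : I) (ξ : Eucl d) : Φ.star i ξ = ∑ l ∈ Q.neighbors i, Φ.fn l ξ :=
  TestFunction.sum_apply _ _ _

/-- The convolution kernel `𝓕⁻¹ (φ_i^* h)`. -/
def multKernel (h : Eucl d → ℂ) (i : I) : Eucl d → ℂ := 𝓕⁻ (fun ξ => Φ.star i ξ * h ξ)

theorem multiplierTerm_eq (h : Eucl d → ℂ) (f : FourierDistribution Ω) (i : I) :
    Φ.multiplierTerm h f i = .ofFun Ω (Φ.multKernel h i
      ⋆[ContinuousLinearMap.mul ℂ ℂ, volume] (Φ.piece f i)) := by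
  simp only [multiplierTerm, multKernel, star_apply]

variable {Φ} {h : Eucl d → ℂ}

theorem IsTame.continuous_multKernel (hh : Φ.IsTame h) (i : I) :
    Continuous (Φ.multKernel h i) :=
  continuous_fourierInv ((Φ.star i).integrable_mul_of_continuousOn hh.1)

theorem IsTame.exists_lintegral_multKernel_le (hh : Φ.IsTame h) :
    ∃ C : ℝ≥0∞, C < ⊤ ∧ ∀ i, ∫⁻ x, ‖Φ.multKernel h i x‖ₑ ≤ C := by
  obtain ⟨n, hn⟩ := Q.exists_card_neighbors_le
  refine ⟨n * ⨆ i, eLpNorm (𝓕⁻ (fun ξ => Φ.fn i ξ * h ξ)) 1 volume,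
    ENNReal.mul_lt_top (ENNReal.natCast_lt_top n) hh.2, fun i => ?_⟩
  have h1 : Φ.multKernel h i = ∑ l ∈ Q.neighbors i, 𝓕⁻ (fun ξ => Φ.fn l ξ * h ξ) := by
    ext x
    simp only [multKernel, Finset.sum_apply, fourierInv_eq_integral_planeWave, star_apply,
      Finset.sum_mul, Finset.mul_sum]
    refine integral_finsetSum _ fun l _ => ?_
    refine (((Φ.fn l).mulSmooth (planeWave x)
      (contDiff_planeWave x)).integrable_mul_of_continuousOn hh.1).congr (.of_forall fun ξ => ?_)
    simp only [TestFunction.mulSmooth_apply]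
    ring
  have hc : ∀ l, Continuous (𝓕⁻ (fun ξ => Φ.fn l ξ * h ξ)) := fun l =>
    continuous_fourierInv ((Φ.fn l).integrable_mul_of_continuousOn hh.1)
  rw [← eLpNorm_one_eq_lintegral_enorm, h1]
  refine (eLpNorm_sum_le (fun l _ => (hc l).aestronglyMeasurable) le_rfl).trans ?_
  refine (Finset.sum_le_card_nsmul _ _ _ fun l _ =>
    le_iSup (fun i => eLpNorm (𝓕⁻ (fun ξ => Φ.fn i ξ * h ξ)) 1 volume) l).trans ?_
  rw [nsmul_eq_mul]
  gcongr
  exact hn i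

variable (Φ)

/-- A bound for the distribution `φ_i φ_m f̂`, if the pieces of `f` are bounded by `H`. -/
def locBound (H : I → Eucl d → ℝ≥0∞) (i m : I) (x : Eucl d) : ℝ≥0∞ :=
  ∫⁻ y, ‖𝓕⁻ (Φ.fn m : Eucl d → ℂ) (x - y)‖ₑ * H i y

/-- A bound for the pieces of the Fourier multiplier. -/
def multBound (h : Eucl d → ℂ) (H : I → Eucl d → ℝ≥0∞) (i m : I) (x : Eucl d) : ℝ≥0∞ :=
  ∫⁻ y, ‖Φ.multKernel h i (x - y)‖ₑ * Φ.locBound H i m y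

theorem measurable_enorm_fourierInv_fn (m : I) :
    Measurable fun x => ‖𝓕⁻ (Φ.fn m : Eucl d → ℂ) x‖ₑ :=
  (continuous_fourierInv_test _).enorm.measurable

theorem _root_.measurable_lintegral_sub {m H : Eucl d → ℝ≥0∞} (hm : Measurable m)
    (hH : Measurable H) : Measurable fun x => ∫⁻ y, m (x - y) * H y :=
  Measurable.lintegral_prod_right' (f := fun z : Eucl d × Eucl d => m (z.1 - z.2) * H z.2)
    ((hm.comp (measurable_fst.sub measurable_snd)).mul (hH.comp measurable_snd))

theorem measurable_locBound {H : I → Eucl d → ℝ≥0∞} (hH : ∀ i, Measurable (H i)) (i m : I) :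
    Measurable (Φ.locBound H i m) :=
  measurable_lintegral_sub (Φ.measurable_enorm_fourierInv_fn m) (hH i)

theorem eLpNorm_locBound_le {p : ℝ≥0∞} (hp : 1 ≤ p) {H : I → Eucl d → ℝ≥0∞}
    (hH : ∀ i, Measurable (H i)) (i m : I) :
    eLpNorm (Φ.locBound H i m) p volume ≤ Φ.const * eLpNorm (H i) p volume := by
  refine (eLpNorm_lintegral_sub_le (Φ.measurable_enorm_fourierInv_fn m) (hH i) hp).trans ?_
  gcongr
  rw [← eLpNorm_one_eq_lintegral_enorm]
  exact le_iSup (fun i => eLpNorm (𝓕⁻ (Φ.fn i : Eucl d → ℂ)) 1 volume) m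

theorem enorm_locFn_mulSmooth_le {f : FourierDistribution Ω} {H : I → Eucl d → ℝ≥0∞}
    (hf : ∀ i x, ‖Φ.piece f i x‖ₑ ≤ H i x) (i m : I) (x : Eucl d) :
    ‖f.fourier.locFn ((Φ.fn i).mulSmooth (Φ.fn m) (Φ.fn m).contDiff) x‖ₑ ≤
      Φ.locBound H i m x := by
  rw [DistributionOn.locFn_mulSmooth]
  refine (enorm_integral_le_lintegral_enorm _).trans (lintegral_mono fun y => ?_)
  rw [enorm_mul, mul_comm]
  exact mul_le_mul' le_rfl (hf i y)

variable {Φ}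

theorem IsTame.measurable_multBound (hh : Φ.IsTame h) {H : I → Eucl d → ℝ≥0∞}
    (hH : ∀ i, Measurable (H i)) (i m : I) : Measurable (Φ.multBound h H i m) :=
  measurable_lintegral_sub (hh.continuous_multKernel i).enorm.measurable
    (Φ.measurable_locBound hH i m)

theorem IsTame.eLpNorm_multBound_le (hh : Φ.IsTame h) {p : ℝ≥0∞} (hp : 1 ≤ p)
    {H : I → Eucl d → ℝ≥0∞} (hH : ∀ i, Measurable (H i)) (i m : I) :
    eLpNorm (Φ.multBound h H i m) p volume ≤
      (∫⁻ x, ‖Φ.multKernel h i x‖ₑ) * (Φ.const * eLpNorm (H i) p volume) :=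
  (eLpNorm_lintegral_sub_le (hh.continuous_multKernel i).enorm.measurable
    (Φ.measurable_locBound hH i m) hp).trans (by gcongr; exact Φ.eLpNorm_locBound_le hp hH i m)

/-- The convolution of an integrable function with an `L^p`-function. -/
theorem _root_.memLp_convolution {a b : Eucl d → ℂ} (ha : Continuous a)
    (hai : ∫⁻ x, ‖a x‖ₑ < ⊤) (hb : Continuous b) {p : ℝ≥0∞} (hp : 1 ≤ p)
    (hbp : eLpNorm b p volume < ⊤) :
    MemLp (a ⋆[ContinuousLinearMap.mul ℂ ℂ, volume] b) p volume := by
  have hcont : Continuous fun z : Eucl d × Eucl d => a z.2 * b (z.1 - z.2) :=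
    (ha.comp continuous_snd).mul (hb.comp (continuous_fst.sub continuous_snd))
  have hsm : StronglyMeasurable (a ⋆[ContinuousLinearMap.mul ℂ ℂ, volume] b) :=
    hcont.stronglyMeasurable.integral_prod_right
  refine ⟨hsm.aestronglyMeasurable, lt_of_le_of_lt ?_ (ENNReal.mul_lt_top hai hbp)⟩
  have := eLpNorm_lintegral_sub_le ha.enorm.measurable hb.enorm.measurable hp
  rw [eLpNorm_enorm] at this
  refine (eLpNorm_mono_enorm fun x => ?_).trans this
  rw [enorm_eq_self, ← lintegral_sub_left_eq_self (fun y => ‖a (x - y)‖ₑ * ‖b y‖ₑ) x]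
  refine (enorm_integral_le_lintegral_enorm _).trans_eq (lintegral_congr fun y => ?_)
  simp only [ContinuousLinearMap.mul_apply', enorm_mul, sub_sub_cancel]

/-- The pieces of the terms of the Fourier multiplier. -/
theorem IsTame.piece_multiplierTerm (hh : Φ.IsTame h) {p : ℝ≥0∞} (hp : 1 ≤ p)
    {f : FourierDistribution Ω} {i : I} (hf : eLpNorm (Φ.piece f i) p volume < ⊤) (m : I)
    (x : Eucl d) : Φ.piece (Φ.multiplierTerm h f i) m x =
      ∫ z, Φ.multKernel h i z *
        f.fourier.locFn ((Φ.fn i).mulSmooth (Φ.fn m) (Φ.fn m).contDiff) (x - z) := by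
  obtain ⟨C, hC, hCi⟩ := hh.exists_lintegral_multKernel_le
  set a := Φ.multKernel h i
  set b := Φ.piece f i
  set c := 𝓕⁻ (Φ.fn m : Eucl d → ℂ)
  have ha : Continuous a := hh.continuous_multKernel i
  have hb : Continuous b := Φ.continuous_piece f i
  have hc : Continuous c := continuous_fourierInv_test _
  rw [multiplierTerm_eq, piece_eq_locFn, FourierDistribution.locFn_ofFun hp
    (memLp_convolution ha ((hCi i).trans_lt hC) hb hp hf)]
  have hcont : Continuous fun z : Eucl d × Eucl d => a z.2 * b (z.1 - z.2) * c (x - z.1) :=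
    ((ha.comp continuous_snd).mul (hb.comp (continuous_fst.sub continuous_snd))).mul
      (hc.comp (continuous_const.sub continuous_fst))
  -- For Fubini: |a| * |b| is in L^p by Young's inequality and is paired with c, a function in L^1 ∩
  -- L^∞.
  have hint : Integrable (fun z : Eucl d × Eucl d => a z.2 * b (z.1 - z.2) * c (x - z.1))
      (volume.prod volume) := by
    refine ⟨hcont.aestronglyMeasurable, ?_⟩
    rw [hasFiniteIntegral_iff_enorm, lintegral_prod _ hcont.enorm.measurable.aemeasurable]
    have hY := eLpNorm_lintegral_sub_le ha.enorm.measurable hb.enorm.measurable hp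
    rw [eLpNorm_enorm] at hY
    have hm := measurable_lintegral_sub ha.enorm.measurable hb.enorm.measurable
    obtain ⟨C', hC', hCu⟩ := exists_lintegral_mul_le hp hm
      (hY.trans_lt (ENNReal.mul_lt_top ((hCi i).trans_lt hC) hf))
    have hcc := memLp_fourierInv_test (Φ.fn m)
    have h1 := hCu (fun y => ‖c (x - y)‖ₑ) (eLpNorm (Φ.fn m : Eucl d → ℂ) 1 volume)
      (.of_forall fun y => norm_fourierInv_le_lintegral _ _)
    rw [lintegral_sub_left_eq_self (fun y => ‖c y‖ₑ) x, ← eLpNorm_one_eq_lintegral_enorm] at h1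
    refine lt_of_le_of_lt ((le_of_eq (lintegral_congr fun y => ?_)).trans h1)
      (ENNReal.mul_lt_top hC' (ENNReal.add_lt_top.2 ⟨(hcc 1).2, ?_⟩))
    · simp only [enorm_mul]
      rw [lintegral_mul_const' _ _ enorm_ne_top,
        ← lintegral_sub_left_eq_self (fun z => ‖a (y - z)‖ₑ * ‖b z‖ₑ) y]
      simp only [sub_sub_cancel]
    · exact (memLp_one_iff_integrable.2 (Φ.fn m).integrable').2
  -- After the exchange the inner integral is b * c at x − z, that is, the transform of f̂ localized
  -- by φ_i φ_m.
  have hswap := integral_integral_swap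
    (f := fun y z => a z * b (y - z) * c (x - y)) hint
  have h1 : ∀ y, (a ⋆[ContinuousLinearMap.mul ℂ ℂ, volume] b) y * c (x - y) =
      ∫ z, a z * b (y - z) * c (x - y) := fun y => by
    rw [integral_mul_const]
    rfl
  refine ((integral_congr_ae (.of_forall h1)).trans hswap).trans
    (integral_congr_ae (.of_forall fun z => ?_))
  simp only [mul_assoc]
  rw [integral_const_mul, DistributionOn.locFn_mulSmooth, ← integral_sub_right_eq_self
    (fun y => f.fourier.locFn (Φ.fn i) y * 𝓕⁻ (Φ.fn m : Eucl d → ℂ) (x - z - y)) z]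
  simp only [sub_sub_sub_cancel_right]
  rfl

theorem mulSmooth_fn_eq_zero (Φ : BAPU Q) {i m : I} (h : i ∉ Q.neighbors m) :
    (Φ.fn i).mulSmooth (Φ.fn m) (Φ.fn m).contDiff = 0 := by
  ext ξ
  exact Φ.fn_mul_fn_eq_zero h ξ

theorem IsTame.piece_multiplierTerm_eq_zero (hh : Φ.IsTame h) {p : ℝ≥0∞} (hp : 1 ≤ p)
    {f : FourierDistribution Ω} {i : I} (hf : eLpNorm (Φ.piece f i) p volume < ⊤) {m : I}
    (hi : i ∉ Q.neighbors m) (x : Eucl d) : Φ.piece (Φ.multiplierTerm h f i) m x = 0 := by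
  rw [hh.piece_multiplierTerm hp hf, Φ.mulSmooth_fn_eq_zero hi]
  have : ∀ y, f.fourier.locFn (0 : 𝓓(Ω, ℂ)) y = 0 := fun y => by
    have h0 : (0 : 𝓓(Ω, ℂ)).mulSmooth (planeWave y) (contDiff_planeWave y) = 0 := by
      ext ξ
      simp only [TestFunction.mulSmooth_apply]
      exact zero_mul _
    rw [DistributionOn.locFn, h0, map_zero]
  simp only [this, mul_zero, integral_zero]

theorem IsTame.enorm_piece_multiplierTerm_le (hh : Φ.IsTame h) {p : ℝ≥0∞} (hp : 1 ≤ p)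
    {f : FourierDistribution Ω} {i : I} (hf : eLpNorm (Φ.piece f i) p volume < ⊤)
    {H : I → Eucl d → ℝ≥0∞} (hH : ∀ i x, ‖Φ.piece f i x‖ₑ ≤ H i x) (m : I) (x : Eucl d) :
    ‖Φ.piece (Φ.multiplierTerm h f i) m x‖ₑ ≤ Φ.multBound h H i m x := by
  rw [hh.piece_multiplierTerm hp hf, multBound,
    ← lintegral_sub_left_eq_self (fun y => ‖Φ.multKernel h i (x - y)‖ₑ * Φ.locBound H i m y) x]
  refine (enorm_integral_le_lintegral_enorm _).trans (lintegral_mono fun z => ?_)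
  simp only [enorm_mul, sub_sub_cancel]
  gcongr
  exact Φ.enorm_locFn_mulSmooth_le hH i m (x - z)

/-- The Fourier multiplier converges and is bounded. -/
theorem IsTame.exists_hasSum_multiplierTerm (hh : Φ.IsTame h) {q : ℝ≥0∞} (hq : 1 ≤ q)
    {w : I → ℝ} (hw : Q.IsModerate w) :
    ∃ C : ℝ≥0, ∀ {p : ℝ≥0∞}, 1 ≤ p → ∀ {f : FourierDistribution Ω},
      Φ.decompositionNorm p q w f < ⊤ → ∃ g, HasSum (Φ.multiplierTerm h f) g ∧
        Φ.decompositionNorm p q w g ≤ C * Φ.decompositionNorm p q w f := by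
  have : Countable I := Φ.countable_index
  obtain ⟨C, hC, hCi⟩ := hh.exists_lintegral_multKernel_le
  have hΓ := AdmissibleCover.clusteringNorm_lt_top (Q := Q) hq hw
  have hCtop : C * Φ.const * Q.clusteringNorm w q < ⊤ :=
    ENNReal.mul_lt_top (ENNReal.mul_lt_top hC Φ.bounded) hΓ
  refine ⟨(C * Φ.const * Q.clusteringNorm w q).toNNReal, fun {p} hp {f} hf => ?_⟩
  rw [ENNReal.coe_toNNReal hCtop.ne]
  have hfin := lt_top_of_ellNorm_lt_top hq hw.1 hf
  let H : I → Eucl d → ℝ≥0∞ := fun i x => ‖Φ.piece f i x‖ₑ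
  have hH : ∀ i, Measurable (H i) := fun i => (Φ.continuous_piece f i).enorm.measurable
  have hHp : ∀ i, eLpNorm (H i) p volume = eLpNorm (Φ.piece f i) p volume := fun i =>
    eLpNorm_enorm _
  -- If i is not a neighbour of m then φ_i φ_m = 0, so the m-th piece of the series is a finite sum.
  let B : I → Eucl d → ℝ≥0∞ := fun m x => ∑ i ∈ Q.neighbors m, Φ.multBound h H i m x
  have hB : ∀ m, Measurable (B m) := fun m =>
    Finset.measurable_sum _ fun i _ => hh.measurable_multBound hH i m
  have hBle : ∀ m, eLpNorm (B m) p volume ≤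
      C * Φ.const * ∑ i ∈ Q.neighbors m, eLpNorm (Φ.piece f i) p volume := fun m => by
    have h1 : B m = ∑ i ∈ Q.neighbors m, Φ.multBound h H i m := by
      ext x
      simp only [B, Finset.sum_apply]
    rw [h1, Finset.mul_sum]
    refine (eLpNorm_sum_le (fun i _ =>
      (hh.measurable_multBound hH i m).aestronglyMeasurable) hp).trans
        (Finset.sum_le_sum fun i _ => ?_)
    refine (hh.eLpNorm_multBound_le hp hH i m).trans ?_
    rw [hHp, ← mul_assoc]
    gcongr
    exact hCi i
  have hBnorm : ellNorm q w (fun m => eLpNorm (B m) p volume) ≤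
      C * Φ.const * Q.clusteringNorm w q * Φ.decompositionNorm p q w f := by
    refine (ellNorm_mono q w hBle).trans ?_
    rw [ellNorm_const_mul q hq, mul_assoc (C * Φ.const)]
    exact mul_le_mul' le_rfl (AdmissibleCover.ellNorm_sum_neighbors_le hq hw.1 hf)
  have hterm : ∀ m x, ∑' i, ‖Φ.piece (Φ.multiplierTerm h f i) m x‖ₑ ≤ B m x := fun m x => by
    rw [tsum_eq_sum (s := Q.neighbors m) fun i hi => by
      rw [hh.piece_multiplierTerm_eq_zero hp (hfin i) hi, enorm_zero]]
    exact Finset.sum_le_sum fun i _ =>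
      hh.enorm_piece_multiplierTerm_le hp (hfin i) (fun _ _ => le_rfl) m x
  obtain ⟨g, hg⟩ := Φ.exists_hasSum_of_dominated hp hB
    (lt_top_of_ellNorm_lt_top hq hw.1 (hBnorm.trans_lt (ENNReal.mul_lt_top hCtop hf))) hterm
  refine ⟨g, hg, (ellNorm_mono q w fun m => eLpNorm_mono_enorm fun x => ?_).trans hBnorm⟩
  rw [enorm_eq_self]
  exact (Φ.enorm_piece_le_of_hasSum hg m x).trans (hterm m x)

/-- The pieces of the Fourier multiplier. -/
theorem IsTame.piece_multiplier (hh : Φ.IsTame h) {p : ℝ≥0∞} (hp : 1 ≤ p)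
    {f g : FourierDistribution Ω} (hf : ∀ i, eLpNorm (Φ.piece f i) p volume < ⊤)
    (hg : HasSum (Φ.multiplierTerm h f) g) (m : I) (x : Eucl d) :
    Φ.piece g m x = ∑ i ∈ Q.neighbors m, ∫ z, Φ.multKernel h i z *
        f.fourier.locFn ((Φ.fn i).mulSmooth (Φ.fn m) (Φ.fn m).contDiff) (x - z) := by
  rw [← (Φ.hasSum_piece hg m x).tsum_eq, tsum_eq_sum (s := Q.neighbors m) fun i hi =>
    hh.piece_multiplierTerm_eq_zero hp (hf i) hi x]
  exact Finset.sum_congr rfl fun i _ => hh.piece_multiplierTerm hp (hf i) m x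

/-- The pieces of the Fourier multiplier applied to a Fourier test function. -/
theorem IsTame.piece_multiplier_fourierInv_test (hh : Φ.IsTame h) (φ : 𝓓(Ω, ℂ))
    {g : FourierDistribution Ω} (hg : HasSum (Φ.multiplierTerm h
      (.ofFun Ω (𝓕⁻ (testToSchwartz Ω φ) : 𝓢(Eucl d, ℂ)))) g) (m : I) (x : Eucl d) :
    Φ.piece g m x = ∫ ξ, planeWave x ξ * (Φ.fn m ξ * h ξ * φ ξ) := by
  have hf : ∀ i, eLpNorm (Φ.piece (.ofFun Ω (𝓕⁻ (testToSchwartz Ω φ) : 𝓢(Eucl d, ℂ))) i) 1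
      volume < ⊤ := fun i => by
    rw [funext (Φ.piece_ofFun_fourierInv_test φ i)]
    exact (memLp_fourierInv_test _ 1).2
  rw [hh.piece_multiplier le_rfl hf hg]
  have h1 : ∀ i, ∫ z, Φ.multKernel h i z * (FourierDistribution.ofFun Ω
      (𝓕⁻ (testToSchwartz Ω φ) : 𝓢(Eucl d, ℂ))).fourier.locFn
        ((Φ.fn i).mulSmooth (Φ.fn m) (Φ.fn m).contDiff) (x - z) =
      ∫ ξ, planeWave x ξ * (Φ.fn i ξ * Φ.fn m ξ * h ξ * φ ξ) := fun i => by
    have h2 : ∀ y, (FourierDistribution.ofFun Ω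
        (𝓕⁻ (testToSchwartz Ω φ) : 𝓢(Eucl d, ℂ))).fourier.locFn
          ((Φ.fn i).mulSmooth (Φ.fn m) (Φ.fn m).contDiff) y =
        𝓕⁻ (((Φ.fn i).mulSmooth (Φ.fn m) (Φ.fn m).contDiff).mulSmooth φ φ.contDiff :
          Eucl d → ℂ) y := fun y => by
      rw [DistributionOn.locFn, FourierDistribution.fourier_ofFun_fourierInv_test,
        fourierInv_eq_integral_planeWave]
      refine integral_congr_ae (.of_forall fun ξ => ?_)
      simp only [TestFunction.mulSmooth_apply]
      ring
    simp only [h2, multKernel]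
    rw [← fourierInv_mul_test ((Φ.star i).integrable_mul_of_continuousOn hh.1),
      fourierInv_eq_integral_planeWave]
    refine integral_congr_ae (.of_forall fun ξ => ?_)
    simp only [TestFunction.mulSmooth_apply]
    have h3 := Φ.sum_neighbors_mul_fn i ξ
    rw [← star_apply] at h3
    -- The factor φ_i^* in the kernel is absorbed by φ_i; the remaining sum over the neighbours of m
    -- is absorbed by φ_m in the same way below.
    linear_combination (planeWave x ξ * h ξ * Φ.fn m ξ * φ ξ) * h3
  simp only [h1]
  rw [← integral_finsetSum]
  · refine integral_congr_ae (.of_forall fun ξ => ?_)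
    have h3 := Φ.sum_neighbors_mul_fn m ξ
    simp only [← Finset.mul_sum, ← Finset.sum_mul]
    rw [h3]
  · intro i _
    refine (((((Φ.fn i).mulSmooth (Φ.fn m) (Φ.fn m).contDiff).mulSmooth φ φ.contDiff).mulSmooth
      (planeWave x) (contDiff_planeWave x)).integrable_mul_of_continuousOn hh.1).congr
      (.of_forall fun ξ => ?_)
    simp only [TestFunction.mulSmooth_apply]
    ring

end BAPU

end

noncomputable section

variable {d : ℕ} {Ω : Opens (Eucl d)} {I J : Type*} {Q : AdmissibleCover Ω I}

/-! ### Poisson summation -/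

/-- The integer vector `n` as a real vector. -/
def intCastVec (n : Fin d → ℤ) : Fin d → ℝ := fun i => n i

theorem intCastVec_add (m n : Fin d → ℤ) : intCastVec (m + n) = intCastVec m + intCastVec n := by
  ext
  simp [intCastVec]

/-- The projection to the torus. -/
def torusProj (x : Fin d → ℝ) : UnitAddTorus (Fin d) := fun i => x i

theorem isOpenQuotientMap_torusProj : IsOpenQuotientMap (torusProj (d := d)) :=
  IsOpenQuotientMap.piMap fun _ => QuotientAddGroup.isOpenQuotientMap_mk

theorem exists_intCastVec_of_torusProj_eq {x y : Fin d → ℝ} (h : torusProj x = torusProj y) :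
    ∃ n : Fin d → ℤ, y = x + intCastVec n := by
  have h1 : ∀ i, ∃ n : ℤ, y i = x i + n := fun i => by
    have h2 : ((x i : ℝ) : UnitAddCircle) = (y i : ℝ) := congrFun h i
    obtain ⟨n, hn⟩ := AddSubgroup.mem_zmultiples_iff.1 (QuotientAddGroup.eq.1 h2)
    refine ⟨n, ?_⟩
    simp only [zsmul_eq_mul, mul_one] at hn
    linarith
  choose n hn using h1
  exact ⟨n, funext hn⟩

theorem mFourier_torusProj (n : Fin d → ℤ) (x : Fin d → ℝ) :
    UnitAddTorus.mFourier n (torusProj x) =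
      Complex.exp (2 * Real.pi * Complex.I * ∑ i, (n i : ℂ) * x i) := by
  change ∏ i, fourier (n i) ((x i : ℝ) : UnitAddCircle) = _
  simp only [fourier_coe_apply]
  rw [← Complex.exp_sum, Finset.mul_sum]
  congr 1
  refine Finset.sum_congr rfl fun i _ => ?_
  push_cast
  ring

/-- The half-open unit box at the integer vector `m`. -/
def unitBox (m : Fin d → ℤ) : Set (Fin d → ℝ) := {x | ∀ i, x i ∈ Set.Ioc (m i : ℝ) (m i + 1)}

theorem measurableSet_unitBox (m : Fin d → ℤ) : MeasurableSet (unitBox m) := by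
  have : unitBox m = Set.univ.pi fun i => Set.Ioc (m i : ℝ) (m i + 1) := by
    ext x
    simp [unitBox]
  rw [this]
  exact MeasurableSet.univ_pi fun i => measurableSet_Ioc

theorem pairwise_disjoint_unitBox :
    Pairwise (Function.onFun Disjoint (unitBox (d := d))) := by
  intro m n hmn
  refine Set.disjoint_left.2 fun x hm hn => hmn (funext fun i => ?_)
  have h1 := hm i
  have h2 := hn i
  have h3 : (m i : ℝ) < n i + 1 := h1.1.trans_le h2.2
  have h4 : (n i : ℝ) < m i + 1 := h2.1.trans_le h1.2
  have h5 : m i < n i + 1 := by exact_mod_cast h3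
  have h6 : n i < m i + 1 := by exact_mod_cast h4
  omega

theorem iUnion_unitBox : ⋃ m, unitBox (d := d) m = Set.univ := by
  -- The boxes are open at their lower faces, hence the ceiling minus one rather than the floor.
  refine Set.eq_univ_of_forall fun x => Set.mem_iUnion.2 ⟨fun i => ⌈x i⌉ - 1, fun i => ?_⟩
  have h1 := Int.ceil_lt_add_one (x i)
  have h2 := Int.le_ceil (x i)
  constructor
  · push_cast
    linarith
  · push_cast
    linarith

theorem preimage_add_unitBox (m : Fin d → ℤ) :
    (fun x => x + intCastVec m) ⁻¹' unitBox m = unitBox 0 := by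
  ext x
  simp only [unitBox, Set.mem_preimage, Set.mem_ofPred_eq, Set.mem_Ioc, Pi.add_apply, intCastVec,
    Pi.zero_apply, Int.cast_zero, zero_add]
  refine forall_congr' fun i => ?_
  constructor <;> rintro ⟨h1, h2⟩ <;> constructor <;> linarith

/-- Unfolding an integral over `ℝ^d` to an integral over the unit box. -/
theorem integral_eq_integral_unitBox_tsum {F : (Fin d → ℝ) → ℂ} (hF : Integrable F) :
    ∫ x, F x = ∫ x in unitBox 0, ∑' m : Fin d → ℤ, F (x + intCastVec m) := by
  have hshift : ∀ m : Fin d → ℤ, ∫ x in unitBox m, F x =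
      ∫ x in unitBox 0, F (x + intCastVec m) := fun m => by
    rw [← preimage_add_unitBox m]
    exact ((measurePreserving_add_right volume (intCastVec m)).setIntegral_preimage_emb
      (measurableEmbedding_addRight _) _ _).symm
  have hshift' : ∀ m : Fin d → ℤ, ∫⁻ x in unitBox m, ‖F x‖ₑ =
      ∫⁻ x in unitBox 0, ‖F (x + intCastVec m)‖ₑ := fun m => by
    rw [← preimage_add_unitBox m]
    exact ((measurePreserving_add_right volume (intCastVec m)).setLIntegral_comp_preimage_emb
      (measurableEmbedding_addRight _) _ _).symm
  rw [integral_tsum]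
  · rw [← setIntegral_univ, ← iUnion_unitBox, integral_iUnion measurableSet_unitBox
      pairwise_disjoint_unitBox hF.integrableOn]
    exact tsum_congr hshift
  · intro m
    exact (hF.comp_add_right (intCastVec m)).aestronglyMeasurable.restrict
  · simp only [← hshift']
    rw [← lintegral_iUnion measurableSet_unitBox pairwise_disjoint_unitBox, iUnion_unitBox,
      setLIntegral_univ]
    exact hF.2.ne

/-- For x in a unit ball only finitely many integer translates meet the support of W, so the series
has a summable constant majorant there. -/
theorem continuous_tsum_intCastVec {W : (Fin d → ℝ) → ℂ} (hW : Continuous W)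
    (hs : HasCompactSupport W) : Continuous fun x => ∑' m : Fin d → ℤ, W (x + intCastVec m) := by
  obtain ⟨R, hR⟩ := hs.isCompact.isBounded.exists_norm_le
  obtain ⟨M, hM⟩ := hs.exists_bound_of_continuous hW
  rw [continuous_iff_continuousAt]
  intro x₀
  have hfin : {m : Fin d → ℤ | ‖m‖ ≤ R + (‖x₀‖ + 1)}.Finite := by
    have : {m : Fin d → ℤ | ‖m‖ ≤ R + (‖x₀‖ + 1)} = Metric.closedBall 0 (R + (‖x₀‖ + 1)) := by
      ext m
      simp
    rw [this]
    exact (isCompact_closedBall _ _).finite_of_discrete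
  have hnorm : ∀ m : Fin d → ℤ, ‖m‖ = ‖intCastVec m‖ := fun m => by
    simp only [Pi.norm_def, intCastVec]
    congr 1
  let u : (Fin d → ℤ) → ℝ := {m : Fin d → ℤ | ‖m‖ ≤ R + (‖x₀‖ + 1)}.indicator fun _ => max M 0
  have hu : Summable u := summable_of_hasFiniteSupport
    (hfin.subset Set.support_indicator_subset)
  refine (continuousOn_tsum (s := Metric.ball x₀ 1) (u := u) (fun m =>
    (hW.comp (continuous_add_const _)).continuousOn) hu fun m x hx => ?_).continuousAt
      (Metric.ball_mem_nhds x₀ one_pos)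
  by_cases hm : ‖m‖ ≤ R + (‖x₀‖ + 1)
  · simp only [u]
    rw [Set.indicator_of_mem (show m ∈ {m : Fin d → ℤ | ‖m‖ ≤ R + (‖x₀‖ + 1)} from hm)]
    exact (hM _).trans (le_max_left _ _)
  · have h0 : W (x + intCastVec m) = 0 := by
      by_contra h0
      have h1 := hR _ (subset_tsupport _ h0)
      have h2 : ‖x‖ ≤ ‖x₀‖ + 1 := by
        have := norm_le_norm_add_norm_sub' x x₀
        have h3 := mem_ball_iff_norm.1 hx
        linarith
      have h4 : ‖intCastVec m‖ ≤ ‖x + intCastVec m‖ + ‖x‖ := by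
        have := norm_sub_le (x + intCastVec m) x
        rwa [add_sub_cancel_left] at this
      rw [hnorm] at hm
      linarith
    rw [Function.comp_apply, h0, norm_zero]
    exact Set.indicator_nonneg (fun _ _ => le_max_right _ _) _

/-- Poisson's summation formula for a continuous function with compact support. -/
theorem hasSum_fourier_intCastVec {W : (Fin d → ℝ) → ℂ} (hW : Continuous W)
    (hs : HasCompactSupport W)
    (hsum : Summable fun n : Fin d → ℤ =>
      ∫ x : Fin d → ℝ, Complex.exp (2 * Real.pi * Complex.I * ∑ i, (-(n i) : ℂ) * x i) * W x) :
    HasSum (fun n : Fin d → ℤ =>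
      ∫ x : Fin d → ℝ, Complex.exp (2 * Real.pi * Complex.I * ∑ i, (-(n i) : ℂ) * x i) * W x)
      (∑' m : Fin d → ℤ, W (intCastVec m)) := by
  let P : C(Fin d → ℝ, ℂ) := ⟨_, continuous_tsum_intCastVec hW hs⟩
  let π : C(Fin d → ℝ, UnitAddTorus (Fin d)) := ⟨torusProj, isOpenQuotientMap_torusProj.continuous⟩
  -- The periodization is invariant under integer translations and hence descends to a continuous
  -- function on the torus.
  have hP : Function.FactorsThrough P π := fun x y hxy => by
    obtain ⟨n, rfl⟩ := exists_intCastVec_of_torusProj_eq hxy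
    change ∑' m : Fin d → ℤ, W (x + intCastVec m) =
      ∑' m : Fin d → ℤ, W (x + intCastVec n + intCastVec m)
    rw [← (Equiv.addLeft n).tsum_eq (fun m => W (x + intCastVec m))]
    refine tsum_congr fun m => ?_
    rw [Equiv.coe_addLeft, intCastVec_add, add_assoc]
  let f : C(UnitAddTorus (Fin d), ℂ) :=
    Topology.IsQuotientMap.lift (f := π) isOpenQuotientMap_torusProj.isQuotientMap P hP
  have hf : ∀ x, f (torusProj x) = ∑' m : Fin d → ℤ, W (x + intCastVec m) := fun x =>
    DFunLike.congr_fun (Topology.IsQuotientMap.lift_comp (f := π)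
      isOpenQuotientMap_torusProj.isQuotientMap P hP) x
  -- Unfolding: the torus integral of a periodization against a character is an integral over the
  -- whole space.
  have hcoeff : ∀ n, UnitAddTorus.mFourierCoeff f n =
      ∫ x : Fin d → ℝ, Complex.exp (2 * Real.pi * Complex.I * ∑ i, (-(n i) : ℂ) * x i) * W x := by
    intro n
    have hexp : ∀ x : Fin d → ℝ, UnitAddTorus.mFourier (-n) (torusProj x) =
        Complex.exp (2 * Real.pi * Complex.I * ∑ i, (-(n i) : ℂ) * x i) := fun x => by
      rw [mFourier_torusProj]
      simp only [Pi.neg_apply, Int.cast_neg]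
    have hper : ∀ (x : Fin d → ℝ) (m : Fin d → ℤ), torusProj (x + intCastVec m) = torusProj x :=
      fun x m => funext fun i => by
        change ((x i + m i : ℝ) : UnitAddCircle) = (x i : ℝ)
        exact (QuotientAddGroup.eq (s := AddSubgroup.zmultiples (1 : ℝ))).2
          (AddSubgroup.mem_zmultiples_iff.2 ⟨-m i, by simp⟩)
    have hc : Continuous fun x : Fin d → ℝ => UnitAddTorus.mFourier (-n) (torusProj x) * W x :=
      ((UnitAddTorus.mFourier (-n)).continuous.comp
        isOpenQuotientMap_torusProj.continuous).mul hW
    rw [UnitAddTorus.mFourierCoeff_eq_integral f n 0]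
    simp only [← hexp]
    rw [integral_eq_integral_unitBox_tsum (hc.integrable_of_hasCompactSupport hs.mul_left)]
    have hbox : {x : Fin d → ℝ | ∀ i, x i ∈ Set.Ioc ((0 : Fin d → ℝ) i) ((0 : Fin d → ℝ) i + 1)} =
        unitBox 0 := by
      simp [unitBox]
    rw [hbox]
    refine integral_congr_ae (.of_forall fun x => ?_)
    simp only [hper, tsum_mul_left]
    rw [← hf, smul_eq_mul]
    rfl
  -- Summability of the coefficients makes the Fourier series converge pointwise; it is evaluated at
  -- the origin, where all characters equal 1.
  have h := UnitAddTorus.hasSum_mFourier_series_apply_of_summable (f := f) (by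
    rw [show UnitAddTorus.mFourierCoeff f = _ from funext hcoeff]
    exact hsum) (torusProj 0)
  simp only [hcoeff, hf, zero_add, mFourier_torusProj, Pi.zero_apply, Complex.ofReal_zero,
    mul_zero, Finset.sum_const_zero, Complex.exp_zero, smul_eq_mul, mul_one] at h
  exact h

/-! ### A Parseval identity for lattices -/

/-- The correlation `η ↦ ∫ u(ξ) v(ξ + η) dξ`. -/
def correlation (u v : Eucl d → ℂ) (η : Eucl d) : ℂ := ∫ ξ, u ξ * v (ξ + η)

theorem correlation_eq_convolution (u v : Eucl d → ℂ) :
    correlation u v = (fun ξ => u (-ξ)) ⋆[ContinuousLinearMap.mul ℂ ℂ, volume] v := by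
  ext η
  rw [correlation, convolution_def, ← integral_neg_eq_self]
  refine integral_congr_ae (.of_forall fun ξ => ?_)
  simp only [ContinuousLinearMap.mul_apply']
  rw [neg_add_eq_sub]

theorem continuous_correlation (u v : 𝓓(Ω, ℂ)) : Continuous (correlation u v) := by
  rw [correlation_eq_convolution]
  exact v.hasCompactSupport.continuous_convolution_right _
    (u.integrable'.comp_neg).locallyIntegrable v.continuous

theorem hasCompactSupport_correlation (u v : 𝓓(Ω, ℂ)) : HasCompactSupport (correlation u v) := by
  rw [correlation_eq_convolution]
  exact HasCompactSupport.convolution _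
    (u.hasCompactSupport.comp_homeomorph (Homeomorph.neg (Eucl d))) v.hasCompactSupport

theorem fourier_correlation (u v : 𝓓(Ω, ℂ)) (x : Eucl d) :
    𝓕 (correlation u v) x = 𝓕⁻ (u : Eucl d → ℂ) x * 𝓕 (v : Eucl d → ℂ) x := by
  rw [correlation_eq_convolution,
    Real.fourier_bilin_convolution_eq _ u.integrable'.comp_neg v.integrable',
    ContinuousLinearMap.mul_apply', Real.fourierInv_eq_fourier_comp_neg]

namespace GSISystem

variable (G : GSISystem d J)

/-- The linear map `C_j^{-t}`. -/
def dualMap (j : J) : Eucl d →ₗ[ℝ] Eucl d :=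
  Matrix.toEuclideanLin ((G.C j)⁻¹).val.transpose

theorem det_dualMap (j : J) : LinearMap.det (G.dualMap j) = ((G.C j).val.det)⁻¹ := by
  rw [dualMap, toEuclideanLin_det, Matrix.det_transpose, Matrix.coe_units_inv,
    Matrix.det_nonsing_inv, Ring.inverse_eq_inv']

theorem inner_intVec (n : Fin d → ℤ) (y : Eucl d) :
    inner ℝ (intVec n) y = ∑ i, (n i : ℝ) * y i := by
  simp [intVec, PiLp.inner_apply, mul_comm]

theorem inner_latticePoint_dualMap (j : J) (k : Fin d → ℤ) (y : Eucl d) :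
    inner ℝ (G.latticePoint j k) (G.dualMap j y) = inner ℝ (intVec k) y := by
  have h1 : inner ℝ (G.latticePoint j k) (G.dualMap j y) =
      inner ℝ (intVec k) (Matrix.toEuclideanLin (G.C j).val.transpose (G.dualMap j y)) := by
    have h := Matrix.toEuclideanLin_conjTranspose_eq_adjoint (G.C j).val
    rw [Matrix.conjTranspose_eq_transpose_of_trivial] at h
    rw [h, LinearMap.adjoint_inner_right]
    rfl
  rw [h1]
  congr 1
  have h2 : (G.C j).val.transpose * ((G.C j)⁻¹).val.transpose = 1 := by
    rw [← Matrix.transpose_mul, ← Units.val_mul, inv_mul_cancel]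
    simp
  ext i
  simp only [dualMap, Matrix.toLpLin_apply]
  rw [Matrix.mulVec_mulVec, h2, Matrix.one_mulVec]

theorem integral_comp_dualMap (j : J) (F : Eucl d → ℂ) (hF : Continuous F) :
    ∫ y, F (G.dualMap j y) = G.absDet j * ∫ η, F η := by
  have hdet : LinearMap.det (G.dualMap j) ≠ 0 := by
    rw [det_dualMap]
    exact inv_ne_zero (G.det_ne_zero j)
  have h1 := Measure.map_linearMap_addHaar_eq_smul_addHaar (volume : Measure (Eucl d)) hdet
  rw [← integral_map (LinearMap.continuous_of_finiteDimensional _).aemeasurable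
    hF.aestronglyMeasurable, h1, integral_smul_measure, det_dualMap, inv_inv,
    ENNReal.toReal_ofReal (abs_nonneg _)]
  exact Complex.real_smul

theorem integral_toLp (F : Eucl d → ℂ) : ∫ x : Fin d → ℝ, F (WithLp.toLp 2 x) = ∫ y, F y :=
  (PiLp.volume_preserving_toLp (Fin d)).integral_comp
    (MeasurableEquiv.toLp 2 (Fin d → ℝ)).measurableEmbedding F

/-- A Parseval identity, obtained from Poisson's summation formula. -/
theorem hasSum_fourierInv_mul_fourier (j : J) (u v : 𝓓(Ω, ℂ))
    (hsum : Summable fun k => 𝓕⁻ (u : Eucl d → ℂ) (G.latticePoint j k) *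
      𝓕 (v : Eucl d → ℂ) (G.latticePoint j k)) :
    HasSum (fun k => 𝓕⁻ (u : Eucl d → ℂ) (G.latticePoint j k) *
      𝓕 (v : Eucl d → ℂ) (G.latticePoint j k))
      ((G.absDet j : ℂ)⁻¹ * ∑' n, ∫ ξ, u ξ * v (ξ + G.dualMap j (intVec n))) := by
  -- Composition with C_j^{-t} reduces the dual lattice to ℤ^d. The Fourier transform of the
  -- correlation is the product 𝓕⁻u · 𝓕v, and the change of variables contributes the Jacobian |det
  -- C_j|.
  let W : (Fin d → ℝ) → ℂ := fun x => correlation u v (G.dualMap j (WithLp.toLp 2 x))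
  have hD : ((G.absDet j : ℝ) : ℂ) ≠ 0 := Complex.ofReal_ne_zero.2 (G.absDet_pos j).ne'
  have hcd : Continuous (G.dualMap j) := LinearMap.continuous_of_finiteDimensional _
  have hdet : LinearMap.det (G.dualMap j) ≠ 0 := by
    rw [det_dualMap]
    exact inv_ne_zero (G.det_ne_zero j)
  let e : (Fin d → ℝ) ≃ₜ Eucl d := (PiLp.continuousLinearEquiv 2 ℝ (fun _ : Fin d => ℝ)).symm
    |>.toHomeomorph.trans (LinearMap.equivOfDetNeZero (G.dualMap j) hdet
      |>.toContinuousLinearEquiv.toHomeomorph)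
  have hW : Continuous W := (continuous_correlation u v).comp e.continuous
  have hWs : HasCompactSupport W := (hasCompactSupport_correlation u v).comp_homeomorph e
  have hint : ∀ k : Fin d → ℤ, ∫ x : Fin d → ℝ,
      Complex.exp (2 * Real.pi * Complex.I * ∑ i, (-(k i) : ℂ) * x i) * W x =
      G.absDet j * (𝓕⁻ (u : Eucl d → ℂ) (G.latticePoint j k) *
        𝓕 (v : Eucl d → ℂ) (G.latticePoint j k)) := fun k => by
    rw [← fourier_correlation, fourier_eq_integral_planeWave]
    have hcont : Continuous fun η => planeWave (-G.latticePoint j k) η * correlation u v η :=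
      (contDiff_planeWave _).continuous.mul (continuous_correlation u v)
    have hswap : ∀ η, planeWave (-η) (G.latticePoint j k) = planeWave (-G.latticePoint j k) η :=
      fun η => by rw [planeWave_comm, planeWave_neg_right]
    simp only [hswap]
    rw [← G.integral_comp_dualMap j _ hcont, ← integral_toLp]
    refine integral_congr_ae (.of_forall fun x => ?_)
    simp only [W, planeWave, inner_neg_left, inner_latticePoint_dualMap, inner_intVec]
    congr 3
    push_cast
    simp only [neg_mul, Finset.sum_neg_distrib]
  have h := hasSum_fourier_intCastVec hW hWs (by
    simp only [hint]
    exact hsum.mul_left _)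
  simp only [hint] at h
  have h2 := h.mul_left ((G.absDet j : ℝ) : ℂ)⁻¹
  simp only [inv_mul_cancel_left₀ hD] at h2
  exact h2

end GSISystem

end

noncomputable section

variable {d : ℕ} {Ω : Opens (Eucl d)} {I J : Type*} {Q : AdmissibleCover Ω I}

/-! ### The frame operator on Fourier test functions -/

namespace GSISystem

variable (G : GSISystem d J) (Φ : BAPU Q)

theorem contDiff_conj_fourier (j : J) : ContDiff ℝ ∞ fun ξ => conj (𝓕 (G.g j) ξ) :=
  Complex.conjCLE.contDiff.comp (G.contDiff_fourier j)

/-- Only finitely many φ_i meet the support of φ and they sum to 1 there, so the extended product is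
the ordinary one: a sample at C_j k of the inverse transform of φ times the conjugate of ĝ_j. -/
theorem extendedPairing_fourierInv_test (φ : 𝓓(Ω, ℂ)) (j : J) (k : Fin d → ℤ) :
    Φ.extendedPairing (.ofFun Ω (𝓕⁻ (testToSchwartz Ω φ) : 𝓢(Eucl d, ℂ))) (G.atom j k)
        (G.contDiff_fourier_atom j k) =
      𝓕⁻ (φ.mulSmooth _ (G.contDiff_conj_fourier j) : Eucl d → ℂ) (G.latticePoint j k) := by
  obtain ⟨F, hF⟩ := Φ.exists_finset_of_isCompact φ.hasCompactSupport φ.tsupport_subset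
  have hterm : ∀ i, Φ.pairingTerm (.ofFun Ω (𝓕⁻ (testToSchwartz Ω φ) : 𝓢(Eucl d, ℂ)))
      (G.atom j k) (G.contDiff_fourier_atom j k) i =
      ∫ ξ, φ ξ * (conj (Φ.fn i ξ) * conj (𝓕 (G.atom j k) ξ)) := fun i => by
    rw [BAPU.pairingTerm, sesqPairing, FourierDistribution.fourier_ofFun_fourierInv_test]
    simp only [conjTest_apply, TestFunction.mulSmooth_apply, map_mul]
  have hint : ∀ i, Integrable fun ξ => φ ξ * (conj (Φ.fn i ξ) * conj (𝓕 (G.atom j k) ξ)) :=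
    fun i => (φ.mulSmooth _ (conjTest ((Φ.fn i).mulSmooth _
      (G.contDiff_fourier_atom j k))).contDiff).integrable'.congr (.of_forall fun ξ => by
        simp only [conjTest_apply, TestFunction.mulSmooth_apply, map_mul])
  rw [BAPU.extendedPairing, tsum_eq_sum (s := F)]
  · simp only [hterm]
    rw [← integral_finsetSum _ fun i _ => hint i, fourierInv_eq_integral_planeWave]
    refine integral_congr_ae (.of_forall fun ξ => ?_)
    simp only [TestFunction.mulSmooth_apply]
    rw [← Finset.mul_sum, ← Finset.sum_mul, ← map_sum, fourier_atom, map_mul, conj_planeWave,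
      neg_neg]
    by_cases hξ : ξ ∈ tsupport φ
    · rw [Φ.sum_eq_one φ.tsupport_subset hF hξ, map_one]
      ring
    · rw [image_eq_zero_of_notMem_tsupport hξ]
      ring
  · intro i hi
    rw [hterm]
    refine integral_eq_zero_of_ae (.of_forall fun ξ => ?_)
    by_cases hξ : ξ ∈ tsupport φ
    · simp [Φ.fn_eq_zero fun h => Set.disjoint_left.1 (hF i hi) h hξ]
    · simp [image_eq_zero_of_notMem_tsupport hξ]

/-- As a function of k, the value at a fixed x is a sample of a Fourier transform. Coefficient and
atom together have the form required by the Parseval identity. -/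
theorem locAtom_eq_fourier (m : I) (j : J) (k : Fin d → ℤ) (x : Eucl d) :
    G.locAtom Φ m j k x = 𝓕 ((G.genTest Φ m j).mulSmooth (planeWave x) (contDiff_planeWave x) :
      Eucl d → ℂ) (G.latticePoint j k) := by
  rw [fourier_mulSmooth_planeWave]
  rfl

/-- The contribution of the generator `j` and the frequency `α` to the frame operator. -/
def crossTerm (φ : 𝓓(Ω, ℂ)) (m : I) (x : Eucl d) (j : J) (α : Eucl d) : ℂ :=
  ∫ ξ, φ ξ * (planeWave x (ξ + α) * Φ.fn m (ξ + α)) *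
    ((G.absDet j : ℂ)⁻¹ * (conj (𝓕 (G.g j) ξ) * 𝓕 (G.g j) (ξ + α)))

theorem continuous_crossTerm_integrand (φ : 𝓓(Ω, ℂ)) (m : I) (x : Eucl d) (j : J) (α : Eucl d) :
    Continuous fun ξ => φ ξ * (planeWave x (ξ + α) * Φ.fn m (ξ + α)) *
      ((G.absDet j : ℂ)⁻¹ * (conj (𝓕 (G.g j) ξ) * 𝓕 (G.g j) (ξ + α))) :=
  (φ.continuous.mul (((contDiff_planeWave x).continuous.comp (continuous_add_const α)).mul
    ((Φ.fn m).continuous.comp (continuous_add_const α)))).mul (continuous_const.mul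
      ((Complex.continuous_conj.comp (G.continuous_fourier j)).mul
        ((G.continuous_fourier j).comp (continuous_add_const α))))

theorem enorm_crossTerm_integrand (φ : 𝓓(Ω, ℂ)) (m : I) (x : Eucl d) (j : J) (α ξ : Eucl d) :
    ‖φ ξ * (planeWave x (ξ + α) * Φ.fn m (ξ + α)) *
      ((G.absDet j : ℂ)⁻¹ * (conj (𝓕 (G.g j) ξ) * 𝓕 (G.g j) (ξ + α)))‖ₑ =
    ‖φ ξ‖ₑ * ‖Φ.fn m (ξ + α)‖ₑ *
      (ENNReal.ofReal (G.absDet j)⁻¹ * (‖𝓕 (G.g j) ξ‖ₑ * ‖𝓕 (G.g j) (ξ + α)‖ₑ)) := by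
  rw [enorm_mul, G.enorm_t_term, enorm_mul, enorm_mul, enorm_planeWave, one_mul]

theorem enorm_crossTerm_le (φ : 𝓓(Ω, ℂ)) (m : I) (x : Eucl d) (j : J) (α : Eucl d) :
    ‖G.crossTerm Φ φ m x j α‖ₑ ≤ ∫⁻ ξ, ‖φ ξ‖ₑ * ‖Φ.fn m (ξ + α)‖ₑ *
      (ENNReal.ofReal (G.absDet j)⁻¹ * (‖𝓕 (G.g j) ξ‖ₑ * ‖𝓕 (G.g j) (ξ + α)‖ₑ)) :=
  (enorm_integral_le_lintegral_enorm _).trans_eq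
    (lintegral_congr fun ξ => G.enorm_crossTerm_integrand Φ φ m x j α ξ)

/-- Absolute summability over all pairs (j, α) is what legitimizes regrouping by frequency. It is
the α-LIC for the union of the supports of φ and φ_m. -/
theorem AlphaLIC.tsum_enorm_crossTerm_lt_top {G : GSISystem d J} (hG : G.AlphaLIC Ω)
    (φ : 𝓓(Ω, ℂ)) (m : I) (x : Eucl d) :
    ∑' j, ∑' α : G.dualLattice j, ‖G.crossTerm Φ φ m x j α‖ₑ < ⊤ := by
  set K := tsupport φ ∪ tsupport (Φ.fn m) with hK
  have hKc : IsCompact K := φ.hasCompactSupport.union (Φ.fn m).hasCompactSupport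
  have hlt := hG.tsum_lintegral_lt_top hKc
    (Set.union_subset φ.tsupport_subset (Φ.fn m).tsupport_subset)
  set A := eLpNorm (𝓕 (φ : Eucl d → ℂ)) 1 volume
  set A' := eLpNorm (𝓕 (Φ.fn m : Eucl d → ℂ)) 1 volume
  have hA : A < ⊤ := (memLp_one_iff_integrable.2 (integrable_fourier_test φ)).2
  have hA' : A' < ⊤ := (memLp_one_iff_integrable.2 (integrable_fourier_test (Φ.fn m))).2
  refine lt_of_le_of_lt ?_ (ENNReal.mul_lt_top (ENNReal.mul_lt_top hA hA') hlt)
  rw [← ENNReal.tsum_mul_left]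
  refine ENNReal.tsum_le_tsum fun j => ?_
  rw [← mul_assoc, ← ENNReal.tsum_mul_left]
  refine ENNReal.tsum_le_tsum fun α => (G.enorm_crossTerm_le Φ φ m x j α).trans ?_
  rw [← lintegral_const_mul' _ _ (ENNReal.mul_lt_top (ENNReal.mul_lt_top hA hA')
    ENNReal.ofReal_lt_top).ne]
  refine lintegral_mono fun ξ => ?_
  have h1 := enorm_le_indicator (K := K) (ψ := φ) Set.subset_union_left ξ
  have h2 := enorm_le_indicator (K := K) (ψ := Φ.fn m) Set.subset_union_right (ξ + α)
  calc _ ≤ (A * K.indicator 1 ξ) * (A' * K.indicator 1 (ξ + α)) *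
        (ENNReal.ofReal (G.absDet j)⁻¹ * (‖𝓕 (G.g j) ξ‖ₑ * ‖𝓕 (G.g j) (ξ + α)‖ₑ)) := by gcongr
    _ = _ := by ring

/-- Summation over j at fixed α rebuilds t_α under the integral, with the integrable majorant B
|φ_m(·+α) φ|. -/
theorem tsum_crossTerm_eq [Countable J] (φ : 𝓓(Ω, ℂ)) (m : I) (x α : Eucl d) :
    ∑' j : {j : J // α ∈ G.dualLattice j}, G.crossTerm Φ φ m x j α =
      ∫ ξ, φ ξ * (planeWave x (ξ + α) * Φ.fn m (ξ + α)) * G.t α ξ := by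
  obtain ⟨B, hB⟩ := G.exists_tAbs_le
  have hmeas : ∀ j : {j : J // α ∈ G.dualLattice j}, AEStronglyMeasurable
      (fun ξ => φ ξ * (planeWave x (ξ + α) * Φ.fn m (ξ + α)) *
        ((G.absDet j : ℂ)⁻¹ * (conj (𝓕 (G.g j) ξ) * 𝓕 (G.g j) (ξ + α)))) volume := fun j =>
    (G.continuous_crossTerm_integrand Φ φ m x j α).aestronglyMeasurable
  have h := integral_tsum hmeas ?_
  · simp only [crossTerm]
    rw [← h]
    refine integral_congr_ae ?_
    filter_upwards [hB α] with ξ hξ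
    exact ((G.hasSum_t (hξ.trans_lt ENNReal.coe_lt_top)).mul_left _).tsum_eq
  · rw [← lintegral_tsum fun j => (hmeas j).enorm]
    simp only [enorm_crossTerm_integrand, ENNReal.tsum_mul_left]
    refine ne_of_lt (lt_of_le_of_lt (lintegral_mono_ae (g := fun ξ =>
      ‖Φ.fn m (ξ + α) * φ ξ‖ₑ * B) ?_) ?_)
    · filter_upwards [hB α] with ξ hξ
      rw [enorm_mul, mul_comm ‖φ ξ‖ₑ]
      gcongr
      exact hξ
    · rw [lintegral_mul_const' _ _ ENNReal.coe_ne_top]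
      exact ENNReal.mul_lt_top ((Φ.fn m).integrable_comp_add_mul φ α).2 ENNReal.coe_lt_top

theorem injective_intVec : Function.Injective (intVec (d := d)) := by
  intro m n h
  ext i
  have := congrArg (fun v : Eucl d => v i) h
  simpa [intVec] using this

theorem injective_dualMap (j : J) : Function.Injective (G.dualMap j) := by
  refine (LinearMap.equivOfDetNeZero (G.dualMap j) ?_).injective
  rw [det_dualMap]
  exact inv_ne_zero (G.det_ne_zero j)

theorem tsum_dualMap_intVec (j : J) (X : Eucl d → ℂ) :
    ∑' n, X (G.dualMap j (intVec n)) = ∑' α : G.dualLattice j, X α :=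
  (Equiv.ofInjective _ ((G.injective_dualMap j).comp injective_intVec)).tsum_eq
    (fun α : Set.range (G.dualMap j ∘ intVec) => X α)

theorem tsum_dualLattice_eq' (j : J) {X : Eucl d → ℂ}
    (hX : Summable fun α : G.dualLattice j => X α) :
    ∑' α : G.dualLattice j, X α =
      X 0 + ∑' α : {α : Eucl d // α ∈ G.dualLattice j ∧ α ≠ 0}, X α := by
  classical
  have h1 : ∑' α : {α : Eucl d // α ∈ G.dualLattice j ∧ α ≠ 0}, X α =
      ∑' α, {α | α ∈ G.dualLattice j ∧ α ≠ 0}.indicator X α :=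
    tsum_subtype {α | α ∈ G.dualLattice j ∧ α ≠ 0} X
  rw [h1, tsum_subtype (G.dualLattice j) X,
    (summable_subtype_iff_indicator.1 hX).tsum_eq_add_tsum_ite 0,
    Set.indicator_of_mem (G.zero_mem_dualLattice j)]
  congr 1
  refine tsum_congr fun α => ?_
  by_cases h0 : α = 0 <;> by_cases h : α ∈ G.dualLattice j <;> simp [h0, h]

variable {G Φ}

theorem locNorm_lt_top_of_isAdapted {w : I → ℝ} {v : J → ℝ} (hw : ∀ i, 0 < w i)
    (hv : ∀ j, 0 < v j) (hA : G.IsAdapted Φ w v) (i : I) (j : J) : G.locNorm Φ i j < ⊤ := by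
  have h := (le_schurNorm (G.adaptMatrix Φ w v) i j).trans_lt hA
  rw [adaptMatrix_eq] at h
  refine ENNReal.lt_top_of_mul_ne_top_right h.ne (ENNReal.ofReal_pos.2 ?_).ne'
  have h1 := hw i
  have h2 := hv j
  have h3 := G.absDet_pos j
  positivity

/-- The Parseval identity for generator j. The sum over k converges because the coefficients are
bounded and the localized atoms are summable in k, by their amalgam norm. -/
theorem hasSum_frameCoeff_mul_locAtom {j : J} {m : I} (hfin : G.locNorm Φ m j < ⊤)
    (φ : 𝓓(Ω, ℂ)) (x : Eucl d) :
    HasSum (fun k => Φ.extendedPairing (.ofFun Ω (𝓕⁻ (testToSchwartz Ω φ) : 𝓢(Eucl d, ℂ)))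
        (G.atom j k) (G.contDiff_fourier_atom j k) * G.locAtom Φ m j k x)
      (∑' α : G.dualLattice j, G.crossTerm Φ φ m x j α) := by
  simp only [extendedPairing_fourierInv_test, locAtom_eq_fourier]
  have h := G.hasSum_fourierInv_mul_fourier j (φ.mulSmooth _ (G.contDiff_conj_fourier j))
    ((G.genTest Φ m j).mulSmooth (planeWave x) (contDiff_planeWave x)) ?_
  · convert h using 1
    rw [← G.tsum_dualMap_intVec j (G.crossTerm Φ φ m x j), ← tsum_mul_left]
    refine tsum_congr fun n => ?_
    rw [crossTerm, ← integral_const_mul]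
    refine integral_congr_ae (.of_forall fun ξ => ?_)
    simp only [TestFunction.mulSmooth_apply, genTest]
    ring
  · refine Summable.of_norm (tsum_enorm_ne_top_iff_summable_norm.1 (ne_of_lt ?_))
    set u := φ.mulSmooth _ (G.contDiff_conj_fourier j)
    have hu : eLpNorm (u : Eucl d → ℂ) 1 volume < ⊤ :=
      (memLp_one_iff_integrable.2 u.integrable').2
    refine lt_of_le_of_lt ?_ (ENNReal.mul_lt_top hu hfin)
    refine le_trans (ENNReal.tsum_le_tsum fun k => ?_)
      ((ENNReal.tsum_mul_left (a := eLpNorm (u : Eucl d → ℂ) 1 volume)).trans_le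
        (mul_le_mul' le_rfl (G.tsum_locAtom_le Φ m j x)))
    rw [enorm_mul, locAtom_eq_fourier]
    gcongr
    exact norm_fourierInv_le_lintegral _ _

/-- The frame operator on Fourier test functions. -/
theorem frame_eq_multiplier_add_remainder [Countable J] (hG : G.AlphaLIC Ω)
    (ht : Φ.IsTame (G.t 0)) (hfin : ∀ m j, G.locNorm Φ m j < ⊤) (φ : 𝓓(Ω, ℂ))
    {s t₀ : FourierDistribution Ω}
    (hs : HasSum (G.frameTerm Φ
      (.ofFun Ω (𝓕⁻ (testToSchwartz Ω φ) : 𝓢(Eucl d, ℂ)))) s)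
    (ht₀ : HasSum (Φ.multiplierTerm (G.t 0)
      (.ofFun Ω (𝓕⁻ (testToSchwartz Ω φ) : 𝓢(Eucl d, ℂ)))) t₀) :
    s = t₀ + G.remainder Ω (𝓕⁻ (testToSchwartz Ω φ)) := by
  refine Φ.fourier_injective_of_piece fun m => .of_forall fun x => ?_
  change Φ.piece s m x = Φ.piece t₀ m x + Φ.piece (G.remainder Ω (𝓕⁻ (testToSchwartz Ω φ))) m x
  have hcross := hG.tsum_enorm_crossTerm_lt_top Φ φ m x
  have hcrossj : ∀ j, Summable fun α : G.dualLattice j => G.crossTerm Φ φ m x j α := fun j =>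
    Summable.of_norm (tsum_enorm_ne_top_iff_summable_norm.1
      (((ENNReal.le_tsum j).trans_lt hcross).ne))
  -- Unconditional summability over (j, k) permits summing over k first, for each j, and applying
  -- the Parseval identity there.
  have h1 : HasSum (fun j => ∑' α : G.dualLattice j, G.crossTerm Φ φ m x j α)
      (Φ.piece s m x) := by
    have h := Φ.hasSum_piece hs m x
    rw [show (fun jk => Φ.piece (G.frameTerm Φ _ jk) m x) = _ from
      funext fun jk : J × (Fin d → ℤ) => G.piece_frameTerm Φ _ m jk.1 jk.2 x] at h
    exact h.prod_fiberwise fun j => hasSum_frameCoeff_mul_locAtom (hfin m j) φ x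
  have hsplit : ∀ j, ∑' α : G.dualLattice j, G.crossTerm Φ φ m x j α =
      G.crossTerm Φ φ m x j 0 + ∑' α : {α : Eucl d // α ∈ G.dualLattice j ∧ α ≠ 0},
        G.crossTerm Φ φ m x j α := fun j => G.tsum_dualLattice_eq' j (hcrossj j)
  have hzero : ∑' j, G.crossTerm Φ φ m x j 0 = Φ.piece t₀ m x := by
    rw [ht.piece_multiplier_fourierInv_test φ ht₀]
    have h := G.tsum_crossTerm_eq Φ φ m x 0
    have h0 := (Equiv.subtypeUnivEquiv (fun j => G.zero_mem_dualLattice j)).tsum_eq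
      (fun j => G.crossTerm Φ φ m x j 0)
    rw [← h0]
    refine h.trans (integral_congr_ae (.of_forall fun ξ => ?_))
    simp only [add_zero]
    ring
  have hnz : ∑' p : (j : J) × {α : Eucl d // α ∈ G.dualLattice j ∧ α ≠ 0},
      ‖G.crossTerm Φ φ m x p.1 p.2‖ₑ < ⊤ := by
    rw [ENNReal.tsum_sigma' (fun p : (j : J) × {α : Eucl d // α ∈ G.dualLattice j ∧ α ≠ 0} =>
      ‖G.crossTerm Φ φ m x p.1 p.2‖ₑ)]
    refine lt_of_le_of_lt (ENNReal.tsum_le_tsum fun j => ?_) hcross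
    rw [G.tsum_dualLattice_eq j (fun α => ‖G.crossTerm Φ φ m x j α‖ₑ)]
    exact le_add_self
  have hsum : Summable fun p : (j : J) × {α : Eucl d // α ∈ G.dualLattice j ∧ α ≠ 0} =>
      G.crossTerm Φ φ m x p.1 p.2 :=
    Summable.of_norm (tsum_enorm_ne_top_iff_summable_norm.1 hnz.ne)
  -- The nonzero frequencies are regrouped: pairs (j, α) with α in the j-th dual lattice are the
  -- same as frequencies α together with an admissible j.
  have hrem : ∑' j, ∑' α : {α : Eucl d // α ∈ G.dualLattice j ∧ α ≠ 0},
      G.crossTerm Φ φ m x j α = Φ.piece (G.remainder Ω (𝓕⁻ (testToSchwartz Ω φ))) m x := by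
    obtain ⟨L, hL⟩ := exists_hasSum_remainderTerm hG φ
    rw [BAPU.piece, remainder, hL.tsum_eq, FourierDistribution.fourier_fourierInv,
      ← (hasSum_weakDual_iff.1 hL _).tsum_eq]
    let e : ((α : {α : Eucl d // α ∈ G.frequencies ∧ α ≠ 0}) ×
        {j : J // (α : Eucl d) ∈ G.dualLattice j}) ≃
        ((j : J) × {α : Eucl d // α ∈ G.dualLattice j ∧ α ≠ 0}) :=
      { toFun := fun p => ⟨p.2, ⟨p.1, p.2.2, p.1.2.2⟩⟩
        invFun := fun p => ⟨⟨p.2, Set.mem_iUnion.2 ⟨p.1, p.2.2.1⟩, p.2.2.2⟩, ⟨p.1, p.2.2.1⟩⟩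
        left_inv := fun p => rfl
        right_inv := fun p => rfl }
    have h2 := (e.summable_iff.2 hsum).tsum_sigma
    have h3 := e.tsum_eq (fun p : (j : J) × {α : Eucl d // α ∈ G.dualLattice j ∧ α ≠ 0} =>
      G.crossTerm Φ φ m x p.1 p.2)
    refine (hsum.tsum_sigma.symm.trans (h3.symm.trans h2)).trans ?_
    refine tsum_congr fun α => ?_
    rw [remainderTerm_apply]
    refine (G.tsum_crossTerm_eq Φ φ m x α).trans (integral_congr_ae (.of_forall fun ξ => ?_))
    simp only [TestFunction.mulSmooth_apply]
    ring
  have hs0 : Summable fun j => G.crossTerm Φ φ m x j 0 := by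
    refine Summable.of_norm (tsum_enorm_ne_top_iff_summable_norm.1 (lt_of_le_of_lt
      (ENNReal.tsum_le_tsum fun j => ?_) hcross).ne)
    exact ENNReal.le_tsum (f := fun α : G.dualLattice j => ‖G.crossTerm Φ φ m x j α‖ₑ)
      ⟨0, G.zero_mem_dualLattice j⟩
  rw [← h1.tsum_eq, ← hzero, ← hrem]
  simp only [hsplit]
  exact hs0.tsum_add hsum.sigma

end GSISystem

end

noncomputable section

variable {d : ℕ} {Ω : Opens (Eucl d)} {I J : Type*} {Q : AdmissibleCover Ω I}

/-! ### Approximation by functions with Fourier transform in `C_c^∞` -/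

/-- A normalized bump function as a Schwartz function. -/
def ContDiffBump.toSchwartz (b : ContDiffBump (0 : Eucl d)) : 𝓢(Eucl d, ℂ) :=
  HasCompactSupport.toSchwartzMap (f := fun y => (b.normed volume y : ℂ))
    (b.hasCompactSupport_normed.comp_left Complex.ofReal_zero)
    (Complex.ofRealCLM.contDiff.comp b.contDiff_normed)

namespace ContDiffBump

variable (b : ContDiffBump (0 : Eucl d))

theorem toSchwartz_apply (y : Eucl d) : b.toSchwartz y = (b.normed volume y : ℂ) := rfl

theorem toSchwartz_eq_zero {y : Eucl d} (h : b.rOut < ‖y‖) : b.toSchwartz y = 0 := by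
  rw [toSchwartz_apply, Complex.ofReal_eq_zero, ← Function.notMem_support, b.support_normed_eq]
  simpa using h.le

theorem norm_fourier_toSchwartz_le (x : Eucl d) : ‖𝓕 (b.toSchwartz : Eucl d → ℂ) x‖ₑ ≤ 1 := by
  refine (norm_fourier_le_lintegral _ x).trans (le_of_eq ?_)
  have h : ∀ y, ‖b.toSchwartz y‖ = b.normed volume y := fun y => by
    rw [toSchwartz_apply, Complex.norm_real, Real.norm_of_nonneg (b.nonneg_normed y)]
  rw [eLpNorm_one_eq_lintegral_enorm, ← ofReal_integral_norm_eq_lintegral_enorm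
    b.toSchwartz.integrable]
  simp only [h, b.integral_normed, ENNReal.ofReal_one]

/-- The value at x is the mean of a plane wave over a shrinking bump at the origin, so it tends to
the value 1 there. -/
theorem tendsto_fourier_toSchwartz {b : ℕ → ContDiffBump (0 : Eucl d)}
    (hb : Filter.Tendsto (fun n => (b n).rOut) .atTop (nhds 0)) (x : Eucl d) :
    Filter.Tendsto (fun n => 𝓕 ((b n).toSchwartz : Eucl d → ℂ) x) .atTop (nhds 1) := by
  have h := ContDiffBump.convolution_tendsto_right_of_continuous (μ := volume) hb
    (contDiff_planeWave x).continuous 0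
  convert h using 1
  · ext n
    rw [fourier_eq_integral_planeWave, convolution]
    refine integral_congr_ae (.of_forall fun y => ?_)
    simp only [toSchwartz_apply, ContinuousLinearMap.lsmul_apply, zero_sub, planeWave_neg_right,
      Complex.real_smul, planeWave_comm (-y)]
    rw [mul_comm, ← planeWave_neg_right, planeWave_comm]
  · simp [planeWave]

/-- The Fourier transform of a translated bump function is a modulated Fourier transform. -/
theorem exists_fourier_translate (ξ : Eucl d) : ∃ u : 𝓢(Eucl d, ℂ),
    (∀ x, u x = planeWave (-x) ξ * 𝓕 (b.toSchwartz : Eucl d → ℂ) x) ∧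
      ∀ y, 𝓕⁻ (u : Eucl d → ℂ) y = b.toSchwartz (y - ξ) := by
  have hc : HasCompactSupport fun y => b.toSchwartz (y - ξ) :=
    (b.hasCompactSupport_normed.comp_left (g := ((↑) : ℝ → ℂ)) Complex.ofReal_zero).comp_homeomorph
      (Homeomorph.subRight ξ)
  have hs : ContDiff ℝ ∞ fun y => b.toSchwartz (y - ξ) :=
    (b.toSchwartz.smooth ⊤).comp (contDiff_id.sub contDiff_const)
  refine ⟨𝓕 (hc.toSchwartzMap hs), fun x => ?_, fun y => ?_⟩
  · rw [SchwartzMap.fourier_coe, fourier_eq_integral_planeWave, fourier_eq_integral_planeWave,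
      ← integral_const_mul, ← integral_add_right_eq_self _ ξ]
    refine integral_congr_ae (.of_forall fun y => ?_)
    change planeWave (-(y + ξ)) x * b.toSchwartz (y + ξ - ξ) =
      planeWave (-x) ξ * (planeWave (-y) x * b.toSchwartz y)
    rw [add_sub_cancel_right, neg_add, planeWave_add_left, planeWave_comm (-ξ),
      planeWave_neg_right]
    ring
  · rw [← SchwartzMap.fourierInv_coe, FourierTransform.fourierInv_fourier_eq]
    rfl

end ContDiffBump

theorem DistributionOn.integrable_pow_mul_locFn_mul (T : DistributionOn Ω) (χ : 𝓓(Ω, ℂ))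
    (u : 𝓢(Eucl d, ℂ)) (n : ℕ) : Integrable (fun x => ‖x‖ ^ n * ‖T.locFn χ x * u x‖) := by
  obtain ⟨C, m, hC0, hC⟩ := T.exists_norm_locFn_le χ
  refine ((u.integrable_one_add_norm_pow_mul (n + m)).const_mul C).mono'
    (((continuous_norm.pow n).mul
      ((T.continuous_locFn χ).mul u.continuous).norm).aestronglyMeasurable) (.of_forall fun x => ?_)
  rw [Real.norm_of_nonneg (by positivity), norm_mul, pow_add]
  calc ‖x‖ ^ n * (‖T.locFn χ x‖ * ‖u x‖)
      ≤ (1 + ‖x‖) ^ n * ((C * (1 + ‖x‖) ^ m) * ‖u x‖) := by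
        gcongr
        · linarith
        · exact hC x
    _ = _ := by ring

/-- Multiplying 𝓕⁻(χT) by 𝓕b mollifies χT in frequency: the Fourier transform of the product at ξ is
T(χ b(·−ξ)). It vanishes once ξ is farther than the bump radius from supp χ, and it is smooth since
all moments of the product are finite. -/
theorem DistributionOn.exists_mollification (T : DistributionOn Ω) (χ : 𝓓(Ω, ℂ))
    (b : ContDiffBump (0 : Eucl d)) (hb : Metric.cthickening b.rOut (tsupport χ) ⊆ Ω) :
    ∃ h : 𝓓(Ω, ℂ), (∀ ξ, h ξ ≠ 0 → ξ ∈ Metric.cthickening b.rOut (tsupport χ)) ∧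
      ∀ ψ : 𝓓(Ω, ℂ), ∫ ξ, h ξ * ψ ξ =
        ∫ x, T.locFn χ x * 𝓕 (b.toSchwartz : Eucl d → ℂ) x * 𝓕 (ψ : Eucl d → ℂ) x := by
  let η : 𝓢(Eucl d, ℂ) := 𝓕 b.toSchwartz
  have hη : ∀ x, η x = 𝓕 (b.toSchwartz : Eucl d → ℂ) x := fun x => by
    rw [← SchwartzMap.fourier_coe]
  let F : Eucl d → ℂ := fun x => T.locFn χ x * η x
  have hF : Integrable F := T.integrable_locFn_mul χ η
  have hsupp : ∀ ξ, 𝓕 F ξ ≠ 0 → ξ ∈ Metric.cthickening b.rOut (tsupport χ) := by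
    intro ξ hξ
    by_contra hn
    refine hξ ?_
    obtain ⟨u, hu, hu'⟩ := b.exists_fourier_translate ξ
    rw [fourier_eq_integral_planeWave]
    have h1 : ∀ x, planeWave (-x) ξ * F x = T.locFn χ x * u x := fun x => by
      rw [hu, ← hη]
      ring
    simp only [h1]
    rw [T.integral_locFn_mul χ u]
    have h2 : χ.mulSmooth (𝓕⁻ (u : Eucl d → ℂ)) (contDiff_fourierInv_schwartz u) = 0 := by
      ext y
      rw [TestFunction.mulSmooth_apply, hu']
      change _ = (0 : ℂ)
      by_cases hy : y ∈ tsupport χ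
      · rw [b.toSchwartz_eq_zero, mul_zero]
        by_contra hle
        refine hn (Metric.mem_cthickening_of_dist_le ξ y _ _ hy ?_)
        rw [dist_comm, dist_eq_norm]
        exact not_lt.1 hle
      · rw [image_eq_zero_of_notMem_tsupport hy, zero_mul]
    rw [h2, map_zero]
  have hK : IsCompact (Metric.cthickening b.rOut (tsupport χ)) := χ.hasCompactSupport.cthickening
  have hts : tsupport (𝓕 F) ⊆ Metric.cthickening b.rOut (tsupport χ) :=
    closure_minimal hsupp Metric.isClosed_cthickening
  let h : 𝓓(Ω, ℂ) :=
    { toFun := 𝓕 F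
      contDiff' := Real.contDiff_fourier fun n _ => T.integrable_pow_mul_locFn_mul χ η n
      hasCompactSupport' := hK.of_isClosed_subset (isClosed_tsupport _) hts
      tsupport_subset' := hts.trans hb }
  refine ⟨h, hsupp, fun ψ => ?_⟩
  refine (integral_fourier_mul_eq_flip hF ψ.integrable').trans ?_
  simp only [F, hη]

theorem eLpNorm_finsetSum_enorm_le {ι X : Type*} [MeasurableSpace X] {μ : Measure X} {p : ℝ≥0∞}
    (hp : 1 ≤ p) {s : Finset ι} {a : ι → X → ℝ≥0∞} (ha : ∀ i, Measurable (a i)) :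
    eLpNorm (fun x => ∑ i ∈ s, a i x) p μ ≤ ∑ i ∈ s, eLpNorm (a i) p μ := by
  have := eLpNorm_sum_le (f := a) (s := s) (μ := μ)
    (fun i _ => (ha i).aestronglyMeasurable) hp
  rwa [show (∑ i ∈ s, a i) = fun x => ∑ i ∈ s, a i x from
    funext fun x => Finset.sum_apply x s a] at this

theorem sum_biUnion_le_sum_sum {ι κ : Type*} [DecidableEq κ] (s : Finset ι) (t : ι → Finset κ)
    (a : κ → ℝ≥0∞) : ∑ i ∈ s.biUnion t, a i ≤ ∑ l ∈ s, ∑ i ∈ t l, a i := by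
  classical
  induction s using Finset.induction_on with
  | empty => simp
  | insert l s hl ih =>
    rw [Finset.biUnion_insert, Finset.sum_insert hl]
    calc _ ≤ ∑ i ∈ t l, a i + ∑ i ∈ s.biUnion t, a i := by
          rw [← Finset.sum_union_inter]
          exact le_self_add
      _ ≤ _ := add_le_add le_rfl ih

namespace BAPU

variable (Φ : BAPU Q)

/-- By continuity φ_i^* = 1 also on the closed support of φ_i. So the compact support has positive
distance room inside the open set {φ_i^* ≠ 0}, and slightly mollified pieces stay in the
neighbouring sets although the Q_i need not be open. -/
theorem exists_cthickening_subset (i : I) :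
    ∃ ε > 0, Metric.cthickening ε (tsupport (Φ.fn i)) ⊆ Function.support (Φ.star i) := by
  refine (Φ.fn i).hasCompactSupport.exists_cthickening_subset_open
    (Φ.star i).continuous.isOpen_support fun ξ hξ => ?_
  have hcl : IsClosed {ξ | Φ.star i ξ = 1} :=
    isClosed_eq (Φ.star i).continuous continuous_const
  have hsub : tsupport (Φ.fn i) ⊆ {ξ | Φ.star i ξ = 1} := by
    refine closure_minimal (fun ξ hξ => ?_) hcl
    change Φ.star i ξ = 1
    rw [star_apply]
    refine Φ.sum_neighbors_eq_one ?_
    by_contra hn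
    exact hξ (Φ.fn_eq_zero hn)
  have h1 : Φ.star i ξ = 1 := hsub hξ
  rw [Function.mem_support, h1]
  exact one_ne_zero

/-- Bound for the pieces of the approximations of `f`. -/
def approxBound (f : FourierDistribution Ω) (m : I) (x : Eucl d) : ℝ≥0∞ :=
  ∫⁻ y, ‖𝓕⁻ (Φ.fn m : Eucl d → ℂ) (x - y)‖ₑ *
    ∑ l ∈ Q.neighbors m, ∑ i ∈ Q.neighbors l, ‖Φ.piece f i y‖ₑ

/-- Each φ_i f̂ is mollified at a radius of at most 1/(n+1), and the results are summed over finite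
sets exhausting I. In space, mollifying multiplies the i-th piece by a factor of modulus at most 1
that tends to 1, which yields both the majorant and, by dominated convergence, the limit. -/
theorem exists_approximation (f : FourierDistribution Ω) : ∃ φ : ℕ → 𝓓(Ω, ℂ),
    (∀ n m x, ‖Φ.piece (.ofFun Ω (𝓕⁻ (testToSchwartz Ω (φ n)) : 𝓢(Eucl d, ℂ))) m x‖ₑ ≤
      Φ.approxBound f m x) ∧
    ∀ ψ : 𝓓(Ω, ℂ), Filter.Tendsto (fun n => (FourierDistribution.ofFun Ω
      (𝓕⁻ (testToSchwartz Ω (φ n)) : 𝓢(Eucl d, ℂ))).fourier ψ) .atTop (nhds (f.fourier ψ)) := by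
  classical
  have := Φ.countable_index
  -- Countability of I provides a sequence, rather than a net, of finite sets; this is needed for
  -- Fatou and dominated convergence.
  obtain ⟨F, hF⟩ := Filter.exists_seq_tendsto (Filter.atTop : Filter (Finset I))
  choose ε hε0 hε using Φ.exists_cthickening_subset
  have hr : ∀ (n : ℕ) i, 0 < min (ε i) (1 / ((n : ℝ) + 1)) := fun n i =>
    lt_min (hε0 i) (by positivity)
  let b : ℕ → I → ContDiffBump (0 : Eucl d) := fun n i =>
    ⟨min (ε i) (1 / ((n : ℝ) + 1)) / 2, min (ε i) (1 / ((n : ℝ) + 1)), half_pos (hr n i),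
      half_lt_self (hr n i)⟩
  have hsub : ∀ n i, Metric.cthickening (b n i).rOut (tsupport (Φ.fn i)) ⊆
      Function.support (Φ.star i) := fun n i =>
    (Metric.cthickening_mono (min_le_left _ _) _).trans (hε i)
  have hb0 : ∀ i, Filter.Tendsto (fun n => (b n i).rOut) .atTop (nhds 0) := fun i =>
    squeeze_zero (fun n => (hr n i).le) (fun n => min_le_right _ _)
      tendsto_one_div_add_atTop_nhds_zero_nat
  choose h hsupp hint using fun n i => f.fourier.exists_mollification (Φ.fn i) (b n i)
    ((hsub n i).trans ((subset_tsupport _).trans (Φ.star i).tsupport_subset))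
  have hne : ∀ n i ξ, h n i ξ ≠ 0 → ∃ l ∈ Q.neighbors i, ξ ∈ Q.carrier l := by
    intro n i ξ hξ
    have h1 : Φ.star i ξ ≠ 0 := hsub n i (hsupp n i ξ hξ)
    rw [star_apply] at h1
    obtain ⟨l, hl, hl0⟩ := Finset.exists_ne_zero_of_sum_ne_zero h1
    exact ⟨l, hl, by_contra fun hn => hl0 (Φ.fn_eq_zero hn)⟩
  have hkey : ∀ n (ψ : 𝓓(Ω, ℂ)), (FourierDistribution.ofFun Ω
      (𝓕⁻ (testToSchwartz Ω (∑ i ∈ F n, h n i)) : 𝓢(Eucl d, ℂ))).fourier ψ =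
      ∑ i ∈ F n, ∫ ξ, h n i ξ * ψ ξ := by
    intro n ψ
    rw [FourierDistribution.fourier_ofFun_fourierInv_test, ← integral_finsetSum]
    · simp only [TestFunction.sum_apply, Finset.sum_mul]
    · exact fun i _ => ((h n i).mulSmooth ψ ψ.contDiff).integrable'
  refine ⟨fun n => ∑ i ∈ F n, h n i, fun n m x => ?_, fun ψ => ?_⟩
  · rw [piece, hkey]
    -- The i-th mollified piece lives on sets Q_l with l ∈ i^*; it can meet Q_m only if such an l is
    -- also a neighbour of m. Hence two neighbour steps in the majorant.
    have hW : ∀ i ∈ F n, ‖∫ ξ, h n i ξ *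
        ((Φ.fn m).mulSmooth (planeWave x) (contDiff_planeWave x)) ξ‖ₑ ≠ 0 →
        i ∈ (Q.neighbors m).biUnion Q.neighbors := by
      intro i _ hi
      by_contra hW
      refine hi ?_
      rw [enorm_eq_zero]
      refine integral_eq_zero_of_ae (.of_forall fun ξ => ?_)
      change h n i ξ * (Φ.fn m ξ * planeWave x ξ) = 0
      by_contra h0
      have h1 := mul_ne_zero_iff.1 h0
      obtain ⟨l, hl, hξl⟩ := hne n i ξ h1.1
      have hξm : ξ ∈ Q.carrier m :=
        by_contra fun hn => (mul_ne_zero_iff.1 h1.2).1 (Φ.fn_eq_zero hn)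
      exact hW (Finset.mem_biUnion.2 ⟨l, AdmissibleCover.mem_neighbors.2 ⟨ξ, hξl, hξm⟩,
        AdmissibleCover.mem_neighbors_comm.1 hl⟩)
    calc ‖∑ i ∈ F n, ∫ ξ, h n i ξ *
          ((Φ.fn m).mulSmooth (planeWave x) (contDiff_planeWave x)) ξ‖ₑ
        ≤ ∑ i ∈ F n, ‖∫ ξ, h n i ξ *
          ((Φ.fn m).mulSmooth (planeWave x) (contDiff_planeWave x)) ξ‖ₑ := enorm_sum_le _ _
      _ ≤ ∑ i ∈ (Q.neighbors m).biUnion Q.neighbors, ‖∫ ξ, h n i ξ *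
          ((Φ.fn m).mulSmooth (planeWave x) (contDiff_planeWave x)) ξ‖ₑ :=
        Finset.sum_le_sum_of_ne_zero hW
      _ ≤ ∑ i ∈ (Q.neighbors m).biUnion Q.neighbors,
          ∫⁻ y, ‖𝓕⁻ (Φ.fn m : Eucl d → ℂ) (x - y)‖ₑ * ‖Φ.piece f i y‖ₑ := by
        refine Finset.sum_le_sum fun i _ => ?_
        rw [hint]
        refine (enorm_integral_le_lintegral_enorm _).trans (lintegral_mono fun y => ?_)
        rw [fourier_mulSmooth_planeWave, enorm_mul, enorm_mul, mul_comm ‖f.fourier.locFn _ y‖ₑ,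
          mul_assoc, mul_comm ‖f.fourier.locFn _ y‖ₑ]
        exact (mul_le_mul' ((b n i).norm_fourier_toSchwartz_le y) le_rfl).trans (one_mul _).le
      _ = ∫⁻ y, ∑ i ∈ (Q.neighbors m).biUnion Q.neighbors,
          ‖𝓕⁻ (Φ.fn m : Eucl d → ℂ) (x - y)‖ₑ * ‖Φ.piece f i y‖ₑ := by
        refine (lintegral_finsetSum _ fun i _ => ?_).symm
        exact ((Φ.measurable_enorm_fourierInv_fn m).comp (measurable_const.sub measurable_id)).mul
          (Φ.continuous_piece f i).enorm.measurable
      _ ≤ Φ.approxBound f m x := by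
        refine lintegral_mono fun y => ?_
        rw [← Finset.mul_sum]
        gcongr
        exact sum_biUnion_le_sum_sum _ _ _
  · obtain ⟨F₀, hF₀⟩ := Φ.exists_finset_of_isCompact ψ.hasCompactSupport ψ.tsupport_subset
    have hFW : F₀ ⊆ F₀.biUnion Q.neighbors := fun i hi =>
      Finset.mem_biUnion.2 ⟨i, hi, AdmissibleCover.mem_neighbors_self i⟩
    rw [Φ.fourier_apply_eq_sum f (F := F₀.biUnion Q.neighbors)
      fun i hi => hF₀ i fun h => hi (hFW h)]
    have hlim : Filter.Tendsto (fun n => ∑ i ∈ F₀.biUnion Q.neighbors, ∫ ξ, h n i ξ * ψ ξ)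
        .atTop (nhds (∑ i ∈ F₀.biUnion Q.neighbors,
          ∫ x, Φ.piece f i x * 𝓕 (ψ : Eucl d → ℂ) x)) := by
      refine tendsto_finsetSum _ fun i _ => ?_
      simp only [hint]
      refine tendsto_integral_of_dominated_convergence
        (fun x => ‖Φ.piece f i x * 𝓕 (ψ : Eucl d → ℂ) x‖) (fun n => ?_)
        (f.fourier.integrable_locFn_mul_fourier (Φ.fn i) ψ).norm (fun n => .of_forall fun x => ?_)
        (.of_forall fun x => ?_)
      · refine Continuous.aestronglyMeasurable ?_
        exact ((f.fourier.continuous_locFn _).mul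
          (continuous_fourier (b n i).toSchwartz.integrable)).mul (continuous_fourier_test ψ)
      · rw [norm_mul, norm_mul, norm_mul]
        have h1 : ‖𝓕 ((b n i).toSchwartz : Eucl d → ℂ) x‖ ≤ 1 := by
          have := (b n i).norm_fourier_toSchwartz_le x
          rwa [← ofReal_norm, ENNReal.ofReal_le_one] at this
        gcongr
        exact mul_le_of_le_one_right (norm_nonneg _) h1
      · have h1 := ContDiffBump.tendsto_fourier_toSchwartz (hb0 i) x
        have h2 := (h1.const_mul (Φ.piece f i x)).mul_const (𝓕 (ψ : Eucl d → ℂ) x)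
        rw [mul_one] at h2
        exact h2
    -- As soon as F_n contains all neighbours of indices meeting supp ψ, the further terms have
    -- support disjoint from that of ψ.
    refine hlim.congr' ?_
    filter_upwards [hF.eventually_ge_atTop (F₀.biUnion Q.neighbors)] with n hn
    rw [hkey]
    refine Finset.sum_subset hn fun i _ hi => ?_
    refine integral_eq_zero_of_ae (.of_forall fun ξ => ?_)
    change h n i ξ * ψ ξ = 0
    by_contra h0
    have h1 := mul_ne_zero_iff.1 h0
    obtain ⟨l, hl, hξl⟩ := hne n i ξ h1.1
    refine hi (Finset.mem_biUnion.2 ⟨l, ?_, AdmissibleCover.mem_neighbors_comm.1 hl⟩)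
    by_contra hn
    exact Set.disjoint_left.1 (hF₀ l hn) hξl (subset_tsupport _ h1.2)

theorem measurable_approxBound (f : FourierDistribution Ω) (m : I) :
    Measurable (Φ.approxBound f m) :=
  measurable_lintegral_sub (Φ.measurable_enorm_fourierInv_fn m)
    (Finset.measurable_sum _ fun _ _ => Finset.measurable_sum _ fun i _ =>
      (Φ.continuous_piece f i).enorm.measurable)

/-- The source of the constant for infinite exponents: C_Φ comes from convolution with φ̌_m, and
‖Γ‖² from the two neighbour steps. -/
theorem ellNorm_approxBound_le {p q : ℝ≥0∞} (hp : 1 ≤ p) (hq : 1 ≤ q) {w : I → ℝ}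
    (hw : Q.IsModerate w) {f : FourierDistribution Ω} (hf : Φ.decompositionNorm p q w f < ⊤) :
    ellNorm q w (fun m => eLpNorm (Φ.approxBound f m) p volume) ≤
      Φ.const * Q.clusteringNorm w q ^ 2 * Φ.decompositionNorm p q w f := by
  have := Φ.countable_index
  have hm : ∀ l, Measurable fun y => ∑ i ∈ Q.neighbors l, ‖Φ.piece f i y‖ₑ := fun l =>
    Finset.measurable_sum _ fun i _ => (Φ.continuous_piece f i).enorm.measurable
  have h1 := Q.ellNorm_sum_neighbors_le hq hw.1 hf
  have hΓ := Q.clusteringNorm_lt_top hq hw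
  have h2 := Q.ellNorm_sum_neighbors_le hq hw.1 (h1.trans_lt (ENNReal.mul_lt_top hΓ hf))
  calc ellNorm q w (fun m => eLpNorm (Φ.approxBound f m) p volume)
      ≤ ellNorm q w (fun m => Φ.const * ∑ l ∈ Q.neighbors m, ∑ i ∈ Q.neighbors l,
          eLpNorm (Φ.piece f i) p volume) := by
        refine ellNorm_mono q w fun m => ?_
        refine (eLpNorm_lintegral_sub_le (Φ.measurable_enorm_fourierInv_fn m)
          (Finset.measurable_sum _ fun l _ => hm l) hp).trans (mul_le_mul' ?_ ?_)
        · rw [← eLpNorm_one_eq_lintegral_enorm]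
          exact le_iSup (fun i => eLpNorm (𝓕⁻ (Φ.fn i : Eucl d → ℂ)) 1 volume) m
        · refine (eLpNorm_finsetSum_enorm_le hp fun l => hm l).trans
            (Finset.sum_le_sum fun l _ => ?_)
          refine (eLpNorm_finsetSum_enorm_le hp fun i =>
            (Φ.continuous_piece f i).enorm.measurable).trans (le_of_eq ?_)
          simp only [eLpNorm_enorm]
    _ ≤ Φ.const * (Q.clusteringNorm w q * (Q.clusteringNorm w q *
          Φ.decompositionNorm p q w f)) := by
        rw [ellNorm_const_mul q hq]
        gcongr
        exact h2.trans (mul_le_mul' le_rfl h1)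
    _ = _ := by ring

end BAPU

end

noncomputable section

variable {d : ℕ} {Ω : Opens (Eucl d)} {I J : Type*} {Q : AdmissibleCover Ω I}

/-! ### Limits of mixed norms -/

open Filter in
-- Fatou's lemma for p < ∞, where powers commute with the limes inferior because they are order
-- isomorphisms. For p = ∞, any bound above the limes inferior is undercut infinitely often.
theorem eLpNorm_le_liminf {X : Type*} [MeasurableSpace X] {μ : Measure X} {p : ℝ≥0∞} (hp : 1 ≤ p)
    {F : ℕ → X → ℝ≥0∞} (hF : ∀ n, Measurable (F n)) {f : X → ℝ≥0∞}
    (h : ∀ᵐ x ∂μ, f x ≤ liminf (fun n => F n x) atTop) :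
    eLpNorm f p μ ≤ liminf (fun n => eLpNorm (F n) p μ) atTop := by
  rcases eq_or_ne p ⊤ with rfl | hpt
  · simp only [eLpNorm_exponent_top]
    refine le_of_forall_gt_imp_ge_of_dense fun c hc => ?_
    have hfr : ∃ᶠ n in atTop, eLpNormEssSup (F n) μ < c := frequently_lt_of_liminf_lt (by
      isBoundedDefault) hc
    refine essSup_le_of_ae_le _ ?_
    filter_upwards [h, ae_all_iff.2 fun n => enorm_ae_le_eLpNormEssSup (F n) μ] with x hx hx'
    refine hx.trans (liminf_le_of_frequently_le (hfr.mono fun n hn => (hx' n).trans hn.le))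
  · have hp0 : 0 < p.toReal := ENNReal.toReal_pos (by positivity) hpt
    have hiso : ∀ {r : ℝ}, 0 < r → ∀ u : ℕ → ℝ≥0∞,
        (liminf u atTop) ^ r = liminf (fun n => u n ^ r) atTop := by
      intro r hr u
      refine ((ENNReal.strictMono_rpow_of_pos hr).orderIsoOfSurjective _
        (ENNReal.rpow_left_bijective hr.ne').2).liminf_apply ?_ ?_ ?_ ?_
      all_goals isBoundedDefault
    simp only [eLpNorm_eq_lintegral_rpow_enorm_toReal (by positivity : p ≠ 0) hpt, enorm_eq_self]
    rw [← hiso (by positivity)]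
    gcongr
    refine (lintegral_mono_ae ?_).trans (lintegral_liminf_le fun n => (hF n).pow_const _)
    filter_upwards [h] with x hx
    rw [← hiso hp0]
    gcongr

theorem tendsto_eLpNorm_of_dominated {X : Type*} [MeasurableSpace X] {μ : Measure X} {p : ℝ≥0∞}
    (hp : 1 ≤ p) (hpt : p ≠ ⊤) {F : ℕ → X → ℝ≥0∞} (hF : ∀ n, Measurable (F n)) {f B : X → ℝ≥0∞}
    (hB : eLpNorm B p μ < ⊤) (hFB : ∀ n x, F n x ≤ B x)
    (h : ∀ x, Filter.Tendsto (fun n => F n x) .atTop (nhds (f x))) :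
    Filter.Tendsto (fun n => eLpNorm (F n) p μ) .atTop (nhds (eLpNorm f p μ)) := by
  have hp0 : 0 < p.toReal := ENNReal.toReal_pos (by positivity) hpt
  simp only [eLpNorm_eq_lintegral_rpow_enorm_toReal (by positivity : p ≠ 0) hpt, enorm_eq_self]
  refine (ENNReal.continuous_rpow_const.tendsto _).comp ?_
  refine tendsto_lintegral_of_dominated_convergence (fun x => B x ^ p.toReal)
    (fun n => (hF n).pow_const _) (fun n => .of_forall fun x => ?_) ?_ (.of_forall fun x => ?_)
  · exact ENNReal.rpow_le_rpow (hFB n x) hp0.le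
  · have := lintegral_rpow_enorm_lt_top_of_eLpNorm_lt_top (by positivity : p ≠ 0) hpt hB
    simpa only [enorm_eq_self] using this.ne
  · exact (ENNReal.continuous_rpow_const.tendsto _).comp (h x)

theorem ae_lt_top_of_eLpNorm_lt_top {X : Type*} [MeasurableSpace X] {μ : Measure X} {p : ℝ≥0∞}
    (hp : 1 ≤ p) {f : X → ℝ≥0∞} (hf : Measurable f) (h : eLpNorm f p μ < ⊤) :
    ∀ᵐ x ∂μ, f x < ⊤ := by
  rcases eq_or_ne p ⊤ with rfl | hpt
  · filter_upwards [enorm_ae_le_eLpNormEssSup f μ] with x hx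
    exact hx.trans_lt h
  · have h1 := lintegral_rpow_enorm_lt_top_of_eLpNorm_lt_top (by positivity : p ≠ 0) hpt h
    simp only [enorm_eq_self] at h1
    filter_upwards [ae_lt_top (hf.pow_const _) h1.ne] with x hx
    by_contra htop
    rw [not_lt, top_le_iff] at htop
    rw [htop, ENNReal.top_rpow_of_pos (ENNReal.toReal_pos (by positivity) hpt)] at hx
    exact lt_irrefl _ hx

theorem ellNorm_le_liminf {q : ℝ≥0∞} (hq : 1 ≤ q) (w : I → ℝ) {a : ℕ → I → ℝ≥0∞} {b : I → ℝ≥0∞}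
    (h : ∀ i, b i ≤ Filter.liminf (fun n => a n i) .atTop) :
    ellNorm q w b ≤ Filter.liminf (fun n => ellNorm q w (a n)) .atTop := by
  let _ : MeasurableSpace I := ⊤
  simp only [ellNorm_eq_ellNorm_one q w, ellNorm_one_eq_eLpNorm hq]
  refine eLpNorm_le_liminf hq (fun n => measurable_from_top) (.of_forall fun i => ?_)
  rw [ENNReal.liminf_const_mul_of_ne_top ENNReal.ofReal_ne_top]
  gcongr
  exact h i

theorem tendsto_ellNorm_of_dominated {q : ℝ≥0∞} (hq : 1 ≤ q) (hqt : q ≠ ⊤) (w : I → ℝ)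
    {a : ℕ → I → ℝ≥0∞} {b B : I → ℝ≥0∞} (hB : ellNorm q w B < ⊤) (haB : ∀ n i, a n i ≤ B i)
    (h : ∀ i, Filter.Tendsto (fun n => a n i) .atTop (nhds (b i))) :
    Filter.Tendsto (fun n => ellNorm q w (a n)) .atTop (nhds (ellNorm q w b)) := by
  let _ : MeasurableSpace I := ⊤
  rw [ellNorm_eq_ellNorm_one q w, ellNorm_one_eq_eLpNorm hq] at hB
  simp only [ellNorm_eq_ellNorm_one q w, ellNorm_one_eq_eLpNorm hq]
  refine tendsto_eLpNorm_of_dominated hq hqt (fun n => measurable_from_top) hB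
    (fun n i => ?_) fun i => ?_
  · gcongr
    exact haB n i
  · exact ENNReal.Tendsto.const_mul (h i) (.inr ENNReal.ofReal_ne_top)

theorem tendsto_tsum_of_enorm_le {β : Type*} {a : ℕ → β → ℂ} {b : β → ℂ} {B : β → ℝ≥0∞}
    (hB : ∑' k, B k < ⊤) (haB : ∀ n k, ‖a n k‖ₑ ≤ B k)
    (h : ∀ k, Filter.Tendsto (fun n => a n k) .atTop (nhds (b k))) :
    Filter.Tendsto (fun n => ∑' k, a n k) .atTop (nhds (∑' k, b k)) := by
  refine tendsto_tsum_of_dominated_convergence (bound := fun k => (B k).toReal)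
    (ENNReal.summable_toReal hB.ne) h (.of_forall fun n k => ?_)
  rw [← toReal_enorm]
  exact ENNReal.toReal_mono (ENNReal.ne_top_of_tsum_ne_top hB.ne k) (haB n k)

theorem tendsto_integral_of_enorm_le {X : Type*} [MeasurableSpace X] {μ : Measure X}
    {a : ℕ → X → ℂ} {b : X → ℂ} {B : X → ℝ≥0∞} (ha : ∀ n, AEStronglyMeasurable (a n) μ)
    (hBm : Measurable B) (hB : ∫⁻ x, B x ∂μ < ⊤) (haB : ∀ n x, ‖a n x‖ₑ ≤ B x)
    (h : ∀ x, Filter.Tendsto (fun n => a n x) .atTop (nhds (b x))) :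
    Filter.Tendsto (fun n => ∫ x, a n x ∂μ) .atTop (nhds (∫ x, b x ∂μ)) := by
  refine tendsto_integral_of_dominated_convergence (fun x => (B x).toReal) ha
    (integrable_toReal_of_lintegral_ne_top hBm.aemeasurable hB.ne) (fun n => ?_) (.of_forall h)
  filter_upwards [ae_lt_top hBm hB.ne] with x hx
  rw [← toReal_enorm]
  exact ENNReal.toReal_mono hx.ne (haB n x)

namespace BAPU

variable (Φ : BAPU Q)

theorem decompositionNorm_le_liminf {p q : ℝ≥0∞} (hq : 1 ≤ q) (w : I → ℝ)
    {u : ℕ → FourierDistribution Ω} {f : FourierDistribution Ω}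
    (h : ∀ m, ∀ᵐ x, Filter.Tendsto (fun n => Φ.piece (u n) m x) .atTop
      (nhds (Φ.piece f m x))) :
    Φ.decompositionNorm p q w f ≤
      Filter.liminf (fun n => Φ.decompositionNorm p q w (u n)) .atTop :=
  ellNorm_le_liminf hq w fun m => Lp.eLpNorm_lim_le_liminf_eLpNorm
    (fun n => (Φ.continuous_piece (u n) m).aestronglyMeasurable) _ (h m)

theorem tendsto_decompositionNorm {p q : ℝ≥0∞} (hp : 1 ≤ p) (hpt : p ≠ ⊤) (hq : 1 ≤ q)
    (hqt : q ≠ ⊤) {w : I → ℝ} (hw : ∀ i, 0 < w i)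
    {u : ℕ → FourierDistribution Ω} {f : FourierDistribution Ω} {H : I → Eucl d → ℝ≥0∞}
    (hH : ellNorm q w (fun m => eLpNorm (H m) p volume) < ⊤)
    (huH : ∀ n m x, ‖Φ.piece (u n) m x‖ₑ ≤ H m x)
    (h : ∀ m x, Filter.Tendsto (fun n => Φ.piece (u n) m x) .atTop (nhds (Φ.piece f m x))) :
    Filter.Tendsto (fun n => Φ.decompositionNorm p q w (u n)) .atTop
      (nhds (Φ.decompositionNorm p q w f)) := by
  refine tendsto_ellNorm_of_dominated hq hqt w hH (fun n m => ?_) fun m => ?_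
  · exact eLpNorm_mono_enorm fun x => (huH n m x).trans (enorm_eq_self _).ge
  · have := tendsto_eLpNorm_of_dominated (μ := volume) hp hpt
      (fun n => (Φ.continuous_piece (u n) m).enorm.measurable)
      (lt_top_of_ellNorm_lt_top hq hw hH m) (fun n x => huH n m x)
      (fun x => (continuous_enorm.tendsto _).comp (h m x))
    simpa only [Function.comp_def, eLpNorm_enorm] using this

variable {Φ} {h : Eucl d → ℂ}

/-- Each piece is a finite sum of convolution integrals, and their integrands converge pointwise.
Dominated convergence works at the points x where the majorant, known only to be in L^p, is finite.
-/
theorem IsTame.tendsto_piece_multiplier (hh : Φ.IsTame h) {p : ℝ≥0∞} (hp : 1 ≤ p)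
    {u g : ℕ → FourierDistribution Ω} {f t : FourierDistribution Ω} {H : I → Eucl d → ℝ≥0∞}
    (hHm : ∀ i, Measurable (H i)) (hH : ∀ i, eLpNorm (H i) p volume < ⊤)
    (huH : ∀ n m x, ‖Φ.piece (u n) m x‖ₑ ≤ H m x)
    (hf : ∀ i, eLpNorm (Φ.piece f i) p volume < ⊤)
    (hlim : ∀ ψ, Filter.Tendsto (fun n => (u n).fourier ψ) .atTop (nhds (f.fourier ψ)))
    (hg : ∀ n, HasSum (Φ.multiplierTerm h (u n)) (g n)) (ht : HasSum (Φ.multiplierTerm h f) t)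
    (m : I) : ∀ᵐ x, Filter.Tendsto (fun n => Φ.piece (g n) m x) .atTop
      (nhds (Φ.piece t m x)) := by
  have := Φ.countable_index
  obtain ⟨C, hC, hker⟩ := hh.exists_lintegral_multKernel_le
  have hfin : ∀ i, ∀ᵐ x, Φ.multBound h H i m x < ⊤ := fun i => by
    have h1 : eLpNorm (Φ.multBound h H i m) p volume < ⊤ :=
      (hh.eLpNorm_multBound_le hp hHm i m).trans_lt (ENNReal.mul_lt_top ((hker i).trans_lt hC)
        (ENNReal.mul_lt_top Φ.bounded (hH i)))
    have h2 := ae_lt_top_of_eLpNorm_lt_top hp (hh.measurable_multBound hHm i m) h1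
    exact h2
  filter_upwards [ae_all_iff.2 hfin] with x hx
  rw [hh.piece_multiplier hp hf ht]
  have hu : ∀ n i, eLpNorm (Φ.piece (u n) i) p volume < ⊤ := fun n i =>
    (eLpNorm_mono_enorm fun x => (huH n i x).trans (enorm_eq_self _).ge).trans_lt (hH i)
  simp only [fun n => hh.piece_multiplier hp (hu n) (hg n) m x]
  refine tendsto_finsetSum _ fun i _ => ?_
  have hLm : Measurable fun z => Φ.locBound H i m (x - z) :=
    (Φ.measurable_locBound hHm i m).comp (measurable_const.sub measurable_id)
  refine tendsto_integral_of_enorm_le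
    (B := fun z => ‖Φ.multKernel h i z‖ₑ * Φ.locBound H i m (x - z)) (fun n => ?_)
    ((hh.continuous_multKernel i).enorm.measurable.mul hLm) ?_ (fun n z => ?_) fun z => ?_
  · exact ((hh.continuous_multKernel i).mul (((u n).fourier.continuous_locFn _).comp
      (continuous_const.sub continuous_id))).aestronglyMeasurable
  · have h1 := lintegral_sub_left_eq_self (μ := volume)
      (fun z => ‖Φ.multKernel h i z‖ₑ * Φ.locBound H i m (x - z)) x
    simp only [sub_sub_cancel] at h1
    rw [← h1]
    exact hx i
  · rw [enorm_mul]
    gcongr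
    exact Φ.enorm_locFn_mulSmooth_le (huH n) i m _
  · exact (hlim _).const_mul _

end BAPU

namespace GSISystem

variable {G : GSISystem d J} {Φ : BAPU Q}

theorem tendsto_extendedPairing {u : ℕ → FourierDistribution Ω} {f : FourierDistribution Ω}
    {H : I → Eucl d → ℝ≥0∞} (huH : ∀ n i x, ‖∑ l ∈ Q.neighbors i, Φ.piece (u n) l x‖ₑ ≤ H i x)
    (hlim : ∀ ψ, Filter.Tendsto (fun n => (u n).fourier ψ) .atTop (nhds (f.fourier ψ)))
    {j : J} {k : Fin d → ℤ} (hfin : G.coeffBound Φ H j k < ⊤) :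
    Filter.Tendsto (fun n => Φ.extendedPairing (u n) (G.atom j k) (G.contDiff_fourier_atom j k))
      .atTop (nhds (Φ.extendedPairing f (G.atom j k) (G.contDiff_fourier_atom j k))) := by
  refine tendsto_tsum_of_enorm_le hfin (fun n i => ?_) fun i => hlim _
  refine (G.enorm_pairingTerm_le Φ (u n) i j k).trans (lintegral_mono fun y => ?_)
  gcongr
  exact huH n i y

/-- The coefficients converge by domination in the inner products. The series over (j, k) is then
dominated wherever the frame bound is finite, which is almost everywhere. -/
theorem tendsto_piece_frame [Countable J] {p : ℝ≥0∞} (hp : 1 ≤ p)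
    {u s : ℕ → FourierDistribution Ω} {f t : FourierDistribution Ω} {H : I → Eucl d → ℝ≥0∞}
    (hH : ∀ m, eLpNorm (G.frameBound Φ H m) p volume < ⊤)
    (huH : ∀ n i x, ‖∑ l ∈ Q.neighbors i, Φ.piece (u n) l x‖ₑ ≤ H i x)
    (hlim : ∀ ψ, Filter.Tendsto (fun n => (u n).fourier ψ) .atTop (nhds (f.fourier ψ)))
    (hs : ∀ n, HasSum (G.frameTerm Φ (u n)) (s n)) (ht : HasSum (G.frameTerm Φ f) t) (m : I) :
    ∀ᵐ x, Filter.Tendsto (fun n => Φ.piece (s n) m x) .atTop (nhds (Φ.piece t m x)) := by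
  filter_upwards [ae_lt_top_of_eLpNorm_lt_top hp (G.measurable_frameBound Φ H m) (hH m)] with x hx
  rw [← (Φ.hasSum_piece ht m x).tsum_eq]
  simp only [← fun n => (Φ.hasSum_piece (hs n) m x).tsum_eq]
  refine tendsto_tsum_of_enorm_le
    (B := fun jk : J × (Fin d → ℤ) => G.coeffBound Φ H jk.1 jk.2 * ‖G.locAtom Φ m jk.1 jk.2 x‖ₑ)
    ?_ (fun n jk => ?_) fun jk => ?_
  · rw [ENNReal.tsum_prod (f := fun j k => G.coeffBound Φ H j k * ‖G.locAtom Φ m j k x‖ₑ)]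
    exact hx
  · obtain ⟨j, k⟩ := jk
    rw [piece_frameTerm, enorm_mul]
    gcongr
    exact G.enorm_extendedPairing_le (huH n) _ _
  · obtain ⟨j, k⟩ := jk
    simp only [piece_frameTerm]
    exact (tendsto_extendedPairing huH hlim (G.coeffBound_lt_top Φ hp hH _ _)).mul_const _

end GSISystem

end

noncomputable section

variable {d : ℕ} {Ω : Opens (Eucl d)} {I J : Type*} {Q : AdmissibleCover Ω I}

/-! ### The operators on the decomposition spaces -/

theorem FourierDistribution.exists_linearMap {ι : Type*} {V : Submodule ℂ (FourierDistribution Ω)}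
    {T : FourierDistribution Ω → ι → FourierDistribution Ω}
    (h : ∀ f ∈ V, ∃ g ∈ V, HasSum (T f) g)
    (hadd : ∀ f ∈ V, ∀ g ∈ V, ∀ a b c, HasSum (T f) a → HasSum (T g) b → HasSum (T (f + g)) c →
      c = a + b)
    (hsmul : ∀ (r : ℂ), ∀ f ∈ V, ∀ a b, HasSum (T f) a → HasSum (T (r • f)) b → b = r • a) :
    ∃ S : V →ₗ[ℂ] V, ∀ f : V, HasSum (T f) (S f : FourierDistribution Ω) := by
  choose! S hSV hS using h
  refine ⟨{ toFun := fun f => ⟨S f, hSV f f.2⟩, map_add' := fun f g => ?_,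
            map_smul' := fun r f => ?_ }, fun f => hS f f.2⟩
  · exact Subtype.ext (hadd f f.2 g g.2 _ _ _ (hS f f.2) (hS g g.2) (hS _ (f + g).2))
  · exact Subtype.ext (hsmul r f f.2 _ _ (hS f f.2) (hS _ (r • f).2))

theorem FourierDistribution.exists_eq_add {V : Submodule ℂ (FourierDistribution Ω)}
    (S T : V →ₗ[ℂ] V) : ∃ R : V →ₗ[ℂ] V, S = T + R ∧
      ∀ f, (R f : FourierDistribution Ω) = S f - T f := by
  have hR : ∀ f, ((S + (-1 : ℂ) • T) f : FourierDistribution Ω) = S f - T f := fun f => by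
    change (S f : FourierDistribution Ω) + (-1 : ℂ) • (T f : FourierDistribution Ω) = _
    rw [neg_one_smul, sub_eq_add_neg]
  refine ⟨S + (-1 : ℂ) • T, LinearMap.ext fun f => Subtype.ext ?_, hR⟩
  change (S f : FourierDistribution Ω) = T f + ((S + (-1 : ℂ) • T) f : V)
  rw [hR, add_sub_cancel]

namespace BAPU

variable {Φ : BAPU Q} {h : Eucl d → ℂ}

theorem IsTame.ae_integrable_multKernel_mul (hh : Φ.IsTame h) {p : ℝ≥0∞} (hp : 1 ≤ p)
    {f : FourierDistribution Ω} (hf : ∀ i, eLpNorm (Φ.piece f i) p volume < ⊤) (i m : I) :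
    ∀ᵐ x, Integrable fun z => Φ.multKernel h i z *
      f.fourier.locFn ((Φ.fn i).mulSmooth (Φ.fn m) (Φ.fn m).contDiff) (x - z) := by
  obtain ⟨C, hC, hker⟩ := hh.exists_lintegral_multKernel_le
  have hHm : ∀ i, Measurable fun x => ‖Φ.piece f i x‖ₑ := fun i =>
    (Φ.continuous_piece f i).enorm.measurable
  have h1 : eLpNorm (Φ.multBound h (fun i x => ‖Φ.piece f i x‖ₑ) i m) p volume < ⊤ := by
    refine (hh.eLpNorm_multBound_le hp hHm i m).trans_lt (ENNReal.mul_lt_top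
      ((hker i).trans_lt hC) (ENNReal.mul_lt_top Φ.bounded ?_))
    rw [eLpNorm_enorm]
    exact hf i
  filter_upwards [ae_lt_top_of_eLpNorm_lt_top hp (hh.measurable_multBound hHm i m) h1] with x hx
  refine ⟨((hh.continuous_multKernel i).mul ((f.fourier.continuous_locFn _).comp
    (continuous_const.sub continuous_id))).aestronglyMeasurable, ?_⟩
  have h2 := lintegral_sub_left_eq_self (μ := volume) (fun z => ‖Φ.multKernel h i z‖ₑ *
    Φ.locBound (fun i x => ‖Φ.piece f i x‖ₑ) i m (x - z)) x
  simp only [sub_sub_cancel] at h2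
  refine lt_of_le_of_lt (lintegral_mono fun z => ?_) (h2.symm.trans_lt hx)
  rw [enorm_mul]
  gcongr
  exact Φ.enorm_locFn_mulSmooth_le (fun _ _ => le_rfl) i m _

/-- Additivity of the integrals defining the pieces requires integrability, which is available only
for almost every x; equality of pieces almost everywhere is enough. -/
theorem IsTame.multiplier_add (hh : Φ.IsTame h) {p : ℝ≥0∞} (hp : 1 ≤ p)
    {f g a b c : FourierDistribution Ω} (hf : ∀ i, eLpNorm (Φ.piece f i) p volume < ⊤)
    (hg : ∀ i, eLpNorm (Φ.piece g i) p volume < ⊤)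
    (ha : HasSum (Φ.multiplierTerm h f) a) (hb : HasSum (Φ.multiplierTerm h g) b)
    (hc : HasSum (Φ.multiplierTerm h (f + g)) c) : c = a + b := by
  have := Φ.countable_index
  refine Φ.fourier_injective_of_piece fun m => ?_
  have hfg : ∀ i, eLpNorm (Φ.piece (f + g) i) p volume < ⊤ := fun i =>
    (eLpNorm_add_le (Φ.continuous_piece f i).aestronglyMeasurable
      (Φ.continuous_piece g i).aestronglyMeasurable hp).trans_lt
        (ENNReal.add_lt_top.2 ⟨hf i, hg i⟩)
  filter_upwards [ae_all_iff.2 fun i => hh.ae_integrable_multKernel_mul hp hf i m,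
    ae_all_iff.2 fun i => hh.ae_integrable_multKernel_mul hp hg i m] with x hx hx'
  change _ = Φ.piece a m x + Φ.piece b m x
  rw [hh.piece_multiplier hp hf ha, hh.piece_multiplier hp hg hb, hh.piece_multiplier hp hfg hc,
    ← Finset.sum_add_distrib]
  refine Finset.sum_congr rfl fun i _ => ?_
  rw [← integral_add (hx i) (hx' i)]
  exact integral_congr_ae (.of_forall fun z => mul_add _ _ _)

theorem IsTame.multiplier_smul (hh : Φ.IsTame h) {p : ℝ≥0∞} (hp : 1 ≤ p)
    {f a b : FourierDistribution Ω} (r : ℂ) (hf : ∀ i, eLpNorm (Φ.piece f i) p volume < ⊤)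
    (ha : HasSum (Φ.multiplierTerm h f) a) (hb : HasSum (Φ.multiplierTerm h (r • f)) b) :
    b = r • a := by
  refine Φ.fourier_injective_of_piece fun m => .of_forall fun x => ?_
  have hrf : ∀ i, eLpNorm (Φ.piece (r • f) i) p volume < ⊤ := fun i => by
    have h1 := eLpNorm_const_smul r (Φ.piece f i) p volume
    exact h1.trans_lt (ENNReal.mul_lt_top enorm_lt_top (hf i))
  change _ = r * Φ.piece a m x
  rw [hh.piece_multiplier hp hf ha, hh.piece_multiplier hp hrf hb, Finset.mul_sum]
  refine Finset.sum_congr rfl fun i _ => ?_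
  rw [← integral_const_mul]
  exact integral_congr_ae (.of_forall fun z => mul_left_comm _ _ _)

/-- The Fourier multiplier with a tame symbol as a bounded operator. -/
theorem IsTame.exists_multiplier (hh : Φ.IsTame h) {p q : ℝ≥0∞} (hp : 1 ≤ p) (hq : 1 ≤ q)
    {w : I → ℝ} (hw : Q.IsModerate w) :
    ∃ T : Φ.decompositionSpace hp hq w →ₗ[ℂ] Φ.decompositionSpace hp hq w,
      (∀ f : Φ.decompositionSpace hp hq w, HasSum (Φ.multiplierTerm h f) (T f : FourierDistribution Ω)) ∧
      ∃ C : ℝ≥0, ∀ f : Φ.decompositionSpace hp hq w,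
        Φ.decompositionNorm p q w (T f) ≤ C * Φ.decompositionNorm p q w f := by
  obtain ⟨C, hC⟩ := hh.exists_hasSum_multiplierTerm hq hw
  have hpiece : ∀ f ∈ Φ.decompositionSpace hp hq w, ∀ i,
      eLpNorm (Φ.piece f i) p volume < ⊤ := fun f hf =>
    lt_top_of_ellNorm_lt_top hq hw.1 hf
  obtain ⟨T, hT⟩ := FourierDistribution.exists_linearMap (V := Φ.decompositionSpace hp hq w)
    (T := Φ.multiplierTerm h)
    (fun f hf => by
      obtain ⟨g, hg, hgn⟩ := hC hp hf
      exact ⟨g, hgn.trans_lt (ENNReal.mul_lt_top ENNReal.coe_lt_top hf), hg⟩)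
    (fun f hf g hg a b c ha hb hc =>
      hh.multiplier_add hp (hpiece f hf) (hpiece g hg) ha hb hc)
    (fun r f hf a b ha hb => hh.multiplier_smul hp r (hpiece f hf) ha hb)
  refine ⟨T, hT, C, fun f => ?_⟩
  obtain ⟨g, hg, hgn⟩ := hC hp f.2
  rwa [(hT f).unique hg]

end BAPU

/-! ### The frame operator and the bound for S − T_0 -/

namespace GSISystem

variable [Countable J] {G : GSISystem d J} {Φ : BAPU Q} {p q : ℝ≥0∞} {w : I → ℝ} {v : J → ℝ}

/-- The frame operator as a bounded operator. -/
theorem exists_frameOperator (hp : 1 ≤ p) (hq : 1 ≤ q) (hw : Q.IsModerate w)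
    (hv : ∀ j, 0 < v j) (hA : G.IsAdapted Φ w v) :
    ∃ S : Φ.decompositionSpace hp hq w →ₗ[ℂ] Φ.decompositionSpace hp hq w,
      (∀ f : Φ.decompositionSpace hp hq w, HasSum (G.frameTerm Φ f) (S f : FourierDistribution Ω)) ∧
      ∃ C : ℝ≥0, ∀ f : Φ.decompositionSpace hp hq w,
        Φ.decompositionNorm p q w (S f) ≤ C * Φ.decompositionNorm p q w f := by
  have := Φ.countable_index
  have hsum := fun f (hf : f ∈ Φ.decompositionSpace hp hq w) j k =>
    (G.summable_pairingTerm hp hq hw hv hA hf j k).of_norm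
  have hCtop : schurNorm (G.adaptMatrix Φ w v) ^ 2 * Q.clusteringNorm w q < ⊤ :=
    ENNReal.mul_lt_top (ENNReal.pow_lt_top hA) (Q.clusteringNorm_lt_top hq hw)
  have hex := fun f (hf : f ∈ Φ.decompositionSpace hp hq w) =>
    G.exists_hasSum_frameTerm hp hq hw hv hA hf
  obtain ⟨S, hS⟩ := FourierDistribution.exists_linearMap (V := Φ.decompositionSpace hp hq w)
    (T := G.frameTerm Φ)
    (fun f hf => by
      obtain ⟨g, hg, hgn⟩ := hex f hf
      exact ⟨g, hgn.trans_lt (ENNReal.mul_lt_top hCtop hf), hg⟩)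
    (fun f hf g hg a b c ha hb hc => by
      refine hc.unique ?_
      have h1 := ha.add hb
      refine (funext fun jk => ?_ : G.frameTerm Φ (f + g) = _) ▸ h1
      rw [frameTerm, frameTerm, frameTerm, ← add_smul]
      congr 1
      exact (hsum f hf _ _).tsum_add (hsum g hg _ _))
    (fun r f hf a b ha hb => by
      refine hb.unique ?_
      have h1 := ha.const_smul r
      refine (funext fun jk => ?_ : G.frameTerm Φ (r • f) = _) ▸ h1
      rw [frameTerm, frameTerm, smul_smul]
      congr 1
      exact tsum_mul_left)
  refine ⟨S, hS, (schurNorm (G.adaptMatrix Φ w v) ^ 2 * Q.clusteringNorm w q).toNNReal,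
    fun f => ?_⟩
  obtain ⟨g, hg, hgn⟩ := hex f f.2
  rw [(hS f).unique hg, ENNReal.coe_toNNReal hCtop.ne]
  exact hgn

/-- The estimate on S_O passes to f along the dominated approximation: the pieces of the remainders
are differences of pieces of S f_n and T_0 f_n, which converge almost everywhere, and Fatou's lemma
needs no more. -/
theorem decompositionNorm_frame_sub_multiplier_le (hp : 1 ≤ p) (hq : 1 ≤ q)
    (hw : Q.IsModerate w) (hG : G.AlphaLIC Ω) (hN : schurNorm (G.matrixN Φ w) < ⊤)
    (ht : Φ.IsTame (G.t 0)) (hv : ∀ j, 0 < v j) (hA : G.IsAdapted Φ w v)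
    {f s t₀ : FourierDistribution Ω} (hf : Φ.decompositionNorm p q w f < ⊤)
    (hs : HasSum (G.frameTerm Φ f) s) (ht₀ : HasSum (Φ.multiplierTerm (G.t 0) f) t₀) :
    Φ.decompositionNorm p q w (s - t₀) ≤
      Φ.extensionConst p q w * schurNorm (G.matrixN Φ w) * Q.clusteringNorm w q *
        Φ.decompositionNorm p q w f := by
  have := Φ.countable_index
  have hΓ := Q.clusteringNorm_lt_top hq hw
  obtain ⟨φ, hφH, hφ⟩ := Φ.exists_approximation f
  set u : ℕ → FourierDistribution Ω := fun n =>
    .ofFun Ω (𝓕⁻ (testToSchwartz Ω (φ n)) : 𝓢(Eucl d, ℂ)) with hu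
  have hun : ∀ n, Φ.decompositionNorm p q w (u n) < ⊤ := fun n =>
    Φ.decompositionNorm_fourierInv_test_lt_top hq w (φ n)
  have hHle := Φ.ellNorm_approxBound_le hp hq hw hf
  have hHfin := hHle.trans_lt (ENNReal.mul_lt_top (ENNReal.mul_lt_top Φ.bounded
    (ENNReal.pow_lt_top hΓ)) hf)
  have hHm := Φ.measurable_approxBound f
  choose S hS hSn using fun n => G.exists_hasSum_frameTerm hp hq hw hv hA (hun n)
  obtain ⟨C, hC⟩ := ht.exists_hasSum_multiplierTerm hq hw
  choose T hT hTn using fun n => hC hp (hun n)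
  have hR : ∀ n, S n = T n + G.remainder Ω (𝓕⁻ (testToSchwartz Ω (φ n))) := fun n =>
    frame_eq_multiplier_add_remainder hG ht (locNorm_lt_top_of_isAdapted hw.1 hv hA) (φ n)
      (hS n) (hT n)
  -- The frame coefficients see clustered pieces, so the common majorant is clustered once more.
  -- This affects only finiteness, not the final constant.
  let H' : I → Eucl d → ℝ≥0∞ := fun i x => ∑ l ∈ Q.neighbors i, Φ.approxBound f l x
  have hH'm : ∀ i, Measurable (H' i) := fun i => Finset.measurable_sum _ fun l _ => hHm l
  have hH' : ∀ n i x, ‖∑ l ∈ Q.neighbors i, Φ.piece (u n) l x‖ₑ ≤ H' i x := fun n i x =>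
    (enorm_sum_le _ _).trans (Finset.sum_le_sum fun l _ => hφH n l x)
  have hH'fin : ellNorm q w (fun i => eLpNorm (H' i) p volume) < ⊤ :=
    (ellNorm_mono q w fun i => eLpNorm_finsetSum_enorm_le hp hHm).trans_lt
      ((Q.ellNorm_sum_neighbors_le hq hw.1 hHfin).trans_lt (ENNReal.mul_lt_top hΓ hHfin))
  have hframe := lt_top_of_ellNorm_lt_top hq hw.1
    ((G.ellNorm_frameBound_le Φ hp hq hw.1 hv hH'm).trans_lt
      (ENNReal.mul_lt_top (ENNReal.pow_lt_top hA) hH'fin))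
  have hlimS := tendsto_piece_frame hp hframe hH' hφ hS hs
  have hlimT := ht.tendsto_piece_multiplier hp hHm (lt_top_of_ellNorm_lt_top hq hw.1 hHfin) hφH
    (lt_top_of_ellNorm_lt_top hq hw.1 hf) hφ hT ht₀
  have hfatou := Φ.decompositionNorm_le_liminf hq (p := p) w
    (u := fun n => G.remainder Ω (𝓕⁻ (testToSchwartz Ω (φ n)))) (f := s - t₀) fun m => by
      filter_upwards [hlimS m, hlimT m] with x hx hx'
      have h1 : ∀ n, Φ.piece (G.remainder Ω (𝓕⁻ (testToSchwartz Ω (φ n)))) m x =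
          Φ.piece (S n) m x - Φ.piece (T n) m x := fun n => by
        rw [hR n]
        exact (add_sub_cancel_left _ _).symm
      simp only [h1]
      exact hx.sub hx'
  have hrem : ∀ n, Φ.decompositionNorm p q w (G.remainder Ω (𝓕⁻ (testToSchwartz Ω (φ n)))) ≤
      schurNorm (G.matrixN Φ w) * Q.clusteringNorm w q * Φ.decompositionNorm p q w (u n) :=
    fun n => decompositionNorm_remainder_le hG Φ hw hp hq (φ n)
  have hctop : schurNorm (G.matrixN Φ w) * Q.clusteringNorm w q ≠ ⊤ :=
    (ENNReal.mul_lt_top hN hΓ).ne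
  refine (hfatou.trans (Filter.liminf_le_liminf (.of_forall hrem))).trans ?_
  rw [BAPU.extensionConst]
  split_ifs with hpq
  -- For finite exponents dominated convergence makes the norms of f_n converge to that of f, so no
  -- constant is lost.
  · rw [max_lt_iff] at hpq
    have hlim := Φ.tendsto_decompositionNorm hp hpq.1.ne hq hpq.2.ne hw.1 hHfin hφH
      (f := f) fun m x => hφ _
    rw [one_mul]
    exact (ENNReal.Tendsto.const_mul hlim (.inr hctop)).liminf_eq.le
  -- With an infinite exponent the norms need not converge; they are replaced by the norm of the
  -- common majorant.
  · have hle : ∀ n, Φ.decompositionNorm p q w (u n) ≤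
        Φ.const * Q.clusteringNorm w q ^ 2 * Φ.decompositionNorm p q w f := fun n =>
      (ellNorm_mono q w fun m => eLpNorm_mono_enorm fun x =>
        (hφH n m x).trans (enorm_eq_self _).ge).trans hHle
    refine Filter.liminf_le_of_frequently_le (Filter.Frequently.of_forall fun n => ?_)
    refine (mul_le_mul' le_rfl (hle n)).trans (le_of_eq ?_)
    ring

end GSISystem

end

/-! ### Assembly of the three statements, with R_0 = S − T_0 -/

theorem mainTheorem8 {d : ℕ} {I J : Type*} [Countable J]
    (Ω : Opens (Eucl d)) (hΩ : volume (Ω : Set (Eucl d))ᶜ = 0)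
    (Q : AdmissibleCover Ω I) (Φ : BAPU Q)
    (w : I → ℝ) (hw : Q.IsModerate w) (G : GSISystem d J) :
    (G.AlphaLIC Ω → schurNorm (G.matrixN Φ w) < ⊤ →
      ∀ (p q : ℝ≥0∞) (hp : 1 ≤ p) (hq : 1 ≤ q),
        (∀ f ∈ schwartzFourierSupported Ω,
          Summable (fun α : {α : Eucl d // α ∈ G.frequencies ∧ α ≠ 0} =>
            G.remainderTerm Ω f α) ∧
          Φ.decompositionNorm p q w (G.remainder Ω f) ≤
            schurNorm (G.matrixN Φ w) * Q.clusteringNorm w q *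
              Φ.decompositionNorm p q w (FourierDistribution.ofFun Ω f)) ∧
        (Φ.IsTame (G.t 0) → (∃ v : J → ℝ, (∀ j, 0 < v j) ∧ G.IsAdapted Φ w v) →
          ∃ S T₀ R₀ : Φ.decompositionSpace hp hq w →ₗ[ℂ] Φ.decompositionSpace hp hq w,
            (∀ f : Φ.decompositionSpace hp hq w,
              (∀ j k, Summable fun i =>
                ‖Φ.pairingTerm f (G.atom j k) (G.contDiff_fourier_atom j k) i‖) ∧
              HasSum (G.frameTerm Φ f) (S f : FourierDistribution Ω)) ∧
            (∃ C : ℝ≥0, ∀ f : Φ.decompositionSpace hp hq w,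
              Φ.decompositionNorm p q w (S f) ≤ C * Φ.decompositionNorm p q w f) ∧
            (∀ f : Φ.decompositionSpace hp hq w,
              HasSum (Φ.multiplierTerm (G.t 0) f) (T₀ f : FourierDistribution Ω)) ∧
            (∃ C : ℝ≥0, ∀ f : Φ.decompositionSpace hp hq w,
              Φ.decompositionNorm p q w (T₀ f) ≤ C * Φ.decompositionNorm p q w f) ∧
            S = T₀ + R₀ ∧
            (∀ f ∈ schwartzFourierSupported Ω,
              ∃ hf : FourierDistribution.ofFun Ω f ∈ Φ.decompositionSpace hp hq w,
                (R₀ ⟨FourierDistribution.ofFun Ω f, hf⟩ : FourierDistribution Ω) =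
                  G.remainder Ω f) ∧
            ∀ f : Φ.decompositionSpace hp hq w,
              Φ.decompositionNorm p q w (R₀ f) ≤
                Φ.extensionConst p q w * schurNorm (G.matrixN Φ w) * Q.clusteringNorm w q *
                  Φ.decompositionNorm p q w f)) ∧
    (schurNorm (G.matrixNTilde Φ w) < ⊤ →
      G.AlphaLIC Ω ∧ schurNorm (G.matrixN Φ w) ≤ schurNorm (G.matrixNTilde Φ w)) := by
  refine ⟨fun hG hN p q hp hq => ⟨?_, fun ht ⟨v, hv, hA⟩ => ?_⟩, fun hN =>
    ⟨G.alphaLIC_of_matrixNTilde Φ w hN, schurNorm_mono (G.matrixN_le_matrixNTilde Φ w)⟩⟩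
  · rintro _ ⟨φ, rfl⟩
    obtain ⟨L, hL⟩ := GSISystem.exists_hasSum_remainderTerm hG φ
    exact ⟨hL.summable, GSISystem.decompositionNorm_remainder_le hG Φ hw hp hq φ⟩
  · obtain ⟨S, hS, hSn⟩ := GSISystem.exists_frameOperator (G := G) (Φ := Φ) hp hq hw hv hA
    obtain ⟨T₀, hT₀, hTn⟩ := ht.exists_multiplier hp hq hw
    obtain ⟨R₀, hR, hRf⟩ := FourierDistribution.exists_eq_add S T₀
    refine ⟨S, T₀, R₀, fun f => ⟨fun j k => G.summable_pairingTerm hp hq hw hv hA f.2 j k,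
      hS f⟩, hSn, hT₀, hTn, hR, ?_, fun f => ?_⟩
    · rintro f ⟨φ, hφ⟩
      obtain rfl : 𝓕⁻ (testToSchwartz Ω φ) = f := hφ
      let F : Φ.decompositionSpace hp hq w :=
        ⟨_, Φ.decompositionNorm_fourierInv_test_lt_top hq w φ⟩
      refine ⟨F.2, ?_⟩
      have h1 := GSISystem.frame_eq_multiplier_add_remainder hG ht
        (GSISystem.locNorm_lt_top_of_isAdapted hw.1 hv hA) φ (hS F) (hT₀ F)
      change (R₀ F : FourierDistribution Ω) = _
      rw [hRf F, h1, add_sub_cancel_left]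
    · rw [hRf]
      exact GSISystem.decompositionNorm_frame_sub_multiplier_le hp hq hw hG hN ht hv hA f.2
        (hS f) (hT₀ f)
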